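/- **Setting.** Let $n\ge 0$ and let $H=H(x,p,u):\mathbb R^n\times\mathbb R^n\times\mathbb R\to\mathbb R$. All sub-, super- and solutions are continuous viscosity ones on $\mathbb R^n$. Let $$c(H)=\inf\{a\in\mathbb R:\ H(x,Du,0)=a \text{ has a continuous viscosity subsolution in }\mathbb R^n\}.$$ **Assumptions.** * $(\mathcal H_1)$ $H$ is continuous, nondecreasing in $u$, convex in $p$, and for all compact $K\subset\mathbb R^n$, $I\subset\mathbb R$, $\lim_{r\to\infty}\inf\{H(x,p,u):x\in K,\ |p|\ge r,\ u\in I\}=+\infty$. * $(\mathcal H_2)$ For some $\varepsilon>0$, $\limsup_{|x|\to\infty}\max_{|p|\le\varepsilon}H(x,p,0)<\max_{x}\min_{p}H(x,p,0)<\infty$. * $(\mathcal H_3)$ $H$ is differentiable in $u$; for every $R>0$ there are $0<\underline\kappa_R\le\overline\kappa_R$ with $\underline\kappa_R\le\partial_uH(x,p,u)\le\overline\kappa_R$ for all $x\in\mathbb R^n$, $|p|\le R$, $u\in\mathbb R$, and there is a modulus $\omega_R$ (with $\omega_R(r)\to0$ as $r\to0^+$) such that $\left|\frac{H(x,p,u)-H(x,p,0)}{u}-\partial_uH(x,p,0)\right|\le\omega_R(|u|)$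 for $|x|,|p|\le R$, $u\neq0$. * $(\mathcal H_4)$ $H$ is differentiable in $u$ and $\partial_uH\le\overline\kappa$ everywhere, for some constant $\overline\kappa$. * $(\mathcal P_1)$ $(\mathcal H_4)$, and for some $\theta\in(0,1)$, $C_\theta>0$: $H(x,\theta p,u)\le H(x,p,u)+C_\theta$ for all $(x,p,u)$. * $(\mathcal P_2)$ $(\mathcal H_4)$, $H$ is convex in $(p,u)$ for each $x$, and for some $\theta\in(0,1)$: for every $C$ there is $C_\theta>0$ such that $H(x,p,\theta u)\le C$ implies $H(x,p,u)\le C_\theta$, for all $(x,p,u)$. * $(\mathcal P_3)$ $(\mathcal H_3)$; for all $R,C>0$, $\sup\{H(x,p,u):x\in\mathbb R^n,|p|\le R,|u|\le C\}<\infty$; for each $u_0$, $\inf_{x,p}H(x,p,u_0)>-\infty$; for each $C>0$, $\lim_{r\to\infty}\inf\{H(x,p,u):x\in\mathbb R^n,|p|\ge r,|u|\le C\}=+\infty$. **Lagrangian.** Let $G$ be either $\widehat H:=H+(\max\{0,H-c(H)\})^2$ or, if $H$ is superlinear in $p$ locally uniformly in $(x,u)$, $H$ itself. Put $L(x,v,u)=\sup_{p}(p\cdot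 v-G(x,p,u))$, and assume that $\partial_uL(x,v,0)$ exists for all $(x,v)$. **Limiting measures.** For $\lambda>0$ let $u_\lambda$ be the maximal solution of $H(x,Du,\lambda u)=c(H)$ in $\mathbb R^n$, that is, a solution that is $\geq$ every other solution. For $z\in\mathbb R^n$ let $\mathcal M_\lambda(z,\infty)$ be the set of locally absolutely continuous curves $\gamma:(-\infty,0]\to\mathbb R^n$ with $\gamma(0)=z$ that attain, for every $t>0$, the infimum in $$u_\lambda(z)=\inf_{\gamma(0)=z}\Big\{u_\lambda(\gamma(-t))+\int_{-t}^0\big(L(\gamma,\dot\gamma,\lambda u_\lambda(\gamma))+c(H)\big)\,ds\Big\}.$$ Let $K_\lambda(x,v)=\frac{L(x,v,\lambda u_\lambda(x))-L(x,v,0)}{\lambda u_\lambda(x)}$ if $u_\lambda(x)\ne0$, and let $K_\lambda(x,v)$ be the right derivative $\partial_u^+L(x,v,0)$ if $u_\lambda(x)=0$. Let $\beta^\lambda_\gamma(s)=\int_s^0K_\lambda(\gamma,\dot\gamma)\,d\tau$, and let $\mu^\lambda_\gamma$ be the probability measure on $\mathbb R^n\times\mathbb R^n$ with $$\int\phi\,d\mu^\lambda_\gamma=\frac{\int_{-\infty}^0e^{\lambda\beta^\lambda_\gamma(s)}\phi(\gamma(s),\dot\gamma(s))\,ds}{\int_{-\infty}^0e^{\lambda\beta^\lambda_\gamma(s)}\,ds},\qquad\phi\in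 C_c(\mathbb R^n\times\mathbb R^n).$$ Let $\mathfrak M$ be the set of all probability measures $\mu$ for which there are $z\in\mathbb R^n$, $\lambda_j\to0^+$ and $\gamma_j\in\mathcal M_{\lambda_j}(z,\infty)$ with $\int\phi\,d\mu^{\lambda_j}_{\gamma_j}\to\int\phi\,d\mu$ for all $\phi\in C_c(\mathbb R^n\times\mathbb R^n)$. **Theorem.** Assume $(\mathcal H_1)$–$(\mathcal H_3)$ and one of $(\mathcal P_1)$–$(\mathcal P_3)$. Then the maximal solution $u_\lambda$ exists for every $\lambda>0$, and as $\lambda\to0^+$ it converges locally uniformly in $\mathbb R^n$ to a solution $u_0\in C(\mathbb R^n)$ of $H(x,Du,0)=c(H)$ in $\mathbb R^n$. Moreover $u_0=\sup\mathcal E$ pointwise, where $$\mathcal E=\Big\{w\in C(\mathbb R^n):\ w\text{ is a subsolution of }H(x,Dw,0)=c(H),\ \int w(x)\,\partial_uL(x,v,0)\,d\mu(x,v)\ge0\ \text{ for all }\mu\in\mathfrak M\Big\}.$$ -/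

import Mathlib

open Set Filter Topology MeasureTheory

noncomputable section

namespace ContactHJ

/-- `ℝⁿ` with its Euclidean norm. -/
abbrev Space (n : ℕ) : Type := EuclideanSpace ℝ (Fin n)

/-- A Hamiltonian `H(x, p, u)`. -/
abbrev Hamiltonian (n : ℕ) : Type := Space n → Space n → ℝ → ℝ

variable {n : ℕ}

/-! ### Viscosity solutions -/

/-- `u` is a continuous viscosity subsolution of `H(x, Du, lam * u) = c` in `ℝⁿ`. -/
def IsSubsolution (H : Hamiltonian n) (c lam : ℝ) (u : Space n → ℝ) : Prop :=
  Continuous u ∧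
    ∀ φ : Space n → ℝ, ContDiff ℝ 1 φ →
      ∀ x, IsLocalMax (fun y => u y - φ y) x → H x (gradient φ x) (lam * u x) ≤ c

/-- `u` is a continuous viscosity supersolution of `H(x, Du, lam * u) = c` in `ℝⁿ`. -/
def IsSupersolution (H : Hamiltonian n) (c lam : ℝ) (u : Space n → ℝ) : Prop :=
  Continuous u ∧
    ∀ φ : Space n → ℝ, ContDiff ℝ 1 φ →
      ∀ x, IsLocalMin (fun y => u y - φ y) x → c ≤ H x (gradient φ x) (lam * u x)

/-- `u` is a continuous viscosity solution of `H(x, Du, lam * u) = c` in `ℝⁿ`. -/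
def IsSolution (H : Hamiltonian n) (c lam : ℝ) (u : Space n → ℝ) : Prop :=
  IsSubsolution H c lam u ∧ IsSupersolution H c lam u

/-- The critical value `c(H)`: the infimum of all `a` such that `H(x, Du, 0) = a` has a continuous
viscosity subsolution in `ℝⁿ`. -/
def criticalValue (H : Hamiltonian n) : ℝ :=
  sInf {a : ℝ | ∃ u : Space n → ℝ, IsSubsolution H a 0 u}

/-- `u` is the maximal solution of `H(x, Du, lam * u) = c(H)` in `ℝⁿ`. -/
def IsMaximalSolution (H : Hamiltonian n) (lam : ℝ) (u : Space n → ℝ) : Prop :=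
  IsSolution H (criticalValue H) lam u ∧
    ∀ v : Space n → ℝ, IsSolution H (criticalValue H) lam v → ∀ x, v x ≤ u x

/-! ### Assumptions on the Hamiltonian -/

/-- Continuity, monotonicity in `u`, convexity in `p`, local coercivity. -/
structure AssumptionH1 (H : Hamiltonian n) : Prop where
  continuous : Continuous fun z : Space n × Space n × ℝ => H z.1 z.2.1 z.2.2
  monotone : ∀ x p, Monotone (H x p)
  convex : ∀ x u, ConvexOn ℝ univ fun p => H x p u
  coercive : ∀ (K : Set (Space n)) (I : Set ℝ), IsCompact K → IsCompact I →
    ∀ M : ℝ, ∃ r : ℝ, ∀ x ∈ K, ∀ p : Space n, r ≤ ‖p‖ → ∀ u ∈ I, M ≤ H x p u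

/-- For some `ε > 0`,
`limsup_{|x| → ∞} max_{|p| ≤ ε} H(x, p, 0) < max_x min_p H(x, p, 0) < ∞`. -/
def AssumptionH2 (H : Hamiltonian n) : Prop :=
  ∃ ε > 0, ∃ m : ℝ,
    IsGreatest {b : ℝ | ∃ x, IsLeast (range fun p => H x p 0) b} m ∧
    ∃ a < m, ∀ᶠ x in cocompact (Space n), ∀ p : Space n, ‖p‖ ≤ ε → H x p 0 ≤ a

/-- Differentiability in `u`, with two-sided positive bounds on `∂_u H` that are local in `p`, and
a local modulus for the difference quotients at `u = 0`. -/
structure AssumptionH3 (H : Hamiltonian n) : Prop where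
  differentiable : ∀ x p, Differentiable ℝ (H x p)
  bounds : ∀ R > 0, ∃ κ > 0, ∃ κ' : ℝ, ∀ x p : Space n, ‖p‖ ≤ R → ∀ u : ℝ,
    κ ≤ deriv (H x p) u ∧ deriv (H x p) u ≤ κ'
  modulus : ∀ R > 0, ∃ ω : ℝ → ℝ, Tendsto ω (𝓝[>] 0) (𝓝 0) ∧
    ∀ x p : Space n, ‖x‖ ≤ R → ‖p‖ ≤ R → ∀ u : ℝ, u ≠ 0 →
      |(H x p u - H x p 0) / u - deriv (H x p) 0| ≤ ω |u|

/-- Differentiability in `u`, with a global upper bound on `∂_u H`. -/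
structure AssumptionH4 (H : Hamiltonian n) : Prop where
  differentiable : ∀ x p, Differentiable ℝ (H x p)
  bound : ∃ κ' : ℝ, ∀ x p u, deriv (H x p) u ≤ κ'

structure AssumptionP1 (H : Hamiltonian n) : Prop where
  h4 : AssumptionH4 H
  scaling : ∃ θ : ℝ, 0 < θ ∧ θ < 1 ∧ ∃ C > 0, ∀ x p u, H x (θ • p) u ≤ H x p u + C

structure AssumptionP2 (H : Hamiltonian n) : Prop where
  h4 : AssumptionH4 H
  jointlyConvex : ∀ x, ConvexOn ℝ univ fun q : Space n × ℝ => H x q.1 q.2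
  scaling : ∃ θ : ℝ, 0 < θ ∧ θ < 1 ∧ ∀ C : ℝ, ∃ C' > 0, ∀ x p u,
    H x p (θ * u) ≤ C → H x p u ≤ C'

structure AssumptionP3 (H : Hamiltonian n) : Prop where
  h3 : AssumptionH3 H
  boundedAbove : ∀ R > 0, ∀ C > 0, ∃ B : ℝ, ∀ x p : Space n, ‖p‖ ≤ R → ∀ u : ℝ, |u| ≤ C →
    H x p u ≤ B
  boundedBelow : ∀ u₀ : ℝ, ∃ B : ℝ, ∀ x p, B ≤ H x p u₀
  coercive : ∀ C > 0, ∀ M : ℝ, ∃ r : ℝ, ∀ x p : Space n, r ≤ ‖p‖ → ∀ u : ℝ, |u| ≤ C →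
    M ≤ H x p u

/-! ### Superlinear Hamiltonians and the Legendre transform -/

/-- Superlinear growth in `p`, locally uniformly in `(x, u)`. -/
def IsSuperlinear (H : Hamiltonian n) : Prop :=
  ∀ (K : Set (Space n)) (I : Set ℝ), IsCompact K → IsCompact I →
    ∀ M : ℝ, ∃ r : ℝ, ∀ x ∈ K, ∀ p : Space n, r ≤ ‖p‖ → ∀ u ∈ I, M * ‖p‖ ≤ H x p u

/-- The superlinear Hamiltonian `H + (max {0, H - c(H)})²`. -/
def superlinearization (H : Hamiltonian n) : Hamiltonian n :=
  fun x p u => H x p u + (max 0 (H x p u - criticalValue H)) ^ 2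

/-- The Legendre transform `L(x, v, u) = sup_p (p · v - H(x, p, u))`; it is finite everywhere for
a continuous superlinear Hamiltonian, and only used for these. -/
def lagrangian (H : Hamiltonian n) (x v : Space n) (u : ℝ) : ℝ :=
  ⨆ p : Space n, (inner ℝ p v - H x p u)

/-! ### Minimizing curves and limiting measures

Here `L` is a Lagrangian, `c` a constant, `lam > 0` and `u` a function on `ℝⁿ` (the maximal solution
for the parameter `lam`). Curves are functions on `ℝ` of which only the restriction to a backward
time interval is used. -/

/-- Curves `γ ∈ AC([-t, 0]; ℝⁿ)` with `γ(0) = z` and finite action. -/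
def IsAdmissible (L : Space n → Space n → ℝ → ℝ) (lam : ℝ) (u : Space n → ℝ)
    (z : Space n) (t : ℝ) (γ : ℝ → Space n) : Prop :=
  AbsolutelyContinuousOnInterval γ (-t) 0 ∧ γ 0 = z ∧
    IntervalIntegrable (fun s => L (γ s) (deriv γ s) (lam * u (γ s))) volume (-t) 0

/-- `u(γ(-t)) + ∫_{-t}^0 (L(γ, γ', lam * u(γ)) + c) ds`. -/
def action (L : Space n → Space n → ℝ → ℝ) (c lam : ℝ) (u : Space n → ℝ)
    (t : ℝ) (γ : ℝ → Space n) : ℝ :=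
  u (γ (-t)) + ∫ s in (-t)..0, (L (γ s) (deriv γ s) (lam * u (γ s)) + c)

/-- `γ` attains the minimum in `u(z) = inf_γ {u(γ(-t)) + ∫_{-t}^0 (L(γ, γ', lam * u(γ)) + c) ds}`. -/
def IsMinimizer (L : Space n → Space n → ℝ → ℝ) (c lam : ℝ) (u : Space n → ℝ)
    (z : Space n) (t : ℝ) (γ : ℝ → Space n) : Prop :=
  IsAdmissible L lam u z t γ ∧ u z = action L c lam u t γ ∧
    ∀ η : ℝ → Space n, IsAdmissible L lam u z t η → u z ≤ action L c lam u t η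

/-- Curves on `(-∞, 0]` that are minimizers on `[-t, 0]` for every `t > 0`. -/
def IsInfiniteMinimizer (L : Space n → Space n → ℝ → ℝ) (c lam : ℝ) (u : Space n → ℝ)
    (z : Space n) (γ : ℝ → Space n) : Prop :=
  ∀ t > 0, IsMinimizer L c lam u z t γ

open Classical in
/-- The discount index: the difference quotient of `L(x, v, ·)` between `0` and `lam * u(x)`, or the
right derivative at `0` where `u(x) = 0`. -/
def discountIndex (L : Space n → Space n → ℝ → ℝ) (lam : ℝ) (u : Space n → ℝ)
    (x v : Space n) : ℝ :=
  if u x = 0 then derivWithin (L x v) (Ici 0) 0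
  else (L x v (lam * u x) - L x v 0) / (lam * u x)

/-- The weight `exp (lam * β(s))`, where `β(s) = ∫_s^0 K(γ, γ') dτ` with the discount index `K`. -/
def weight (L : Space n → Space n → ℝ → ℝ) (lam : ℝ) (u : Space n → ℝ)
    (γ : ℝ → Space n) (s : ℝ) : ℝ :=
  Real.exp (lam * ∫ τ in s..0, discountIndex L lam u (γ τ) (deriv γ τ))

/-- `μ` is the discounted probability measure of the curve `γ`. -/
def IsDiscountedMeasure (L : Space n → Space n → ℝ → ℝ) (lam : ℝ) (u : Space n → ℝ)
    (γ : ℝ → Space n) (μ : Measure (Space n × Space n)) : Prop :=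
  IsProbabilityMeasure μ ∧
    ∀ φ : Space n × Space n → ℝ, Continuous φ → HasCompactSupport φ →
      ∫ q, φ q ∂μ =
        (∫ s in Iic (0 : ℝ), weight L lam u γ s * φ (γ s, deriv γ s)) /
          ∫ s in Iic (0 : ℝ), weight L lam u γ s

/-- The limiting measures: weak-* limits, as `lam → 0⁺`, of discounted measures of infinite
minimizers that end at a fixed point `z`, for all `z`. Here `u lam` is the solution for the
parameter `lam`. -/
def limitingMeasures (L : Space n → Space n → ℝ → ℝ) (c : ℝ) (u : ℝ → Space n → ℝ) :
    Set (Measure (Space n × Space n)) :=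
  {μ | IsProbabilityMeasure μ ∧
    ∃ (z : Space n) (lam : ℕ → ℝ) (γ : ℕ → ℝ → Space n)
      (ν : ℕ → Measure (Space n × Space n)),
      (∀ j, 0 < lam j) ∧ Tendsto lam atTop (𝓝 0) ∧
      (∀ j, IsInfiniteMinimizer L c (lam j) (u (lam j)) z (γ j)) ∧
      (∀ j, IsDiscountedMeasure L (lam j) (u (lam j)) (γ j) (ν j)) ∧
      ∀ φ : Space n × Space n → ℝ, Continuous φ → HasCompactSupport φ →
        Tendsto (fun j => ∫ q, φ q ∂(ν j)) atTop (𝓝 (∫ q, φ q ∂μ))}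

/-- The subsolutions `w` of `H(x, Dw, 0) = c(H)` with `∫ w(x) ∂_u L(x, v, 0) dμ ≥ 0` for all
measures `μ` in a given set. -/
def constrainedSubsolutions (H : Hamiltonian n) (L : Space n → Space n → ℝ → ℝ)
    (𝔐 : Set (Measure (Space n × Space n))) : Set (Space n → ℝ) :=
  {w | IsSubsolution H (criticalValue H) 0 w ∧
    ∀ μ ∈ 𝔐, Integrable (fun q : Space n × Space n => w q.1 * deriv (L q.1 q.2) 0) μ ∧
      0 ≤ ∫ q : Space n × Space n, w q.1 * deriv (L q.1 q.2) 0 ∂μ}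

end ContactHJ

end

namespace ContactHJ

variable {n : ℕ}

/-! ### Pointwise viscosity inequalities -/

/-! Existence is Perron's method. By (H2), outside a ball every momentum of norm at most `ε` lies
strictly below the critical level, so constants and shallow cones are strict subsolutions there.
Truncating a critical subsolution far away gives a bounded nonpositive subsolution of all the
discounted equations (`exists_bounded_subsolution`). Conversely, a discounted subsolution that is
positive on the whole ball could be glued with a cone and a constant into a subsolution at a level
below `c(H)`; hence it is nonpositive somewhere in the ball (`exists_nonpos_of_isSubsolution`). With
coercivity this gives local bounds and local Lipschitz bounds, uniform in `λ ≤ 1`, so the solutions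
are precompact as `λ → 0`.

The Hamiltonian `G` agrees with `H` where `H ≤ c(H)` and is larger elsewhere, so solutions for `H`
are solutions for `G`, whose Lagrangian is finite. Each `u_λ` has infinite minimizers: they are
limits of a discrete scheme (`IsTonelli.exists_step`, `Confinement.exists_curve`). For small `λ`
they stay in a fixed compact set, since far away the running cost is at least `ε|v| + δ` while `u_λ`
is bounded below everywhere and above on balls. Along a minimizer, `d/ds u_λ(γ) = L(γ, γ', λ u_λ) +
c = λ K u_λ + L(γ, γ', 0) + c`. Multiplying by the weight, whose derivative is `-λ K` times itself,
and integrating gives `θ u_λ(z) = ∫ (L(x, v, 0) + c) dν`, where `θ` is the inverse of the total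
weight and is comparable to `λ`. A subsolution `w` of the equation with parameter `λ'` satisfies `θ
w(z) + λ ∫ K w dν ≤ ∫ (L(x, v, λ' w) + c) dν`. Both are in `IsDiscount.weighted_inequalities`.

These relations identify every subsequential limit `U`. Letting `λ → 0` with `w` and `λ'` fixed
gives `∫ (L(x, v, 0) + c) dμ = 0` and `∫ (L(x, v, λ' w) + c) dμ ≥ 0` for each limiting measure `μ`
(`limitingMeasures_spec`). Taking `w = u_λ'`, subtracting, dividing by `λ'` and letting `λ' → 0`
shows that `U` satisfies the constraint. In the other direction, `λ' = 0` gives `θ (w(z) - u_λ(z)) ≤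
-λ ∫ K w dν`. If `U(z) < w(z)`, dividing by `λ` yields in the limit a measure `μ` with `∫ w ∂_u L dμ
< 0`, which the constraint on `w` forbids. So `U` is the greatest element of the constrained set; it
does not depend on the subsequence, and the whole family converges. -/

/-- The viscosity subsolution inequality for `F(x, Dv) ≤ c` at the point `x`. -/
def SubAt (F : Space n → Space n → ℝ) (c : ℝ) (v : Space n → ℝ) (x : Space n) : Prop :=
  ∀ φ : Space n → ℝ, ContDiff ℝ 1 φ →
    IsLocalMax (fun y => v y - φ y) x → F x (gradient φ x) ≤ c

theorem isSubsolution_iff {H : Hamiltonian n} {c lam : ℝ} {u : Space n → ℝ} :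
    IsSubsolution H c lam u ↔
      Continuous u ∧ ∀ x, SubAt (fun y p => H y p (lam * u y)) c u x :=
  ⟨fun h => ⟨h.1, fun x φ hφ hx => h.2 φ hφ x hx⟩, fun h => ⟨h.1, fun φ hφ x hx => h.2 x φ hφ hx⟩⟩

theorem SubAt.mono {F F' : Space n → Space n → ℝ} {c c' : ℝ} {v : Space n → ℝ} {x : Space n}
    (h : SubAt F c v x) (hF : ∀ p, F x p ≤ c → F' x p ≤ c') : SubAt F' c' v x :=
  fun φ hφ hx => hF _ (h φ hφ hx)

/-- If `w` touches `v` from above at `x`, then `w` inherits the subsolution inequality. -/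
theorem SubAt.of_le {F : Space n → Space n → ℝ} {c : ℝ} {v w : Space n → ℝ} {x : Space n}
    (h : SubAt F c v x) (hle : ∀ᶠ y in 𝓝 x, v y ≤ w y) (hx : v x = w x) : SubAt F c w x := by
  intro φ hφ hmax
  refine h φ hφ ?_
  filter_upwards [hmax, hle] with y h1 h2
  linarith

theorem hasGradientAt_quadratic (k : ℝ) (a y : Space n) :
    HasGradientAt (fun z => k * ‖z - a‖ ^ 2) ((2 * k) • (y - a)) y := by
  rw [hasGradientAt_iff_hasFDerivAt]
  have h := (((hasFDerivAt_id (𝕜 := ℝ) y).sub_const a).norm_sq).const_mul k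
  refine h.congr_fderiv ?_
  ext q
  simp
  ring

theorem contDiff_quadratic (k : ℝ) (a : Space n) :
    ContDiff ℝ 1 (fun z : Space n => k * ‖z - a‖ ^ 2) := by
  exact contDiff_const.mul ((contDiff_id.sub contDiff_const).norm_sq ℝ)

set_option maxHeartbeats 1000000 in
/-- Mean value inequality: a bound on `p · q` for all superjets `p` near a segment in the
direction `q` bounds the increment along the segment. -/
theorem increment_le_of_subAt {v : Space n → ℝ} (hv : Continuous v) {x q : Space n} {A T ρ : ℝ}
    (hT : 0 ≤ T) (hρ : 0 < ρ)
    (h : ∀ s ∈ Icc 0 T, ∀ y, ‖y - (x + s • q)‖ ≤ ρ → SubAt (fun _ p => inner ℝ p q) A v y) :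
    v (x + T • q) - v x ≤ T * A := by
  refine le_of_forall_pos_le_add fun ε hε => ?_
  obtain ⟨ε', hε', hε'T⟩ : ∃ ε' > 0, ε' * T + ε' ≤ ε :=
    ⟨ε / (T + 1), by positivity, by field_simp; linarith⟩
  obtain ⟨δ, hδ, hδv⟩ := Metric.continuous_iff.1 hv x ε' hε'
  set D : Set (ℝ × Space n) := Icc 0 T ×ˢ Metric.closedBall 0 ρ with hD
  have hDc : IsCompact D := isCompact_Icc.prod (isCompact_closedBall 0 ρ)
  have hDne : D.Nonempty := ⟨(0, 0), by simp [hD, hT, hρ.le]⟩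
  have hg : Continuous fun z : ℝ × Space n => v (x + z.1 • q + z.2) - z.1 * (A + ε') := by fun_prop
  obtain ⟨B, hB⟩ := hDc.exists_bound_of_continuousOn hg.continuousOn
  set r := min ρ δ with hr
  have hr0 : 0 < r := lt_min hρ hδ
  -- The penalty must exceed the oscillation of the unpenalized function as soon as `‖e‖ ≥ r`; this
  -- keeps the maximizer inside the tube and within `δ` of the segment.
  obtain ⟨k, hk0, hk⟩ : ∃ k : ℝ, 0 < k ∧ 2 * B < k * r ^ 2 := by
    refine ⟨(2 * |B| + 1) / r ^ 2, by positivity, ?_⟩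
    rw [div_mul_cancel₀ _ (by positivity)]
    linarith [le_abs_self B]
  -- The point `x + s • q + e` is free in a tube around the segment, and the quadratic penalty on
  -- `e` supplies the test function. At the maximum its gradient `2k e` is a superjet of `v`, so its
  -- product with `q` is at most `A`.
  have hΨ : Continuous fun z : ℝ × Space n =>
      v (x + z.1 • q + z.2) - z.1 * (A + ε') - k * ‖z.2‖ ^ 2 := by fun_prop
  obtain ⟨⟨s, e⟩, hse, hmax⟩ := hDc.exists_isMaxOn hDne hΨ.continuousOn
  have hmax' : ∀ s' e', s' ∈ Icc 0 T → ‖e'‖ ≤ ρ →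
      v (x + s' • q + e') - s' * (A + ε') - k * ‖e'‖ ^ 2 ≤
      v (x + s • q + e) - s * (A + ε') - k * ‖e‖ ^ 2 := fun s' e' h1 h2 =>
    hmax (show (s', e') ∈ D by simp [hD, h2, h1.1, h1.2])
  have hs : s ∈ Icc 0 T := hse.1
  have he : ‖e‖ ≤ ρ := by simpa [hD] using hse.2
  have her : ‖e‖ < r := by
    have h1 := hmax' s 0 hs (by simpa using hρ.le)
    have h2 := abs_le.1 (hB (s, e) hse)
    have h3 := abs_le.1 (hB (s, 0) (by simp [hD, hs.1, hs.2, hρ.le]))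
    simp only [norm_zero] at h1 h2 h3
    by_contra hcon
    have : r ^ 2 ≤ ‖e‖ ^ 2 := by gcongr; exact not_lt.1 hcon
    nlinarith
  have heρ : ‖e‖ < ρ := her.trans_le (min_le_left _ _)
  have hsub := h s hs (x + s • q + e) (by simpa using he) (fun z => k * ‖z - (x + s • q)‖ ^ 2)
    (contDiff_quadratic k _) (by
      have : ∀ᶠ y in 𝓝 (x + s • q + e), ‖y - (x + s • q)‖ < ρ := by
        refine ContinuousAt.eventually_lt (by fun_prop) (by fun_prop) (by simpa using heρ)
      filter_upwards [this] with y hy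
      have := hmax' s (y - (x + s • q)) hs hy.le
      simp only [add_sub_cancel, add_sub_cancel_left] at this ⊢
      linarith)
  rw [(hasGradientAt_quadratic k (x + s • q) _).gradient] at hsub
  simp only [add_sub_cancel_left, inner_smul_left] at hsub
  -- The pairs `(s, e)` and `(s - t, e + t • q)` name the same point of space. Moving back gains `t
  -- (A + ε')` and costs only `t A + O(t²)`, so a maximum with `s > 0` is impossible.
  have hs0 : s = 0 := by
    by_contra hne
    have hspos : 0 < s := lt_of_le_of_ne hs.1 (Ne.symm hne)
    have hev : ∀ᶠ t in 𝓝[>] (0 : ℝ), t < s ∧ ‖e + t • q‖ < ρ ∧ k * t * ‖q‖ ^ 2 < ε' := by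
      refine ((ContinuousAt.eventually_lt (by fun_prop) (by fun_prop) (by simpa)).and
        ((ContinuousAt.eventually_lt (by fun_prop) (by fun_prop) (by simpa)).and
        (ContinuousAt.eventually_lt (by fun_prop) (by fun_prop) (by simpa)))).filter_mono
          nhdsWithin_le_nhds
    obtain ⟨t, ⟨ht1, ht2, ht3⟩, ht0⟩ := (hev.and self_mem_nhdsWithin).exists
    have ht0 : 0 < t := ht0
    have h1 := hmax' (s - t) (e + t • q) ⟨by linarith, by linarith [hs.2]⟩ ht2.le
    have h2 : x + (s - t) • q + (e + t • q) = x + s • q + e := by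
      rw [sub_smul]; abel
    rw [h2, norm_add_sq_real, inner_smul_right, norm_smul, mul_pow, Real.norm_eq_abs, sq_abs] at h1
    simp at hsub
    nlinarith
  subst hs0
  have h1 := hmax' T 0 ⟨hT, le_rfl⟩ (by simpa using hρ.le)
  have h2 := hδv (x + e) (by simpa using her.trans_le (min_le_right _ _))
  rw [Real.dist_eq] at h2
  have h3 := (abs_lt.1 h2).2
  have h4 : 0 ≤ k * ‖e‖ ^ 2 := by positivity
  simp at h1
  nlinarith

/-- Directional difference quotients of `v` bound directional derivatives of test functions
touching from above. -/
theorem inner_gradient_le {v φ : Space n → ℝ} {x q : Space n} {A : ℝ} (hφ : DifferentiableAt ℝ φ x)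
    (hmax : IsLocalMax (fun y => v y - φ y) x)
    (h : ∀ᶠ t in 𝓝[>] (0 : ℝ), v x - v (x - t • q) ≤ t * A) : inner ℝ (gradient φ x) q ≤ A := by
  have hline : HasDerivAt (fun t : ℝ => x - t • q) (-q) 0 := by
    simpa using ((hasDerivAt_id (0 : ℝ)).smul_const q).const_sub x
  have hd : HasDerivAt (fun t : ℝ => φ (x - t • q)) (-(inner ℝ (gradient φ x) q)) 0 := by
    have h0 : HasFDerivAt φ (fderiv ℝ φ x) (x - (0 : ℝ) • q) := by simpa using hφ.hasFDerivAt
    have := h0.comp_hasDerivAt 0 hline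
    convert! this using 1
    simp [gradient, InnerProductSpace.toDual_symm_apply]
  have hs := (hasDerivAt_iff_tendsto_slope.1 hd).neg.mono_left
    (nhdsWithin_mono (0 : ℝ) (show Ioi (0 : ℝ) ⊆ {0}ᶜ from fun t (ht : 0 < t) => ht.ne'))
  rw [neg_neg] at hs
  refine le_of_tendsto hs ?_
  have hcont : Tendsto (fun t : ℝ => x - t • q) (𝓝[>] 0) (𝓝 x) := by
    have := hline.continuousAt.tendsto.mono_left (nhdsWithin_le_nhds (s := Ioi 0))
    simpa using this
  filter_upwards [h, hcont.eventually hmax, self_mem_nhdsWithin] with t h1 h2 ht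
  have ht : 0 < t := ht
  simp only [slope_def_field, zero_smul, sub_zero] at h2 ⊢
  rw [neg_le, le_div_iff₀ ht]
  linarith

/-- Moving from `x` against the gradient of the test function makes the one-sided Lipschitz bound
control its norm. -/
theorem subAt_norm_of_lipschitz {g : Space n → ℝ} {ε : ℝ} {x : Space n} (hε : 0 ≤ ε)
    (hg : ∀ y, g x - g y ≤ ε * ‖x - y‖) : SubAt (fun _ p => ‖p‖) ε g x := by
  intro φ hφ hmax
  have h := inner_gradient_le (q := gradient φ x) (A := ε * ‖gradient φ x‖)
    (hφ.differentiable one_ne_zero x) hmax (by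
      filter_upwards [self_mem_nhdsWithin] with t ht
      refine (hg _).trans (le_of_eq ?_)
      rw [sub_sub_cancel, norm_smul, Real.norm_of_nonneg (le_of_lt ht)]
      ring)
  rw [real_inner_self_eq_norm_sq] at h
  rcases (norm_nonneg (gradient φ x)).eq_or_lt with h0 | h0
  · simpa only [← h0] using hε
  · exact le_of_mul_le_mul_right (by rwa [← sq]) h0

/-- Superjets bounded by `M` on a ball give the Lipschitz constant `M` on smaller balls. -/
theorem lipschitz_of_subAt_norm {v : Space n → ℝ} (hv : Continuous v) {R R' M : ℝ} (hR : R < R')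
    (h : ∀ y, ‖y‖ ≤ R' → SubAt (fun _ p => ‖p‖) M v y) {x y : Space n} (hx : ‖x‖ ≤ R)
    (hy : ‖y‖ ≤ R) : |v y - v x| ≤ M * ‖y - x‖ := by
  have key : ∀ x y : Space n, ‖x‖ ≤ R → ‖y‖ ≤ R → v y - v x ≤ M * ‖y - x‖ := by
    intro x y hx hy
    have := increment_le_of_subAt hv (x := x) (q := y - x) (A := M * ‖y - x‖) (T := 1)
      (ρ := R' - R) zero_le_one (by linarith) ?_
    · simpa using this
    intro s hs z hz
    have h1 : ‖x + s • (y - x)‖ ≤ R := by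
      have := (convex_closedBall (0 : Space n) R) (x := x) (by simpa) (y := y) (by simpa)
        (a := 1 - s) (b := s) (by linarith [hs.2]) hs.1 (by ring)
      have h2 : x + s • (y - x) = (1 - s) • x + s • y := by
        rw [smul_sub, sub_smul, one_smul]; abel
      rw [h2]
      simpa using this
    have h3 : ‖z‖ ≤ R' := by
      have := norm_add_le (z - (x + s • (y - x))) (x + s • (y - x))
      rw [sub_add_cancel] at this
      linarith
    exact (h z h3).mono fun p hp => (real_inner_le_norm _ _).trans
      (mul_le_mul_of_nonneg_right hp (norm_nonneg _))
  rw [abs_le]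
  constructor
  · have := key y x hy hx
    rw [norm_sub_rev] at this
    linarith
  · exact key x y hx hy

/-! ### Convex coercive Hamiltonians and minima of subsolutions -/

/-- A Hamiltonian `F(x, p)`, continuous, convex in `p`, and coercive in `p` locally uniformly
in `x`. -/
structure IsCoerciveHamiltonian (F : Space n → Space n → ℝ) : Prop where
  continuous : Continuous fun z : Space n × Space n => F z.1 z.2
  convex : ∀ x, ConvexOn ℝ univ (F x)
  coercive : ∀ R M : ℝ, ∃ r : ℝ, ∀ x, ‖x‖ ≤ R → ∀ p, F x p ≤ M → ‖p‖ ≤ r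

theorem IsCoerciveHamiltonian.continuous_right {F : Space n → Space n → ℝ}
    (hF : IsCoerciveHamiltonian F) (x : Space n) : Continuous (F x) :=
  hF.continuous.comp (Continuous.prodMk_right x)

/-- Affine minorants of a convex Hamiltonian. -/
theorem exists_affine_minorant {f : Space n → ℝ} (hf : ConvexOn ℝ univ f) (hc : Continuous f)
    {p₀ : Space n} {a : ℝ} (ha : a < f p₀) :
    ∃ r : Space n, ∀ p, a + inner ℝ (p - p₀) r ≤ f p := by
  obtain ⟨l, b, hl, hlb⟩ := hf.exists_affine_le_of_lt (𝕜 := ℝ) (mem_univ p₀) ha isClosed_univ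
    (hc.lowerSemicontinuous.lowerSemicontinuousOn _)
  refine ⟨(InnerProductSpace.toDual ℝ (Space n)).symm l, fun p => ?_⟩
  have h1 := hl ⟨p, mem_univ p⟩
  simp only [Pi.add_apply, Function.const_apply, Set.domRestrict_apply, Function.comp_apply,
    RCLike.re_to_real] at h1 hlb
  rw [real_inner_comm, InnerProductSpace.toDual_symm_apply, map_sub]
  linarith

/-- Coercivity confines the sublevel sets at points near `x` to one compact ball of momenta, where
continuity is uniform. -/
theorem IsCoerciveHamiltonian.eventually_le {F : Space n → Space n → ℝ}
    (hF : IsCoerciveHamiltonian F) (x : Space n) (c : ℝ) {ε : ℝ} (hε : 0 < ε) :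
    ∀ᶠ y in 𝓝 x, ∀ p, F y p ≤ c → F x p ≤ c + ε := by
  obtain ⟨r, hr⟩ := hF.coercive (‖x‖ + 1) c
  have h1 : ∀ᶠ y in 𝓝 x, ∀ p ∈ Metric.closedBall (0 : Space n) r, F x p < F y p + ε := by
    refine (isCompact_closedBall 0 r).eventually_forall_of_forall_eventually fun p _ => ?_
    have hc := hF.continuous
    have hc2 := hF.continuous_right x
    exact ContinuousAt.eventually_lt (x₀ := (x, p)) (f := fun z : Space n × Space n => F x z.2)
      (g := fun z => F z.1 z.2 + ε) (by fun_prop) (by fun_prop) (by simpa)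
  have h2 : ∀ᶠ y in 𝓝 x, ‖y‖ < ‖x‖ + 1 :=
    ContinuousAt.eventually_lt (by fun_prop) (by fun_prop) (by simp)
  filter_upwards [h1, h2] with y hy1 hy2 p hp
  have := hy1 p (by simpa using hr y hy2.le p hp)
  linarith

/-- Difference quotients of subsolutions. -/
theorem eventually_slope_le {F : Space n → Space n → ℝ} (hF : IsCoerciveHamiltonian F) {c : ℝ}
    {v : Space n → ℝ} (hv : Continuous v) {x : Space n} (h : ∀ᶠ y in 𝓝 x, SubAt F c v y)
    {q : Space n} {A ε : ℝ} (hε : 0 < ε) (hA : ∀ p, F x p ≤ c + ε → inner ℝ p q ≤ A) :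
    ∀ᶠ t in 𝓝[>] (0 : ℝ), v x - v (x - t • q) ≤ t * A := by
  obtain ⟨ρ, hρ, hball⟩ := Metric.eventually_nhds_iff.1 (h.and (hF.eventually_le x c hε))
  have hev : ∀ᶠ t in 𝓝[>] (0 : ℝ), t * ‖q‖ < ρ / 2 := by
    refine Eventually.filter_mono nhdsWithin_le_nhds ?_
    exact ContinuousAt.eventually_lt (by fun_prop) (by fun_prop) (by simpa)
  filter_upwards [hev, self_mem_nhdsWithin] with t ht ht0
  have ht0 : 0 < t := ht0
  have := increment_le_of_subAt hv (x := x - t • q) (q := q) (A := A) (T := t) (ρ := ρ / 3)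
    ht0.le (by positivity) ?_
  · simpa using this
  intro s hs y hy
  have hyx : dist y x < ρ := by
    have h1 : y - x = (y - (x - t • q + s • q)) - (t - s) • q := by
      rw [sub_smul]; abel
    rw [dist_eq_norm, h1]
    refine (norm_sub_le _ _).trans_lt ?_
    rw [norm_smul, Real.norm_of_nonneg (by linarith [hs.2])]
    have : (t - s) * ‖q‖ ≤ t * ‖q‖ := by
      gcongr
      linarith [hs.1]
    linarith
  obtain ⟨h1, h2⟩ := hball hyx
  exact h1.mono fun p hp => hA p (h2 p hp)

/-- The minimum of two subsolutions is a subsolution at a point where they agree. -/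
theorem SubAt.min {F : Space n → Space n → ℝ} (hF : IsCoerciveHamiltonian F) {c : ℝ}
    {v g : Space n → ℝ} (hv : Continuous v) (hg : Continuous g) {x : Space n}
    (h : ∀ᶠ y in 𝓝 x, SubAt F c v y) (h' : ∀ᶠ y in 𝓝 x, SubAt F c g y) (hx : v x = g x) :
    SubAt F c (fun y => min (v y) (g y)) x := by
  intro φ hφ hmax
  by_contra hcon
  have hcon : c < F x (gradient φ x) := not_le.1 hcon
  set p₀ := gradient φ x with hp₀
  -- Convexity separates `p₀` from the sublevel set: in the direction `r`, all momenta of level at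
  -- most `c + δ` fall short of `p₀` by `δ`. Both functions then have backward difference quotients
  -- below `⟪p₀, r⟫ - δ`, and so has their minimum, contrary to the test function.
  obtain ⟨r, hr⟩ := exists_affine_minorant (hF.convex x) (hF.continuous_right x)
    (show (c + F x p₀) / 2 < F x p₀ by linarith)
  set δ := (F x p₀ - c) / 4 with hδ
  have hδ0 : 0 < δ := by rw [hδ]; linarith
  have hA : ∀ p, F x p ≤ c + δ → inner ℝ p r ≤ inner ℝ p₀ r - δ := by
    intro p hp
    have := hr p
    rw [inner_sub_left] at this
    linarith
  have h1 := eventually_slope_le hF hv h hδ0 hA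
  have h2 := eventually_slope_le hF hg h' hδ0 hA
  have := inner_gradient_le (hφ.differentiable one_ne_zero x) hmax (q := r)
    (A := inner ℝ p₀ r - δ) (by
      filter_upwards [h1, h2] with t h3 h4
      rcases min_cases (v (x - t • r)) (g (x - t • r)) with h5 | h5 <;>
        rcases min_cases (v x) (g x) with h6 | h6 <;> linarith)
  rw [← hp₀] at this
  linarith

/-! ### Stability and compactness -/

/-- Stability of subsolutions under half-relaxed limits. -/
theorem subAt_of_tendsto {H : Hamiltonian n}
    (hH : Continuous fun z : Space n × Space n × ℝ => H z.1 z.2.1 z.2.2)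
    {U : Space n → ℝ} (hU : Continuous U) {v : ℕ → Space n → ℝ} {lam c : ℝ} {lamj cj : ℕ → ℝ}
    (hlam : Tendsto lamj atTop (𝓝 lam)) (hc : Tendsto cj atTop (𝓝 c))
    (hv : ∀ᶠ j in atTop, IsSubsolution H (cj j) (lamj j) (v j)) {x : Space n}
    (hx : Tendsto (fun j => v j x) atTop (𝓝 (U x)))
    (hle : ∀ ε > 0, ∀ᶠ j in atTop, ∀ y ∈ Metric.closedBall x 1, v j y ≤ U y + ε) :
    SubAt (fun y p => H y p (lam * U y)) c U x := by
  intro φ hφ hmax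
  obtain ⟨r', hr', hball⟩ := Metric.eventually_nhds_iff.1 hmax
  -- The radius is at most `1` because the upper bound on `v j` is available only on the unit ball,
  -- and below `r'` so that the local maximum is available.
  obtain ⟨r, hr, hr1, hrr⟩ : ∃ r > 0, r ≤ 1 ∧ r < r' :=
    ⟨Min.min 1 (r' / 2), by positivity, min_le_left _ _, (min_le_right _ _).trans_lt (by linarith)⟩
  have hne : (Metric.closedBall x r).Nonempty := ⟨x, by simp [hr.le]⟩
  have hφc := hφ.continuous
  -- The added square makes the maximum at `x` strict, so the maximizers of the perturbed problems
  -- must converge to `x`. Continuity of `v j` holds only for large `j`, whence the implication.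
  have hex : ∀ j, ∃ y ∈ Metric.closedBall x r, Continuous (v j) →
      ∀ z ∈ Metric.closedBall x r,
        v j z - (φ z + 1 * ‖z - x‖ ^ 2) ≤ v j y - (φ y + 1 * ‖y - x‖ ^ 2) := by
    intro j
    by_cases hj : Continuous (v j)
    · obtain ⟨y, hy, hym⟩ := (isCompact_closedBall x r).exists_isMaxOn hne
        (f := fun z => v j z - (φ z + 1 * ‖z - x‖ ^ 2)) (by fun_prop)
      exact ⟨y, hy, fun _ z hz => hym hz⟩
    · exact ⟨x, by simp [hr.le], fun h => absurd h hj⟩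
  choose y hy hym using hex
  have hloc : ∀ z ∈ Metric.closedBall x r, U z - φ z ≤ U x - φ x := fun z hz =>
    hball ((Metric.mem_closedBall.1 hz).trans_lt hrr)
  have hsq : Tendsto (fun j => ‖y j - x‖ ^ 2) atTop (𝓝 0) := by
    rw [Metric.tendsto_nhds]
    intro ε hε
    filter_upwards [hle (ε / 3) (by positivity), hv, (Metric.tendsto_nhds.1 hx) (ε / 3)
      (by positivity)] with j h1 h2 h3
    have h4 := hym j h2.1 x (by simp [hr.le])
    have h5 := h1 (y j) (Metric.closedBall_subset_closedBall hr1 (hy j))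
    have h6 := hloc _ (hy j)
    rw [Real.dist_eq, abs_lt] at h3
    rw [Real.dist_eq, sub_zero, abs_of_nonneg (by positivity)]
    simp only [sub_self, norm_zero] at h4
    linarith [h3.1]
  have hyx : Tendsto y atTop (𝓝 x) := by
    rw [tendsto_iff_norm_sub_tendsto_zero]
    have := hsq.sqrt
    simpa [Real.sqrt_sq (norm_nonneg _)] using this
  have hvy : Tendsto (fun j => v j (y j)) atTop (𝓝 (U x)) := by
    rw [Metric.tendsto_nhds]
    intro ε hε
    have hUy := (hU.tendsto x).comp hyx
    have hφy := (hφc.tendsto x).comp hyx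
    filter_upwards [hle (ε / 3) (by positivity), hv, (Metric.tendsto_nhds.1 hx) (ε / 3)
      (by positivity), (Metric.tendsto_nhds.1 hUy) (ε / 3) (by positivity),
      (Metric.tendsto_nhds.1 hφy) (ε / 3) (by positivity)] with j h1 h2 h3 h4 h5
    have h6 := hym j h2.1 x (by simp [hr.le])
    have h7 := h1 (y j) (Metric.closedBall_subset_closedBall hr1 (hy j))
    simp only [Real.dist_eq, abs_lt, Function.comp_apply, sub_self, norm_zero] at h3 h4 h5 h6 ⊢
    have : 0 ≤ ‖y j - x‖ ^ 2 := by positivity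
    constructor <;> linarith [h3.1, h4.2, h5.1]
  have hgrad : ∀ z, HasGradientAt (fun z => φ z + 1 * ‖z - x‖ ^ 2)
      (gradient φ z + (2 * 1 : ℝ) • (z - x)) z := by
    intro z
    have := ((hφ.differentiable one_ne_zero z).hasGradientAt).hasFDerivAt.add
      (hasGradientAt_quadratic 1 x z).hasFDerivAt
    rw [← map_add] at this
    exact hasGradientAt_iff_hasFDerivAt.2 this
  have hgc : Continuous fun z => gradient φ z + (2 * 1 : ℝ) • (z - x) := by
    have : Continuous (gradient φ) :=
      (InnerProductSpace.toDual ℝ (Space n)).symm.continuous.comp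
        (hφ.continuous_fderiv one_ne_zero)
    fun_prop
  have hlim : Tendsto (fun j => H (y j) (gradient φ (y j) + (2 * 1 : ℝ) • (y j - x))
      (lamj j * v j (y j))) atTop (𝓝 (H x (gradient φ x) (lam * U x))) := by
    have h1 := ((hgc.tendsto x).comp hyx)
    simp only [sub_self, smul_zero, add_zero] at h1
    exact (hH.tendsto (x, gradient φ x, lam * U x)).comp
      (hyx.prodMk_nhds (h1.prodMk_nhds (hlam.mul hvy)))
  refine le_of_tendsto_of_tendsto hlim hc ?_
  filter_upwards [hv, hyx.eventually (Metric.ball_mem_nhds x hr)] with j h1 h2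
  rw [← (hgrad (y j)).gradient]
  refine h1.2 _ (hφ.add (contDiff_quadratic 1 x)) _ ?_
  filter_upwards [Metric.isOpen_ball.mem_nhds h2] with z hz
  exact hym j h1.1 z (Metric.ball_subset_closedBall hz)

/-- Locally uniform limits of subsolutions are subsolutions. -/
theorem isSubsolution_of_tendstoLocallyUniformly {H : Hamiltonian n}
    (hH : Continuous fun z : Space n × Space n × ℝ => H z.1 z.2.1 z.2.2)
    {U : Space n → ℝ} (hU : Continuous U) {v : ℕ → Space n → ℝ} {lam c : ℝ} {lamj cj : ℕ → ℝ}
    (hlam : Tendsto lamj atTop (𝓝 lam)) (hc : Tendsto cj atTop (𝓝 c))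
    (hv : ∀ᶠ j in atTop, IsSubsolution H (cj j) (lamj j) (v j))
    (hlim : TendstoLocallyUniformly v U atTop) : IsSubsolution H c lam U := by
  rw [isSubsolution_iff]
  refine ⟨hU, fun x => subAt_of_tendsto hH hU hlam hc hv
    (hlim.tendstoLocallyUniformlyOn.tendsto_at (mem_univ x)) fun ε hε => ?_⟩
  have := (tendstoLocallyUniformly_iff_forall_isCompact.1 hlim) _ (isCompact_closedBall x 1)
  filter_upwards [Metric.tendstoUniformlyOn_iff.1 this ε hε] with j hj y hy
  have := hj y hy
  rw [Real.dist_eq, abs_lt] at this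
  linarith [this.1]

/-- The reflected Hamiltonian is in general neither convex nor coercive, but stability needs only
continuity; so stability of supersolutions follows from that of subsolutions. -/
theorem isSupersolution_iff_neg {H : Hamiltonian n} {c lam : ℝ} {u : Space n → ℝ} :
    IsSupersolution H c lam u ↔
      IsSubsolution (fun x p s => -H x (-p) (-s)) (-c) lam (fun x => -u x) := by
  have hgr : ∀ (φ : Space n → ℝ) x, gradient (fun y => -φ y) x = -gradient φ x := by
    intro φ x
    simp [gradient, fderiv_fun_neg]
  constructor
  · rintro ⟨h1, h2⟩
    refine ⟨h1.neg, fun φ hφ x hx => ?_⟩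
    have := h2 (fun y => -φ y) hφ.neg x (by
      filter_upwards [hx] with y hy
      linarith)
    rw [hgr] at this
    simpa using this
  · rintro ⟨h1, h2⟩
    refine ⟨h1.neg.congr fun x => neg_neg (u x), fun φ hφ x hx => ?_⟩
    have := h2 (fun y => -φ y) hφ.neg x (by
      filter_upwards [hx] with y hy
      linarith)
    simpa [hgr] using this

theorem isSupersolution_of_tendstoLocallyUniformly {H : Hamiltonian n}
    (hH : Continuous fun z : Space n × Space n × ℝ => H z.1 z.2.1 z.2.2)
    {U : Space n → ℝ} (hU : Continuous U) {v : ℕ → Space n → ℝ} {lam c : ℝ} {lamj cj : ℕ → ℝ}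
    (hlam : Tendsto lamj atTop (𝓝 lam)) (hc : Tendsto cj atTop (𝓝 c))
    (hv : ∀ᶠ j in atTop, IsSupersolution H (cj j) (lamj j) (v j))
    (hlim : TendstoLocallyUniformly v U atTop) : IsSupersolution H c lam U := by
  rw [isSupersolution_iff_neg]
  refine isSubsolution_of_tendstoLocallyUniformly (cj := fun j => -cj j) (lamj := lamj)
    (v := fun j x => -v j x) ?_ hU.neg hlam hc.neg ?_ ?_
  · exact (hH.comp (f := fun z : Space n × Space n × ℝ => (z.1, -z.2.1, -z.2.2))
      (by fun_prop)).neg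
  · filter_upwards [hv] with j hj
    exact isSupersolution_iff_neg.1 hj
  · rw [Metric.tendstoLocallyUniformly_iff] at hlim ⊢
    simpa [dist_neg_neg] using hlim

/-- Arzelà–Ascoli for sequences that are asymptotically locally equi-Lipschitz. -/
theorem exists_subseq_tendstoLocallyUniformly {E Y : Type*} [NormedAddCommGroup E] [ProperSpace E]
    [NormedAddCommGroup Y] [ProperSpace Y] {f : ℕ → E → Y} (hb : ∀ x, ∃ C, ∀ j, ‖f j x‖ ≤ C)
    {M : ℝ → ℝ} {δ : ℕ → ℝ} (hδ : Tendsto δ atTop (𝓝 0))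
    (hf : ∀ R j x y, ‖x‖ ≤ R → ‖y‖ ≤ R → ‖f j x - f j y‖ ≤ M R * ‖x - y‖ + δ j) :
    ∃ (g : E → Y) (φ : ℕ → ℕ), StrictMono φ ∧
      TendstoLocallyUniformly (fun j => f (φ j)) g atTop ∧
      ∀ R x y, ‖x‖ ≤ R → ‖y‖ ≤ R → ‖g x - g y‖ ≤ M R * ‖x - y‖ := by
  choose C hC using hb
  set d := TopologicalSpace.denseSeq E
  -- Compactness of a countable product of balls replaces the diagonal extraction on a dense
  -- sequence. The error `δ j` in the Lipschitz bound admits discontinuous functions, such as step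
  -- curves.
  have hcpt : IsCompact (univ.pi fun i : ℕ => Metric.closedBall (0 : Y) (C (d i))) :=
    isCompact_univ_pi fun i => isCompact_closedBall _ _
  obtain ⟨a, -, φ, hφ, hlim⟩ := hcpt.tendsto_subseq (x := fun j i => f j (d i))
    (fun j i _ => by simpa using hC (d i) j)
  have hlim' : ∀ i, Tendsto (fun j => f (φ j) (d i)) atTop (𝓝 (a i)) := fun i =>
    (tendsto_pi_nhds.1 hlim) i
  have hδφ := hδ.comp hφ.tendsto_atTop
  have hcau : ∀ x, CauchySeq fun j => f (φ j) x := by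
    intro x
    rw [Metric.cauchySeq_iff']
    intro ε hε
    set m := |M (‖x‖ + 1)| + 1
    have hm : 0 < m := by positivity
    obtain ⟨_, hz, i, rfl⟩ := (TopologicalSpace.denseRange_denseSeq E).exists_mem_open
      (Metric.isOpen_ball (x := x) (ε := min 1 (ε / (8 * m)))) ⟨x, by simp; positivity⟩ |> fun ⟨i, hi⟩ =>
        (⟨_, hi, i, rfl⟩ : ∃ z, z ∈ Metric.ball x (min 1 (ε / (8 * m))) ∧ ∃ i, d i = z)
    rw [Metric.mem_ball, dist_comm, dist_eq_norm] at hz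
    have hz1 := hz.trans_le (min_le_left _ _)
    have hz2 := hz.trans_le (min_le_right _ _)
    have hdi : ‖d i‖ ≤ ‖x‖ + 1 := by
      have := norm_sub_norm_le (d i) x
      rw [norm_sub_rev] at this
      linarith
    have hclose : ∀ j, ‖f (φ j) x - f (φ j) (d i)‖ ≤ ε / 8 + δ (φ j) := by
      intro j
      refine (hf (‖x‖ + 1) (φ j) x (d i) (by linarith) hdi).trans ?_
      have h1 : M (‖x‖ + 1) * ‖x - d i‖ ≤ m * ‖x - d i‖ := by
        gcongr
        linarith [le_abs_self (M (‖x‖ + 1))]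
      have h2 : m * ‖x - d i‖ ≤ m * (ε / (8 * m)) := by gcongr
      have h3 : m * (ε / (8 * m)) = ε / 8 := by field_simp
      linarith
    obtain ⟨N, hN⟩ := (((Metric.tendsto_nhds.1 (hlim' i)) (ε / 8) (by positivity)).and
      ((Metric.tendsto_nhds.1 hδφ) (ε / 8) (by positivity))).exists_forall_of_atTop
    refine ⟨N, fun j hj => ?_⟩
    have e1 := hN j hj
    have e2 := hN N le_rfl
    simp only [Real.dist_eq, sub_zero, Function.comp_apply] at e1 e2
    have e3 := (dist_triangle_right (f (φ j) (d i)) (f (φ N) (d i)) (a i)).trans_lt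
      (add_lt_add e1.1 e2.1)
    have e4 := dist_triangle4 (f (φ j) x) (f (φ j) (d i)) (f (φ N) (d i)) (f (φ N) x)
    have e5 := hclose j
    have e6 := hclose N
    rw [← dist_eq_norm] at e5 e6
    rw [dist_comm] at e6
    linarith [abs_lt.1 e1.2, abs_lt.1 e2.2, (abs_lt.1 e1.2).2, (abs_lt.1 e2.2).2]
  choose g hg using fun x => cauchySeq_tendsto_of_complete (hcau x)
  have hgl : ∀ R x y, ‖x‖ ≤ R → ‖y‖ ≤ R → ‖g x - g y‖ ≤ M R * ‖x - y‖ := by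
    intro R x y hx hy
    have h1 : Tendsto (fun j => M R * ‖x - y‖ + δ (φ j)) atTop (𝓝 (M R * ‖x - y‖ + 0)) :=
      tendsto_const_nhds.add hδφ
    rw [add_zero] at h1
    exact le_of_tendsto_of_tendsto' ((hg x).sub (hg y)).norm h1 fun j => hf R (φ j) x y hx hy
  refine ⟨g, φ, hφ, ?_, hgl⟩
  rw [Metric.tendstoLocallyUniformly_iff]
  intro ε hε x
  set m := |M (‖x‖ + 1)| + 1
  have hm : 0 < m := by positivity
  refine ⟨Metric.ball x (min 1 (ε / (8 * m))), Metric.ball_mem_nhds _ (by positivity), ?_⟩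
  filter_upwards [(Metric.tendsto_nhds.1 (hg x)) (ε / 8) (by positivity),
    (Metric.tendsto_nhds.1 hδφ) (ε / 8) (by positivity)] with j h1 h2 y hy
  rw [Metric.mem_ball, dist_eq_norm] at hy
  have hz1 := hy.trans_le (min_le_left _ _)
  have hz2 := hy.trans_le (min_le_right _ _)
  have hdi : ‖y‖ ≤ ‖x‖ + 1 := by
    have := norm_sub_norm_le y x
    linarith
  have h3 : M (‖x‖ + 1) * ‖y - x‖ ≤ m * ‖y - x‖ := by
    gcongr
    linarith [le_abs_self (M (‖x‖ + 1))]
  have h4 : m * ‖y - x‖ ≤ m * (ε / (8 * m)) := by gcongr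
  have h5 : m * (ε / (8 * m)) = ε / 8 := by field_simp
  have h6 := hgl (‖x‖ + 1) y x hdi (by linarith)
  have h7 := hf (‖x‖ + 1) (φ j) y x hdi (by linarith)
  rw [← dist_eq_norm] at h6 h7
  have h8 := dist_triangle4 (g y) (g x) (f (φ j) x) (f (φ j) y)
  simp only [Real.dist_eq, sub_zero, Function.comp_apply] at h2
  have h9 := (abs_lt.1 h2).2
  rw [dist_comm] at h1
  rw [dist_comm (f (φ j) x)] at h8
  linarith

/-! ### Subsolutions of the critical and of the discounted equations -/

/-- Substituting a continuous function for the variable `u` brings the equation into the form `F(x,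
Du) ≤ c` used by the preceding lemmas. -/
theorem AssumptionH1.frozen {H : Hamiltonian n} (h1 : AssumptionH1 H) {w : Space n → ℝ}
    (hw : Continuous w) : IsCoerciveHamiltonian fun x p => H x p (w x) where
  continuous := h1.continuous.comp
    (f := fun z : Space n × Space n => (z.1, z.2, w z.1)) (by fun_prop)
  convex x := h1.convex x (w x)
  coercive R M := by
    obtain ⟨r, hr⟩ := h1.coercive (Metric.closedBall 0 R) (w '' Metric.closedBall 0 R)
      (isCompact_closedBall 0 R) ((isCompact_closedBall 0 R).image hw) (M + 1)
    refine ⟨r, fun x hx p hp => ?_⟩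
    by_contra hcon
    have hxm : x ∈ Metric.closedBall (0 : Space n) R := by simpa using hx
    have := hr x hxm p (not_le.1 hcon).le (w x) (mem_image_of_mem w hxm)
    linarith

theorem isSubsolution_max {H : Hamiltonian n} {c lam : ℝ} {v w : Space n → ℝ}
    (hv : IsSubsolution H c lam v) (hw : IsSubsolution H c lam w) :
    IsSubsolution H c lam fun x => max (v x) (w x) := by
  rw [isSubsolution_iff] at *
  refine ⟨hv.1.max hw.1, fun x => ?_⟩
  rcases le_total (v x) (w x) with h | h
  · refine ((hw.2 x).of_le (Eventually.of_forall fun y => le_max_right _ _)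
      (max_eq_right h).symm).mono fun p hp => ?_
    simpa only [max_eq_right h] using hp
  · refine ((hv.2 x).of_le (Eventually.of_forall fun y => le_max_left _ _)
      (max_eq_left h).symm).mono fun p hp => ?_
    simpa only [max_eq_left h] using hp

/-- Subsolutions with a given lower bound on `lam * u` are locally equi-Lipschitz. -/
theorem AssumptionH1.exists_lipschitz {H : Hamiltonian n} (h1 : AssumptionH1 H) (a B : ℝ) :
    ∃ M : ℝ → ℝ, (∀ R, 0 ≤ M R) ∧ ∀ lam u, IsSubsolution H a lam u → (∀ x, -B ≤ lam * u x) →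
      ∀ R x y, ‖x‖ ≤ R → ‖y‖ ≤ R → |u y - u x| ≤ M R * ‖y - x‖ := by
  -- By monotonicity in `u`, coercivity at the single value `-B` bounds all superjets; no upper
  -- bound on the subsolution is needed.
  have hF := h1.frozen (w := fun _ => -B) continuous_const
  choose r hr using fun R => hF.coercive (R + 1) a
  refine ⟨fun R => max 0 (r R), fun R => le_max_left _ _, fun lam u hu hB R x y hx hy => ?_⟩
  rw [isSubsolution_iff] at hu
  refine lipschitz_of_subAt_norm hu.1 (lt_add_one R) (fun z hz => ?_) hx hy
  exact (hu.2 z).mono fun p hp => (hr R z hz p ((h1.monotone z p (hB z)).trans hp)).trans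
    (le_max_right _ _)

theorem isSubsolution_zero_sub_const {H : Hamiltonian n} {a : ℝ} {u : Space n → ℝ}
    (hu : IsSubsolution H a 0 u) (b : ℝ) : IsSubsolution H a 0 fun x => u x - b := by
  refine ⟨hu.1.sub continuous_const, fun φ hφ x hx => ?_⟩
  have := hu.2 φ hφ x (by
    filter_upwards [hx] with y hy
    linarith)
  simpa using this

/-- If the level were lower, there would be no admissible momentum at any point near `x`. The mean
value inequality with direction `0` would then hold vacuously with `A = -1` and read `0 ≤ -1`. -/
theorem le_level_of_isLeast {H : Hamiltonian n} (h1 : AssumptionH1 H) {a b : ℝ} {x : Space n}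
    (hb : IsLeast (range fun p => H x p 0) b) {u : Space n → ℝ} (hu : IsSubsolution H a 0 u) :
    b ≤ a := by
  by_contra hcon
  have hcon : a < b := not_le.1 hcon
  have hF := h1.frozen (w := fun _ => 0) continuous_const
  obtain ⟨ρ, hρ, h⟩ := Metric.eventually_nhds_iff.1
    (hF.eventually_le x a (ε := (b - a) / 2) (by linarith))
  rw [isSubsolution_iff] at hu
  have := increment_le_of_subAt hu.1 (x := x) (q := 0) (A := -1) (T := 1) (ρ := ρ / 2)
    zero_le_one (by positivity) (fun s _ y hy => (hu.2 y).mono fun p hp => by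
      have h2 := h (y := y) (by rw [dist_eq_norm]; simp at hy; linarith) p (by simpa using hp)
      have h3 := hb.2 ⟨p, rfl⟩
      simp only at h3
      linarith)
  simp at this
  linarith

/-- Outside a ball, `H(x, p, 0)` is below a level `a < c(H)` for all small `p`. -/
theorem exists_level_lt_criticalValue {H : Hamiltonian n} (h1 : AssumptionH1 H)
    (h2 : AssumptionH2 H) :
    BddBelow {a : ℝ | ∃ u : Space n → ℝ, IsSubsolution H a 0 u} ∧
    {a : ℝ | ∃ u : Space n → ℝ, IsSubsolution H a 0 u}.Nonempty ∧
    ∃ ε > 0, ∃ R > 0, ∃ a < criticalValue H, ∀ x : Space n, R ≤ ‖x‖ → ∀ p : Space n,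
      ‖p‖ ≤ ε → H x p 0 ≤ a := by
  obtain ⟨ε, hε, m, ⟨⟨x₀, hx₀⟩, -⟩, a, ham, hev⟩ := h2
  have hbdd : m ∈ lowerBounds {a : ℝ | ∃ u : Space n → ℝ, IsSubsolution H a 0 u} := by
    rintro b ⟨u, hu⟩
    exact le_level_of_isLeast h1 hx₀ hu
  obtain ⟨R, hR0, hR⟩ : ∃ R > 0, ∀ x : Space n, R ≤ ‖x‖ → ∀ p : Space n,
      ‖p‖ ≤ ε → H x p 0 ≤ a := by
    obtain ⟨R, -, hR⟩ := (Metric.hasBasis_cobounded_compl_closedBall (0 : Space n)).eventually_iff.1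
      (by rwa [Metric.cobounded_eq_cocompact])
    refine ⟨max 1 (R + 1), by positivity, fun x hx => hR ?_⟩
    have := (le_max_right 1 (R + 1)).trans hx
    simp only [mem_compl_iff, Metric.mem_closedBall, dist_zero_right]
    linarith
  -- A constant function is a subsolution at any level above `H(x, 0, 0)`, which is bounded on the
  -- ball by compactness and outside it by (H2).
  have hne : {a : ℝ | ∃ u : Space n → ℝ, IsSubsolution H a 0 u}.Nonempty := by
    have hc : Continuous fun x : Space n => H x 0 0 :=
      h1.continuous.comp (f := fun x : Space n => (x, 0, 0)) (by fun_prop)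
    obtain ⟨B, hB⟩ := (isCompact_closedBall (0 : Space n) R).exists_bound_of_continuousOn
      hc.continuousOn
    refine ⟨max a B, fun _ => 0, isSubsolution_iff.2 ⟨continuous_const, fun x => ?_⟩⟩
    refine (subAt_norm_of_lipschitz (g := fun _ => 0) (ε := 0) le_rfl (fun y => by simp)).mono ?_
    intro p hp
    obtain rfl : p = 0 := by simpa using hp
    rcases le_total R ‖x‖ with h | h
    · simpa using Or.inl (hR x h 0 (by simpa using hε.le))
    · have := (abs_le.1 (hB x (by simpa using h))).2
      simpa using Or.inr this
  exact ⟨⟨m, hbdd⟩, hne, ε, hε, R, hR0, a, ham.trans_le (le_csInf hne hbdd), hR⟩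

/-- The infimum that defines the critical value is attained: subsolutions at levels decreasing to
it, normalized to vanish at `0`, are locally equi-Lipschitz, and their limit is a critical
subsolution. -/
theorem exists_critical_subsolution {H : Hamiltonian n} (h1 : AssumptionH1 H)
    (h2 : AssumptionH2 H) : ∃ w, IsSubsolution H (criticalValue H) 0 w := by
  obtain ⟨-, hne, -⟩ := exists_level_lt_criticalValue h1 h2
  set c := criticalValue H with hc
  have hex : ∀ j : ℕ, ∃ a u, a < c + 1 / ((j : ℝ) + 1) ∧ IsSubsolution H a 0 u ∧ u 0 = 0 := by
    intro j
    obtain ⟨a, ⟨u, hu⟩, ha⟩ := exists_lt_of_csInf_lt hne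
      (show sInf _ < c + 1 / ((j : ℝ) + 1) by
        rw [hc, criticalValue]
        linarith [show (0 : ℝ) < 1 / ((j : ℝ) + 1) by positivity])
    exact ⟨a, _, ha, isSubsolution_zero_sub_const hu (u 0), sub_self _⟩
  choose a u ha hu hu0 using hex
  have hu' : ∀ j : ℕ, IsSubsolution H (c + 1 / ((j : ℝ) + 1)) 0 (u j) := fun j =>
    ⟨(hu j).1, fun φ hφ x hx => ((hu j).2 φ hφ x hx).trans (ha j).le⟩
  have hu1 : ∀ j, IsSubsolution H (c + 1) 0 (u j) := fun j =>
    ⟨(hu j).1, fun φ hφ x hx => ((hu' j).2 φ hφ x hx).trans (by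
      have : 1 / ((j : ℝ) + 1) ≤ 1 := by
        rw [div_le_one (by positivity)]
        linarith [Nat.cast_nonneg (α := ℝ) j]
      linarith)⟩
  obtain ⟨M, hM0, hM⟩ := h1.exists_lipschitz (c + 1) 0
  have hL : ∀ R j x y, ‖x‖ ≤ R → ‖y‖ ≤ R → |u j y - u j x| ≤ M R * ‖y - x‖ := fun R j =>
    hM 0 (u j) (hu1 j) (by simp) R
  obtain ⟨g, φ, hφ, hlim, -⟩ := exists_subseq_tendstoLocallyUniformly (f := u) (M := M)
    (δ := fun _ => 0) (fun x => ⟨M ‖x‖ * ‖x‖, fun j => by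
      have := hL ‖x‖ j 0 x (by simp) le_rfl
      simpa [hu0] using this⟩) tendsto_const_nhds (fun R j x y hx hy => by
      simpa using hL R j y x hy hx)
  refine ⟨g, isSubsolution_of_tendstoLocallyUniformly h1.continuous
    (hlim.continuous (Frequently.of_forall fun j => (hu (φ j)).1)) tendsto_const_nhds ?_
    (Eventually.of_forall fun j => hu' (φ j)) hlim⟩
  have := (tendsto_one_div_add_atTop_nhds_zero_nat (𝕜 := ℝ)).comp hφ.tendsto_atTop
  simpa using this.const_add c

/-! ### A bounded subsolution and uniform bounds -/

/-- Truncating a subsolution by a subsolution from above. -/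
theorem subAt_min_cases {F : Space n → Space n → ℝ} (hF : IsCoerciveHamiltonian F) {c : ℝ}
    {v g : Space n → ℝ} (hv : Continuous v) (hg : Continuous g) {x : Space n}
    (h : v x ≤ g x → ∀ᶠ y in 𝓝 x, SubAt F c v y)
    (h' : g x ≤ v x → ∀ᶠ y in 𝓝 x, SubAt F c g y) :
    SubAt F c (fun y => min (v y) (g y)) x := by
  rcases lt_trichotomy (v x) (g x) with hlt | heq | hlt
  · refine (h hlt.le).self_of_nhds.of_le ?_ (min_eq_left hlt.le).symm
    filter_upwards [hv.continuousAt.eventually_lt hg.continuousAt hlt] with y hy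
    exact (min_eq_left hy.le).ge
  · exact SubAt.min hF hv hg (h heq.le) (h' heq.ge) heq
  · refine (h' hlt.le).self_of_nhds.of_le ?_ (min_eq_right hlt.le).symm
    filter_upwards [hg.continuousAt.eventually_lt hv.continuousAt hlt] with y hy
    exact (min_eq_right hy.le).ge

/-- There is a bounded nonpositive function that is a subsolution of all the equations. -/
theorem exists_bounded_subsolution {H : Hamiltonian n} (h1 : AssumptionH1 H)
    (h2 : AssumptionH2 H) : ∃ (w : Space n → ℝ) (N : ℝ), 0 ≤ N ∧ (∀ x, -N ≤ w x ∧ w x ≤ 0) ∧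
      ∀ lam, 0 ≤ lam → IsSubsolution H (criticalValue H) lam w := by
  obtain ⟨-, -, ε, hε, R, hR0, a, ha, hR⟩ := exists_level_lt_criticalValue h1 h2
  obtain ⟨w, hw⟩ := exists_critical_subsolution h1 h2
  obtain ⟨hwc, hws⟩ := isSubsolution_iff.1 hw
  simp only [zero_mul] at hws
  obtain ⟨B, hB⟩ := (isCompact_closedBall (0 : Space n) R).exists_bound_of_continuousOn
    hwc.continuousOn
  -- The constant exceeds `|w|` on the ball, so the truncations at `C` and `-C` act only outside it,
  -- where constants are subsolutions.
  set C := |B| + 1 with hC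
  have hC0 : 0 < C := by positivity
  have hwB : ∀ x, ‖x‖ ≤ R → |w x| < C := fun x hx => by
    have := hB x (by simpa using hx)
    rw [Real.norm_eq_abs] at this
    linarith [le_abs_self B]
  have hF := h1.frozen (w := fun _ => 0) continuous_const
  have hconst : ∀ (b : ℝ) (x : Space n), R ≤ ‖x‖ →
      SubAt (fun x p => H x p 0) (criticalValue H) (fun _ => b) x := by
    intro b x hx
    refine (subAt_norm_of_lipschitz (g := fun _ => b) (ε := 0) le_rfl (fun y => by simp)).mono ?_
    intro p hp
    exact (hR x hx p (hp.trans hε.le)).trans ha.le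
  have hmin : ∀ x, SubAt (fun x p => H x p 0) (criticalValue H) (fun y => min (w y) C) x := by
    intro x
    refine subAt_min_cases hF hwc continuous_const (fun _ => Eventually.of_forall hws) fun hx => ?_
    have hxR : R < ‖x‖ := by
      by_contra hcon
      have := (abs_lt.1 (hwB x (not_lt.1 hcon))).2
      linarith
    filter_upwards [continuousAt_const.eventually_lt continuous_norm.continuousAt hxR] with y hy
    exact hconst C y (le_of_lt hy)
  have hmax : ∀ x, SubAt (fun x p => H x p 0) (criticalValue H)
      (fun y => max (min (w y) C) (-C)) x := by
    intro x
    rcases le_total (min (w x) C) (-C) with hx | hx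
    · have hxR : R < ‖x‖ := by
        by_contra hcon
        have h3 := abs_lt.1 (hwB x (not_lt.1 hcon))
        rw [min_eq_left h3.2.le] at hx
        linarith [h3.1]
      exact (hconst (-C) x hxR.le).of_le (Eventually.of_forall fun y => le_max_right _ _)
        (max_eq_right hx).symm
    · exact (hmin x).of_le (Eventually.of_forall fun y => le_max_left _ _) (max_eq_left hx).symm
  have hsub : IsSubsolution H (criticalValue H) 0 fun y => max (min (w y) C) (-C) := by
    refine isSubsolution_iff.2 ⟨by fun_prop, ?_⟩
    simpa using hmax
  have hbd : ∀ x, -(2 * C) ≤ max (min (w x) C) (-C) - C ∧ max (min (w x) C) (-C) - C ≤ 0 := by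
    intro x
    have h3 := le_max_right (min (w x) C) (-C)
    have h4 : max (min (w x) C) (-C) ≤ C := max_le (min_le_right _ _) (by linarith)
    constructor <;> linarith
  have hsub' := isSubsolution_zero_sub_const hsub C
  refine ⟨fun x => max (min (w x) C) (-C) - C, 2 * C, by positivity, hbd, fun lam hlam =>
    ⟨hsub'.1, fun φ hφ x hx => ?_⟩⟩
  -- The truncated function was shifted down by `C` to be nonpositive, so the discount term only
  -- lowers the Hamiltonian.
  refine (h1.monotone x _ ?_).trans (hsub'.2 φ hφ x hx)
  rw [zero_mul]
  exact mul_nonpos_of_nonneg_of_nonpos hlam (hbd x).2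

/-- The mean value theorem in `u`; the upper constant is enlarged to be positive. -/
theorem AssumptionH3.le_sub {H : Hamiltonian n} (h3 : AssumptionH3 H) {R : ℝ} (hR : 0 < R) :
    ∃ κ > 0, ∃ κ' > 0, ∀ x p : Space n, ‖p‖ ≤ R → ∀ u v : ℝ, u ≤ v →
      κ * (v - u) ≤ H x p v - H x p u ∧ H x p v - H x p u ≤ κ' * (v - u) := by
  obtain ⟨κ, hκ, κ', h⟩ := h3.bounds R hR
  refine ⟨κ, hκ, |κ'| + 1, by positivity, fun x p hp u v huv => ⟨?_, ?_⟩⟩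
  · exact (convex_univ).mul_sub_le_image_sub_of_le_deriv (h3.differentiable x p).continuous.continuousOn
      (h3.differentiable x p).differentiableOn (fun s _ => (h x p hp s).1) u (mem_univ _) v
      (mem_univ _) huv
  · exact (convex_univ).image_sub_le_mul_sub_of_deriv_le (h3.differentiable x p).continuous.continuousOn
      (h3.differentiable x p).differentiableOn
      (fun s _ => (h x p hp s).2.trans (by linarith [le_abs_self κ'])) u (mem_univ _) v
      (mem_univ _) huv

/-- A subsolution of the discounted equation is not positive on all of a ball outside which the
critical equation has strict subsolutions of small slope. -/
theorem exists_nonpos_of_isSubsolution {H : Hamiltonian n} (h1 : AssumptionH1 H)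
    (h3 : AssumptionH3 H)
    (hbdd : BddBelow {a : ℝ | ∃ u : Space n → ℝ, IsSubsolution H a 0 u}) {ε R a : ℝ} (hε : 0 < ε)
    (hR0 : 0 < R) (ha : a < criticalValue H)
    (hR : ∀ x : Space n, R ≤ ‖x‖ → ∀ p : Space n, ‖p‖ ≤ ε → H x p 0 ≤ a) {lam : ℝ} (hlam : 0 < lam)
    {v : Space n → ℝ} (hv : IsSubsolution H (criticalValue H) lam v) :
    ∃ x, ‖x‖ ≤ R ∧ v x ≤ 0 := by
  by_contra! hcon
  obtain ⟨hvc, hvs⟩ := isSubsolution_iff.1 hv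
  set c := criticalValue H with hc
  obtain ⟨x₁, hx₁, hmin⟩ := (isCompact_closedBall (0 : Space n) R).exists_isMinOn
    ⟨0, by simp [hR0.le]⟩ hvc.continuousOn
  obtain ⟨x₂, hx₂, hmax⟩ := (isCompact_closedBall (0 : Space n) R).exists_isMaxOn
    ⟨0, by simp [hR0.le]⟩ hvc.continuousOn
  set K := v x₁ with hK
  have hK0 : 0 < K := hcon x₁ (by simpa using hx₁)
  have hKv : ∀ x, ‖x‖ ≤ R → K ≤ v x := fun x hx => hmin (by simpa using hx)
  set C := v x₂ + 1 with hC
  have hCv : ∀ x, ‖x‖ ≤ R → v x < C := fun x hx => by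
    have : v x ≤ v x₂ := hmax (by simpa using hx)
    linarith
  -- The cone exceeds `v` on the ball, where it need not be a subsolution, and is strict outside it;
  -- taking the minimum with `v` brings the function below `K / 2` at infinity.
  set g : Space n → ℝ := fun x => C - ε * (‖x‖ - R) with hg
  have hgc : Continuous g := by fun_prop
  have hF := h1.frozen (w := fun _ => 0) continuous_const
  -- Every point where the cone is positive lies within this radius, so the momenta that matter are
  -- bounded and the discount acts with a uniform rate `κ`.
  set R₁ := R + C / ε + 1 with hR₁
  obtain ⟨r, hr⟩ := hF.coercive R₁ c
  obtain ⟨κ, hκ, κ', -, hκH⟩ := h3.le_sub (R := max 1 r) (by positivity)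
  -- The uniform gain below the critical level: `c - a` for the cone and the constants outside the
  -- ball, and the discount `κ λ K / 4` for `v` where `v ≥ K / 4`.
  set η := min (c - a) (κ * (lam * (K / 4))) with hη
  have hη0 : 0 < η := lt_min (by linarith) (by positivity)
  have hgs : ∀ x, R ≤ ‖x‖ → SubAt (fun x p => H x p 0) (c - η) g x := by
    intro x hx
    refine (subAt_norm_of_lipschitz (g := g) hε.le (fun y => ?_)).mono fun p hp => ?_
    · have := norm_sub_norm_le y x
      rw [norm_sub_rev] at this
      have := mul_le_mul_of_nonneg_left this hε.le
      simp only [hg]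
      linarith
    · have := hR x hx p hp
      linarith [min_le_left (c - a) (κ * (lam * (K / 4)))]
  have hcs : ∀ (b : ℝ) x, R ≤ ‖x‖ → SubAt (fun x p => H x p 0) (c - η) (fun _ => b) x := by
    intro b x hx
    refine (subAt_norm_of_lipschitz (g := fun _ => b) (ε := 0) le_rfl (fun y => by simp)).mono ?_
    intro p hp
    have := hR x hx p (hp.trans hε.le)
    linarith [min_le_left (c - a) (κ * (lam * (K / 4)))]
  have hvs' : ∀ x, ‖x‖ ≤ R₁ → K / 4 ≤ v x → SubAt (fun x p => H x p 0) (c - η) v x := by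
    intro x hx hvx
    refine (hvs x).mono fun p hp => ?_
    have hv0 : 0 ≤ lam * v x := mul_nonneg hlam.le (by linarith)
    have hp0 : H x p 0 ≤ c := (h1.monotone x p hv0).trans hp
    have h4 := (hκH x p ((hr x hx p hp0).trans (le_max_right _ _)) 0 (lam * v x) hv0).1
    have h5 : κ * (lam * (K / 4)) ≤ κ * (lam * v x - 0) := by
      rw [sub_zero]
      gcongr
    linarith [min_le_right (c - a) (κ * (lam * (K / 4)))]
  have hmm : ∀ x, K / 2 < min (v x) (g x) →
      SubAt (fun x p => H x p 0) (c - η) (fun y => min (v y) (g y)) x := by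
    intro x hx
    have hgx : K / 2 < g x := hx.trans_le (min_le_right _ _)
    have hvx : K / 2 < v x := hx.trans_le (min_le_left _ _)
    have hxR : ‖x‖ < R₁ := by
      have : ε * (‖x‖ - R) < C := by
        simp only [hg] at hgx
        linarith
      rw [mul_comm, ← lt_div_iff₀ hε] at this
      linarith
    refine subAt_min_cases hF hvc hgc (fun _ => ?_) fun hgv => ?_
    · filter_upwards [continuous_norm.continuousAt.eventually_lt continuousAt_const hxR,
        continuousAt_const.eventually_lt hvc.continuousAt (show K / 4 < v x by linarith)]
        with y hy1 hy2
      exact hvs' y (le_of_lt hy1) (le_of_lt hy2)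
    · have hxR' : R < ‖x‖ := by
        by_contra hle
        have h4 := hCv x (not_lt.1 hle)
        have h5 : 0 ≤ ε * (R - ‖x‖) := mul_nonneg hε.le (by linarith [not_lt.1 hle])
        simp only [hg] at hgv
        linarith
      filter_upwards [continuousAt_const.eventually_lt continuous_norm.continuousAt hxR'] with y hy
      exact hgs y (le_of_lt hy)
  -- The cutoff from below at `K / 2` is inactive on the ball, where `v` and the cone are at least
  -- `K`. The result is a subsolution at a level below the critical value.
  have hfin : IsSubsolution H (c - η) 0 fun y => max (min (v y) (g y)) (K / 2) := by
    refine isSubsolution_iff.2 ⟨by fun_prop, fun x => ?_⟩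
    simp only [zero_mul]
    rcases lt_or_ge (K / 2) (min (v x) (g x)) with hx | hx
    · exact (hmm x hx).of_le (Eventually.of_forall fun y => le_max_left _ _) (max_eq_left hx.le).symm
    · refine (hcs (K / 2) x ?_).of_le (Eventually.of_forall fun y => le_max_right _ _)
        (max_eq_right hx).symm
      by_contra hle
      have hle := not_le.1 hle
      have h4 := hKv x hle.le
      have h5 := hCv x hle.le
      have h6 : 0 ≤ ε * (R - ‖x‖) := mul_nonneg hε.le (by linarith)
      have h7 : K ≤ min (v x) (g x) := le_min h4 (by simp only [hg]; linarith)
      linarith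
  have := csInf_le hbdd ⟨_, hfin⟩
  rw [← criticalValue, ← hc] at this
  linarith

/-- Subsolutions above a fixed bounded function are locally bounded and locally equi-Lipschitz,
uniformly for bounded `lam`. -/
theorem exists_uniform_bounds {H : Hamiltonian n} (h1 : AssumptionH1 H) (h2 : AssumptionH2 H)
    (h3 : AssumptionH3 H) {N : ℝ} (hN : 0 ≤ N) (Λ : ℝ) :
    ∃ M C : ℝ → ℝ, (∀ R, 0 ≤ M R) ∧ (∀ R, 0 ≤ C R) ∧ ∀ lam u, 0 < lam → lam ≤ Λ →
      IsSubsolution H (criticalValue H) lam u → (∀ x, -N ≤ u x) →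
      (∀ R x y, ‖x‖ ≤ R → ‖y‖ ≤ R → |u y - u x| ≤ M R * ‖y - x‖) ∧
      ∀ R x, ‖x‖ ≤ R → u x ≤ C R := by
  obtain ⟨hbdd, -, ε, hε, R₀, hR0, a, ha, hR⟩ := exists_level_lt_criticalValue h1 h2
  obtain ⟨M, hM0, hM⟩ := h1.exists_lipschitz (criticalValue H) (Λ * N)
  refine ⟨M, fun R => M (max R R₀) * (2 * max R R₀), hM0, fun R => ?_, ?_⟩
  · have := hM0 (max R R₀)
    have := (le_max_right R R₀).trans' hR0.le
    positivity
  intro lam u hlam hΛ hu huN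
  have hLip := hM lam u hu (fun x => by
    have h4 : lam * N ≤ Λ * N := by gcongr
    have h5 : lam * (-N) ≤ lam * u x := by gcongr; exact huN x
    linarith)
  refine ⟨hLip, fun R x hx => ?_⟩
  -- A zero upper bound at one point of a fixed ball, propagated by the Lipschitz estimate, bounds
  -- the subsolution above on every ball.
  obtain ⟨x₀, hx₀, hux₀⟩ := exists_nonpos_of_isSubsolution h1 h3 hbdd hε hR0 ha hR hlam hu
  have h4 := (abs_le.1 (hLip (max R R₀) x₀ x (hx₀.trans (le_max_right _ _))
    (hx.trans (le_max_left _ _)))).2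
  have h5 : ‖x - x₀‖ ≤ 2 * max R R₀ := by
    have := norm_sub_le x x₀
    linarith [le_max_left R R₀, le_max_right R R₀]
  have h6 := mul_le_mul_of_nonneg_left h5 (hM0 (max R R₀))
  linarith

/-! ### Perron's method -/

/-- A subsolution that dominates all subsolutions is a supersolution. -/
theorem isSupersolution_of_forall_le {H : Hamiltonian n}
    (hH : Continuous fun z : Space n × Space n × ℝ => H z.1 z.2.1 z.2.2) {c lam : ℝ}
    {U : Space n → ℝ} (hU : IsSubsolution H c lam U)
    (hmax : ∀ v, IsSubsolution H c lam v → ∀ x, v x ≤ U x) : IsSupersolution H c lam U := by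
  refine ⟨hU.1, fun φ hφ x₀ hmin => ?_⟩
  by_contra hcon
  have hcon := not_le.1 hcon
  -- If the supersolution inequality fails at `x₀`, this bump is a strict subsolution near `x₀`. It
  -- exceeds `U` by `δ` at `x₀` and, by the quadratic term, falls below `U` away from it.
  set ψ : ℝ → Space n → ℝ := fun δ y => φ y + (U x₀ - φ x₀ + δ) + (-1) * ‖y - x₀‖ ^ 2 with hψ
  have hgrad : ∀ δ z, HasGradientAt (ψ δ) (gradient φ z + (2 * (-1) : ℝ) • (z - x₀)) z := by
    intro δ z
    have := (((hφ.differentiable one_ne_zero z).hasGradientAt).hasFDerivAt.add_const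
      (U x₀ - φ x₀ + δ)).add (hasGradientAt_quadratic (-1) x₀ z).hasFDerivAt
    rw [← map_add] at this
    exact hasGradientAt_iff_hasFDerivAt.2 this
  have hgc : Continuous fun z => gradient φ z + (2 * (-1) : ℝ) • (z - x₀) := by
    have : Continuous (gradient φ) :=
      (InnerProductSpace.toDual ℝ (Space n)).symm.continuous.comp
        (hφ.continuous_fderiv one_ne_zero)
    fun_prop
  have hφc := hφ.continuous
  have hψd : ∀ δ, ContDiff ℝ 1 (ψ δ) := fun δ =>
    (hφ.add contDiff_const).add (contDiff_quadratic (-1) x₀)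
  have hev : ∀ᶠ z : ℝ × Space n in 𝓝 (0, x₀),
      H z.2 (gradient φ z.2 + (2 * (-1) : ℝ) • (z.2 - x₀)) (lam * ψ z.1 z.2) < c := by
    have hψc : Continuous fun z : ℝ × Space n => ψ z.1 z.2 := by fun_prop
    refine ContinuousAt.eventually_lt (Continuous.continuousAt ?_) continuousAt_const ?_
    · exact hH.comp (f := fun z : ℝ × Space n =>
        (z.2, gradient φ z.2 + (2 * (-1) : ℝ) • (z.2 - x₀), lam * ψ z.1 z.2)) 
        (continuous_snd.prodMk ((hgc.comp continuous_snd).prodMk (by fun_prop)))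
    · simpa [hψ] using hcon
  obtain ⟨r₁, hr₁, hball₁⟩ := Metric.eventually_nhds_iff.1 hev
  obtain ⟨r₂, hr₂, hball₂⟩ := Metric.eventually_nhds_iff.1 hmin
  set r := min r₁ r₂ with hr
  have hr0 : 0 < r := lt_min hr₁ hr₂
  -- The bound `δ < (r / 2) ^ 2` makes the bump smaller than `U` on the annulus `r / 2 ≤ dist y x₀ <
  -- r`, so that the glued function equals `U` there.
  obtain ⟨δ, hδ0, hδr, hδ1⟩ : ∃ δ > 0, δ < (r / 2) ^ 2 ∧ δ < r₁ :=
    ⟨min ((r / 2) ^ 2 / 2) (r₁ / 2), by positivity,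
      (min_le_left _ _).trans_lt (half_lt_self (by positivity)),
      (min_le_right _ _).trans_lt (half_lt_self hr₁)⟩
  have hsubψ : ∀ y, dist y x₀ < r → H y (gradient (ψ δ) y) (lam * ψ δ y) ≤ c := by
    intro y hy
    rw [(hgrad δ y).gradient]
    refine (hball₁ (y := (δ, y)) ?_).le
    rw [Prod.dist_eq]
    exact max_lt (by simpa [abs_of_pos hδ0] using hδ1) (hy.trans_le (min_le_left _ _))
  have hring : ∀ y, dist y x₀ < r → r / 2 ≤ dist y x₀ → ψ δ y < U y := by
    intro y hy hy'
    have h1 := hball₂ (hy.trans_le (min_le_right _ _))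
    have h2 : (r / 2) ^ 2 ≤ ‖y - x₀‖ ^ 2 := by
      rw [← dist_eq_norm]
      gcongr
    simp only [hψ]
    linarith
  set W : Space n → ℝ := fun y => if dist y x₀ < r then max (U y) (ψ δ y) else U y with hW
  have hWU : ∀ y, r / 2 < dist y x₀ → W =ᶠ[𝓝 y] U := by
    intro y hy
    filter_upwards [(continuous_id.dist continuous_const).continuousAt.eventually_const_lt hy] with z hz
    simp only [hW]
    split_ifs with h
    · exact max_eq_left (hring z h (le_of_lt hz)).le
    · rfl
  have hWm : ∀ y, dist y x₀ < r → W =ᶠ[𝓝 y] fun z => max (U z) (ψ δ z) := by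
    intro y hy
    filter_upwards [(continuous_id.dist continuous_const).continuousAt.eventually_lt_const hy] with z hz
    exact if_pos hz
  have hUc := hU.1
  have hUs := (isSubsolution_iff.1 hU).2
  have hcases : ∀ y, dist y x₀ < r ∨ r / 2 < dist y x₀ := fun y => by
    rcases lt_or_ge (dist y x₀) r with h | h
    · exact Or.inl h
    · exact Or.inr (by linarith)
  have hWsub : IsSubsolution H c lam W := by
    rw [isSubsolution_iff]
    constructor
    · rw [continuous_iff_continuousAt]
      intro y
      rcases hcases y with hy | hy
      · exact (ContinuousAt.congr (by fun_prop) (hWm y hy).symm)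
      · exact (hUc.continuousAt.congr (hWU y hy).symm)
    · intro y
      rcases hcases y with hy | hy
      · have hWy : W y = max (U y) (ψ δ y) := (hWm y hy).self_of_nhds
        rcases le_total (U y) (ψ δ y) with hle | hle
        · have hWy' : W y = ψ δ y := by rw [hWy, max_eq_right hle]
          have hs : SubAt (fun z p => H z p (lam * ψ δ z)) c (ψ δ) y := by
            intro χ hχ hx
            have hgr : gradient χ y = gradient (ψ δ) y := by
              have h0 := hx.fderiv_eq_zero
              rw [fderiv_fun_sub ((hψd δ).differentiable one_ne_zero y)
                (hχ.differentiable one_ne_zero y), sub_eq_zero] at h0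
              rw [gradient, gradient, h0]
            rw [hgr]
            exact hsubψ y hy
          refine (hs.of_le (w := W) ?_ hWy'.symm).mono fun p hp => ?_
          · filter_upwards [hWm y hy] with z hz
            rw [hz]
            exact le_max_right _ _
          · simpa only [hWy'] using hp
        · have hWy' : W y = U y := by rw [hWy, max_eq_left hle]
          refine ((hUs y).of_le (w := W) ?_ hWy'.symm).mono fun p hp => ?_
          · filter_upwards [hWm y hy] with z hz
            rw [hz]
            exact le_max_left _ _
          · simpa only [hWy'] using hp
      · have hWy' := (hWU y hy).self_of_nhds
        refine ((hUs y).of_le (w := W) ?_ hWy'.symm).mono fun p hp => ?_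
        · filter_upwards [hWU y hy] with z hz
          rw [hz]
        · simpa only [hWy'] using hp
  have h1 := hmax W hWsub x₀
  have h2 := (hWm x₀ (by simpa using hr0)).self_of_nhds
  have h3 := le_max_right (U x₀) (ψ δ x₀)
  have h4 : ψ δ x₀ = U x₀ + δ := by simp [hψ]; ring
  simp only at h2
  linarith

/-- Perron's method: there is a solution that dominates all subsolutions. -/
theorem exists_solution_ge_subsolutions {H : Hamiltonian n} (h1 : AssumptionH1 H)
    (h2 : AssumptionH2 H) (h3 : AssumptionH3 H) {lam : ℝ} (hlam : 0 < lam) :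
    ∃ U, IsSolution H (criticalValue H) lam U ∧
      ∀ v, IsSubsolution H (criticalValue H) lam v → ∀ x, v x ≤ U x := by
  obtain ⟨w, N, hN, hwN, hw⟩ := exists_bounded_subsolution h1 h2
  obtain ⟨M, C, hM0, hC0, hMC⟩ := exists_uniform_bounds h1 h2 h3 hN lam
  -- The bound from below by `w` is what makes the family locally bounded and equi-Lipschitz.
  set S : Set (Space n → ℝ) := {v | IsSubsolution H (criticalValue H) lam v ∧ ∀ x, w x ≤ v x}
  have hwS : w ∈ S := ⟨hw lam hlam.le, fun x => le_rfl⟩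
  have hS : ∀ v ∈ S, (∀ R x y, ‖x‖ ≤ R → ‖y‖ ≤ R → |v y - v x| ≤ M R * ‖y - x‖) ∧
      ∀ R x, ‖x‖ ≤ R → v x ≤ C R := fun v hv =>
    hMC lam v hlam le_rfl hv.1 fun x => (hwN x).1.trans (hv.2 x)
  set U : Space n → ℝ := fun x => sSup ((fun v : Space n → ℝ => v x) '' S) with hU
  have hbd : ∀ x, BddAbove ((fun v : Space n → ℝ => v x) '' S) := by
    intro x
    refine ⟨C ‖x‖, ?_⟩
    rintro _ ⟨v, hv, rfl⟩
    exact (hS v hv).2 ‖x‖ x le_rfl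
  have hne : ∀ x, ((fun v : Space n → ℝ => v x) '' S).Nonempty := fun x => ⟨_, w, hwS, rfl⟩
  have hle : ∀ v ∈ S, ∀ x, v x ≤ U x := fun v hv x => le_csSup (hbd x) ⟨v, hv, rfl⟩
  have hUlip : ∀ R x y, ‖x‖ ≤ R → ‖y‖ ≤ R → U y - U x ≤ M R * ‖y - x‖ := by
    intro R x y hx hy
    rw [sub_le_iff_le_add]
    refine csSup_le (hne y) ?_
    rintro _ ⟨v, hv, rfl⟩
    have := (abs_le.1 ((hS v hv).1 R x y hx hy)).2
    linarith [hle v hv x]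
  have hUc : Continuous U := by
    rw [Metric.continuous_iff]
    intro x ε hε
    set m := M (‖x‖ + 1) + 1
    have hm : 0 < m := by linarith [hM0 (‖x‖ + 1)]
    refine ⟨min 1 (ε / m), by positivity, fun y hy => ?_⟩
    rw [dist_eq_norm] at hy
    have hy1 := hy.trans_le (min_le_left _ _)
    have hy2 := hy.trans_le (min_le_right _ _)
    rw [lt_div_iff₀ hm] at hy2
    have hyn : ‖y‖ ≤ ‖x‖ + 1 := by linarith [norm_sub_norm_le y x]
    have e1 := hUlip (‖x‖ + 1) x y (by linarith) hyn
    have e2 := hUlip (‖x‖ + 1) y x hyn (by linarith)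
    rw [norm_sub_rev] at e2
    have e3 : M (‖x‖ + 1) * ‖y - x‖ ≤ ‖y - x‖ * m := by
      rw [mul_comm]
      gcongr
      exact (lt_add_one _).le
    rw [Real.dist_eq, abs_lt]
    constructor <;> linarith
  have hUsub : IsSubsolution H (criticalValue H) lam U := by
    refine isSubsolution_iff.2 ⟨hUc, fun x => ?_⟩
    -- A sequence that approaches the supremum at `x` alone suffices for stability, since all
    -- members lie below `U` everywhere.
    have hex : ∀ j : ℕ, ∃ v ∈ S, U x - 1 / ((j : ℝ) + 1) < v x := by
      intro j
      obtain ⟨_, ⟨v, hv, rfl⟩, hlt⟩ := exists_lt_of_lt_csSup (hne x)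
        (show U x - 1 / ((j : ℝ) + 1) < sSup ((fun v : Space n → ℝ => v x) '' S) by
          have : (0 : ℝ) < 1 / ((j : ℝ) + 1) := by positivity
          linarith)
      exact ⟨v, hv, hlt⟩
    choose v hvS hvx using hex
    refine subAt_of_tendsto (v := v) h1.continuous hUc tendsto_const_nhds tendsto_const_nhds
      (Eventually.of_forall fun j => (hvS j).1) ?_ fun ε hε => Eventually.of_forall fun j y _ => ?_
    · have h4 : Tendsto (fun j : ℕ => U x - 1 / ((j : ℝ) + 1)) atTop (𝓝 (U x - 0)) :=
        tendsto_const_nhds.sub tendsto_one_div_add_atTop_nhds_zero_nat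
      rw [sub_zero] at h4
      exact tendsto_of_tendsto_of_tendsto_of_le_of_le h4 tendsto_const_nhds
        (fun j => (hvx j).le) fun j => hle _ (hvS j) x
    · linarith [hle _ (hvS j) y]
  -- An arbitrary subsolution enters the family after taking its maximum with `w`.
  have hUmax : ∀ v, IsSubsolution H (criticalValue H) lam v → ∀ x, v x ≤ U x := fun v hv x =>
    (le_max_left (v x) (w x)).trans
      (hle _ ⟨isSubsolution_max hv (hw lam hlam.le), fun y => le_max_right (v y) (w y)⟩ x)
  exact ⟨U, ⟨hUsub, isSupersolution_of_forall_le h1.continuous hUsub hUmax⟩, hUmax⟩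

/-- Perron's solution lies between any subsolution and the maximal solution. -/
theorem IsMaximalSolution.ge_of_isSubsolution {H : Hamiltonian n} (h1 : AssumptionH1 H)
    (h2 : AssumptionH2 H) (h3 : AssumptionH3 H) {lam : ℝ} (hlam : 0 < lam) {u v : Space n → ℝ}
    (hu : IsMaximalSolution H lam u) (hv : IsSubsolution H (criticalValue H) lam v) (x : Space n) :
    v x ≤ u x := by
  obtain ⟨U, hU, hUmax⟩ := exists_solution_ge_subsolutions h1 h2 h3 hlam
  exact (hUmax v hv x).trans (hu.2 U hU x)

/-! ### The Lagrangian -/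

/-- Hamiltonians that are superlinear, strictly increasing in `u` with a rate that is local in `p`,
and whose difference quotients at `u = 0` extend continuously. -/
structure IsTonelli (G : Hamiltonian n) : Prop where
  h1 : AssumptionH1 G
  superlinear : IsSuperlinear G
  quotient : ∃ D : Space n → Space n → ℝ, Continuous fun z : Space n × Space n × ℝ =>
    if z.2.2 = 0 then D z.1 z.2.1 else (G z.1 z.2.1 z.2.2 - G z.1 z.2.1 0) / z.2.2
  increasing : ∀ R > 0, ∃ κ > 0, ∀ x p : Space n, ‖p‖ ≤ R → ∀ u v : ℝ, u ≤ v →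
    κ * (v - u) ≤ G x p v - G x p u

/-- Momenta at which the supremum that defines the Lagrangian is attained. -/
def IsMaximizer (G : Hamiltonian n) (x v : Space n) (u : ℝ) (p : Space n) : Prop :=
  ∀ p', inner ℝ p' v - G x p' u ≤ inner ℝ p v - G x p u

theorem IsMaximizer.lagrangian_eq {G : Hamiltonian n} {x v : Space n} {u : ℝ} {p : Space n}
    (hp : IsMaximizer G x v u p) : lagrangian G x v u = inner ℝ p v - G x p u :=
  le_antisymm (ciSup_le hp)
    (le_ciSup (f := fun p => inner ℝ p v - G x p u) ⟨_, by rintro _ ⟨p', rfl⟩; exact hp p'⟩ p)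

theorem AssumptionH1.continuous_comp {G : Hamiltonian n} (h1 : AssumptionH1 G) {X : Type*}
    [TopologicalSpace X] {x p : X → Space n} {u : X → ℝ} (hx : Continuous x) (hp : Continuous p)
    (hu : Continuous u) : Continuous fun z => G (x z) (p z) (u z) :=
  h1.continuous.comp (f := fun z => (x z, p z, u z)) (by fun_prop)

namespace IsTonelli

variable {G : Hamiltonian n} (hG : IsTonelli G)

include hG

/-- Superlinearity with slope `R + 1` beats the pairing, which is at most `R ‖p‖`: outside a ball of
fixed radius every momentum does worse than `0`. The uniform radius is what later gives continuity
and rates. -/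
theorem exists_isMaximizer (R : ℝ) : ∃ r, 0 < r ∧ ∀ x v u, ‖x‖ ≤ R → ‖v‖ ≤ R → |u| ≤ R →
    (∃ p, IsMaximizer G x v u p) ∧ ∀ p, IsMaximizer G x v u p → ‖p‖ ≤ r := by
  obtain ⟨r₁, hr₁⟩ := hG.superlinear (Metric.closedBall 0 R) (Icc (-R) R)
    (isCompact_closedBall 0 R) isCompact_Icc (R + 1)
  have hc : Continuous fun z : Space n × ℝ => G z.1 0 z.2 :=
    hG.h1.continuous_comp continuous_fst continuous_const continuous_snd
  obtain ⟨B, hB⟩ := ((isCompact_closedBall (0 : Space n) R).prod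
    (isCompact_Icc (a := -R) (b := R))).exists_bound_of_continuousOn hc.continuousOn
  have hr0 : 0 < |r₁| + |B| + 1 := by positivity
  refine ⟨|r₁| + |B| + 1, hr0, fun x v u hx hv hu => ?_⟩
  have hu' := abs_le.1 hu
  have key : ∀ p : Space n, |r₁| + |B| + 1 < ‖p‖ →
      inner ℝ p v - G x p u < inner ℝ 0 v - G x 0 u := by
    intro p hp
    have e1 := hr₁ x (by simpa using hx) p
      (by linarith [le_abs_self r₁, abs_nonneg B]) u hu'
    have e2 := (abs_le.1 (hB (x, u) ⟨by simpa using hx, hu'⟩)).2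
    have e3 : inner ℝ p v ≤ R * ‖p‖ := by
      refine (real_inner_le_norm p v).trans ?_
      rw [mul_comm]
      gcongr
    simp only [inner_zero_left]
    simp only at e2
    linarith [le_abs_self B, abs_nonneg r₁]
  constructor
  · have hcont : Continuous fun p => inner ℝ p v - G x p u := by
      have := hG.h1.continuous_comp (x := fun _ : Space n => x) continuous_const continuous_id
        (continuous_const (y := u))
      fun_prop
    obtain ⟨p, hp, hmax⟩ := (isCompact_closedBall (0 : Space n) (|r₁| + |B| + 1)).exists_isMaxOn
      ⟨0, by simp [hr0.le]⟩ hcont.continuousOn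
    refine ⟨p, fun p' => ?_⟩
    rcases le_or_gt ‖p'‖ (|r₁| + |B| + 1) with h | h
    · exact hmax (by simpa using h)
    · exact (key p' h).le.trans (hmax (by simp [hr0.le]))
  · intro p hp
    by_contra hcon
    exact absurd (hp 0) (not_le.2 (key p (not_le.1 hcon)))

theorem exists_maximizer (x v : Space n) (u : ℝ) : ∃ p, IsMaximizer G x v u p := by
  obtain ⟨r, -, hr⟩ := hG.exists_isMaximizer (max ‖x‖ (max ‖v‖ |u|))
  exact (hr x v u (le_max_left _ _) ((le_max_left _ _).trans (le_max_right _ _))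
    ((le_max_right _ _).trans (le_max_right _ _))).1

theorem inner_sub_le (x v : Space n) (u : ℝ) (p : Space n) :
    inner ℝ p v - G x p u ≤ lagrangian G x v u := by
  obtain ⟨p', hp'⟩ := hG.exists_maximizer x v u
  exact (hp' p).trans hp'.lagrangian_eq.ge

theorem isMaximizer_iff (x v : Space n) (u : ℝ) (p : Space n) :
    IsMaximizer G x v u p ↔ lagrangian G x v u ≤ inner ℝ p v - G x p u :=
  ⟨fun h => h.lagrangian_eq.le, fun h p' => (hG.inner_sub_le x v u p').trans h⟩

/-- Locally the supremum may be taken over one compact ball of momenta. -/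
theorem continuous_lagrangian :
    Continuous fun z : Space n × Space n × ℝ => lagrangian G z.1 z.2.1 z.2.2 := by
  rw [continuous_iff_continuousAt]
  rintro z₀
  set R := ‖z₀‖ + 1
  obtain ⟨r, hr0, hr⟩ := hG.exists_isMaximizer R
  have hcont : Continuous fun z : Space n × Space n × ℝ =>
      sSup ((fun p => inner ℝ p z.2.1 - G z.1 p z.2.2) '' Metric.closedBall 0 r) := by
    refine (isCompact_closedBall (0 : Space n) r).continuous_sSup ?_
    have := hG.h1.continuous_comp (X := (Space n × Space n × ℝ) × Space n) (x := fun z => z.1.1)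
      (p := fun z => z.2) (u := fun z => z.1.2.2) (by fun_prop) (by fun_prop) (by fun_prop)
    exact (show Continuous fun z : (Space n × Space n × ℝ) × Space n => inner ℝ z.2 z.1.2.1 by
      fun_prop).sub this
  refine hcont.continuousAt.congr ?_
  have hev : ∀ᶠ z in 𝓝 z₀, ‖z‖ < R :=
    continuous_norm.continuousAt.eventually_lt continuousAt_const (lt_add_one _)
  filter_upwards [hev] with z hz
  have e1 : ‖z.1‖ ≤ R := (norm_fst_le z).trans hz.le
  have e2 : ‖z.2.1‖ ≤ R := (norm_fst_le z.2).trans ((norm_snd_le z).trans hz.le)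
  have e3 : |z.2.2| ≤ R := (norm_snd_le z.2).trans ((norm_snd_le z).trans hz.le)
  obtain ⟨⟨p, hp⟩, hb⟩ := hr _ _ _ e1 e2 e3
  rw [hp.lagrangian_eq]
  refine IsGreatest.csSup_eq ⟨⟨p, by simpa using hb p hp, rfl⟩, ?_⟩
  rintro _ ⟨p', -, rfl⟩
  exact hp p'

theorem continuous_lagrangian_comp {X : Type*} [TopologicalSpace X] {x v : X → Space n} {u : X → ℝ}
    (hx : Continuous x) (hv : Continuous v) (hu : Continuous u) :
    Continuous fun z => lagrangian G (x z) (v z) (u z) :=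
  hG.continuous_lagrangian.comp (f := fun z => (x z, v z, u z)) (by fun_prop)

theorem lagrangian_convex (x v w : Space n) (u : ℝ) {a b : ℝ} (ha : 0 ≤ a) (hb : 0 ≤ b)
    (hab : a + b = 1) :
    lagrangian G x (a • v + b • w) u ≤ a * lagrangian G x v u + b * lagrangian G x w u := by
  obtain ⟨p, hp⟩ := hG.exists_maximizer x (a • v + b • w) u
  rw [hp.lagrangian_eq, inner_add_right, inner_smul_right, inner_smul_right]
  have e1 := mul_le_mul_of_nonneg_left (hG.inner_sub_le x v u p) ha
  have e2 := mul_le_mul_of_nonneg_left (hG.inner_sub_le x w u p) hb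
  have e3 : G x p u = a * G x p u + b * G x p u := by rw [← add_mul, hab, one_mul]
  linarith

/-- Approximate duality, with bounds on the velocity. -/
theorem exists_velocity (R : ℝ) : ∃ V, 0 < V ∧ ∀ x p u, ‖x‖ ≤ R → ‖p‖ ≤ R → |u| ≤ R →
    ∀ ε, 0 < ε → ε ≤ 1 → ∃ v, ‖v‖ ≤ V ∧ G x p u + lagrangian G x v u ≤ inner ℝ p v + ε := by
  obtain ⟨B, hB⟩ := ((isCompact_closedBall (0 : Space n) R).prod
    ((isCompact_closedBall (0 : Space n) (R + 1)).prod
    (isCompact_Icc (a := -R) (b := R)))).exists_bound_of_continuousOn hG.h1.continuous.continuousOn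
  refine ⟨2 * |B| + 2, by positivity, fun x p u hx hp hu ε hε hε1 => ?_⟩
  have hu' := abs_le.1 hu
  have hcont : Continuous fun p => G x p u :=
    hG.h1.continuous_comp continuous_const continuous_id continuous_const
  -- The velocity is an `ε`-subgradient at `p`; this avoids the attainment of the supremum over
  -- velocities.
  obtain ⟨v, hv⟩ := exists_affine_minorant (hG.h1.convex x u) hcont
    (show G x p u - ε < G x p u by linarith)
  refine ⟨v, ?_, ?_⟩
  · rcases eq_or_ne v 0 with rfl | hv0
    · rw [norm_zero]
      positivity
    have hvn : 0 < ‖v‖ := norm_pos_iff.2 hv0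
    -- One unit from `p` in the direction of `v` the affine minorant has grown by `‖v‖`, so `‖v‖` is
    -- bounded by the variation of `G` on a ball.
    have e1 := hv (p + (1 / ‖v‖) • v)
    rw [add_sub_cancel_left, inner_smul_left, real_inner_self_eq_norm_sq] at e1
    have e2 : (starRingEnd ℝ) (1 / ‖v‖) * ‖v‖ ^ 2 = ‖v‖ := by
      simp
      field_simp
    rw [e2] at e1
    have hn : ‖p + (1 / ‖v‖) • v‖ ≤ R + 1 := by
      refine (norm_add_le _ _).trans ?_
      have : ‖(1 / ‖v‖) • v‖ = 1 := by
        rw [norm_smul, norm_div, norm_one, norm_norm]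
        field_simp
      linarith
    have e3 := (abs_le.1 (hB (x, p + (1 / ‖v‖) • v, u)
      ⟨by simpa using hx, by simpa using hn, hu'⟩)).2
    have e4 := (abs_le.1 (hB (x, p, u)
      ⟨by simpa using hx, by simp; linarith, hu'⟩)).1
    simp only at e3 e4
    linarith [le_abs_self B]
  · obtain ⟨p', hp'⟩ := hG.exists_maximizer x v u
    have := hv p'
    rw [inner_sub_left] at this
    rw [hp'.lagrangian_eq]
    linarith

end IsTonelli

/-! ### The dependence of the Lagrangian on `u` -/

/-- The difference quotient of the Lagrangian between `0` and `u`, extended by the derivative. -/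
noncomputable def lagrangianQuotient (G : Hamiltonian n) (x v : Space n) (u : ℝ) : ℝ :=
  if u = 0 then deriv (lagrangian G x v) 0 else (lagrangian G x v u - lagrangian G x v 0) / u

theorem mul_lagrangianQuotient (G : Hamiltonian n) (x v : Space n) (u : ℝ) :
    u * lagrangianQuotient G x v u = lagrangian G x v u - lagrangian G x v 0 := by
  unfold lagrangianQuotient
  split_ifs with h
  · simp [h]
  · field_simp

namespace IsTonelli

variable {G : Hamiltonian n} (hG : IsTonelli G)

include hG

/-- The maximizer at `u` is a competitor at `u'`. -/
theorem le_lagrangian_sub {x v : Space n} {u u' : ℝ} {p : Space n} (hp : IsMaximizer G x v u p) :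
    -(G x p u' - G x p u) ≤ lagrangian G x v u' - lagrangian G x v u := by
  rw [hp.lagrangian_eq]
  linarith [hG.inner_sub_le x v u' p]

/-- The envelope theorem. One maximizer gives a one-sided bound on the increment, and division by
positive and by negative `u` turns it into both inequalities. Hence `D x p` takes the same value at
all maximizers. -/
theorem deriv_lagrangian {D : Space n → Space n → ℝ}
    (hD : Continuous fun z : Space n × Space n × ℝ =>
      if z.2.2 = 0 then D z.1 z.2.1 else (G z.1 z.2.1 z.2.2 - G z.1 z.2.1 0) / z.2.2)
    {x v p : Space n} (hL : DifferentiableAt ℝ (lagrangian G x v) 0)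
    (hp : IsMaximizer G x v 0 p) : deriv (lagrangian G x v) 0 = -D x p := by
  have hslope := hasDerivAt_iff_tendsto_slope.1 hL.hasDerivAt
  have hq : Tendsto (fun u : ℝ => -((G x p u - G x p 0) / u)) (𝓝[≠] 0) (𝓝 (-D x p)) := by
    refine Tendsto.neg ?_
    have := (hD.comp (f := fun u : ℝ => (x, p, u)) (by fun_prop)).tendsto 0
    simp only [Function.comp_def, if_true] at this
    refine (this.mono_left nhdsWithin_le_nhds).congr' ?_
    filter_upwards [self_mem_nhdsWithin] with u hu
    exact if_neg hu
  have hgt : 𝓝[>] (0 : ℝ) ≤ 𝓝[≠] 0 :=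
    nhdsWithin_mono (0 : ℝ) (show Ioi (0 : ℝ) ⊆ {0}ᶜ from fun t (ht : 0 < t) => ht.ne')
  have hlt : 𝓝[<] (0 : ℝ) ≤ 𝓝[≠] 0 :=
    nhdsWithin_mono (0 : ℝ) (show Iio (0 : ℝ) ⊆ {0}ᶜ from fun t (ht : t < 0) => ht.ne)
  refine le_antisymm ?_ ?_
  · refine le_of_tendsto_of_tendsto (hslope.mono_left hlt) (hq.mono_left hlt) ?_
    filter_upwards [self_mem_nhdsWithin] with u hu
    have hu : u < 0 := hu
    have := hG.le_lagrangian_sub hp (u' := u)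
    rw [slope_def_field, sub_zero, ← neg_div]
    exact (div_le_div_right_of_neg hu).2 this
  · refine le_of_tendsto_of_tendsto (hq.mono_left hgt) (hslope.mono_left hgt) ?_
    filter_upwards [self_mem_nhdsWithin] with u hu
    have hu : 0 < u := hu
    have := hG.le_lagrangian_sub hp (u' := u)
    rw [slope_def_field, sub_zero, ← neg_div]
    gcongr

/-- The difference quotient of `L` lies between negatives of difference quotients of `G` at
maximizing momenta. -/
theorem lagrangianQuotient_between {D : Space n → Space n → ℝ}
    (hD : Continuous fun z : Space n × Space n × ℝ =>
      if z.2.2 = 0 then D z.1 z.2.1 else (G z.1 z.2.1 z.2.2 - G z.1 z.2.1 0) / z.2.2)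
    (hL : ∀ x v : Space n, DifferentiableAt ℝ (lagrangian G x v) 0)
    {x v : Space n} {u : ℝ} {p₀ p₁ : Space n} (hp₀ : IsMaximizer G x v 0 p₀)
    (hp₁ : IsMaximizer G x v u p₁) {a b : ℝ}
    (h : ∀ p ∈ ({p₀, p₁} : Set (Space n)),
      (if u = 0 then D x p else (G x p u - G x p 0) / u) ∈ Icc a b) :
    lagrangianQuotient G x v u ∈ Icc (-b) (-a) := by
  have h0 := h p₀ (by simp)
  have h1 := h p₁ (by simp)
  unfold lagrangianQuotient
  split_ifs at h0 h1 ⊢ with hu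
  · rw [hG.deriv_lagrangian hD (hL x v) hp₀]
    exact ⟨neg_le_neg h0.2, neg_le_neg h0.1⟩
  · have e0 := hG.le_lagrangian_sub hp₀ (u' := u)
    have e1 := hG.le_lagrangian_sub hp₁ (u' := 0)
    rcases lt_or_gt_of_ne hu with hlt | hgt
    · have f0 := (div_le_div_right_of_neg hlt).2 e0
      have f1 := (div_le_div_right_of_neg hlt).2
        (show lagrangian G x v u - lagrangian G x v 0 ≤ -(G x p₁ u - G x p₁ 0) by linarith)
      rw [neg_div] at f0 f1
      constructor <;> linarith [h0.1, h0.2, h1.1, h1.2]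
    · have f0 := (div_le_div_iff_of_pos_right hgt).2 e0
      have f1 := (div_le_div_iff_of_pos_right hgt).2
        (show lagrangian G x v u - lagrangian G x v 0 ≤ -(G x p₁ u - G x p₁ 0) by linarith)
      rw [neg_div] at f0 f1
      constructor <;> linarith [h0.1, h0.2, h1.1, h1.2]

-- Only `u = 0` needs an argument. At the limit point all maximizers give the same value of `D`, by
-- differentiability of `L`. By compactness, maximizers at nearby points have difference quotients
-- of `G` close to that value, and the quotient of `L` is squeezed between their negatives.
set_option maxHeartbeats 1000000 in
theorem continuous_lagrangianQuotient
    (hL : ∀ x v : Space n, DifferentiableAt ℝ (lagrangian G x v) 0) :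
    Continuous fun z : Space n × Space n × ℝ => lagrangianQuotient G z.1 z.2.1 z.2.2 := by
  obtain ⟨D, hD⟩ := hG.quotient
  rw [continuous_iff_continuousAt]
  rintro ⟨x₀, v₀, u₀⟩
  rcases ne_or_eq u₀ 0 with hu | rfl
  · have hLc := hG.continuous_lagrangian
    have hLc0 := hG.continuous_lagrangian_comp (X := Space n × Space n × ℝ) (x := fun z => z.1)
      (v := fun z => z.2.1) (u := fun _ => 0) (by fun_prop) (by fun_prop) (by fun_prop)
    have hc : ContinuousAt (fun z : Space n × Space n × ℝ =>
        (lagrangian G z.1 z.2.1 z.2.2 - lagrangian G z.1 z.2.1 0) / z.2.2) (x₀, v₀, u₀) :=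
      ContinuousAt.div (by fun_prop) (by fun_prop) hu
    refine hc.congr ?_
    have : ∀ᶠ z : Space n × Space n × ℝ in 𝓝 (x₀, v₀, u₀), z.2.2 ≠ 0 :=
      (continuous_snd.comp continuous_snd).continuousAt.eventually_ne hu
    filter_upwards [this] with z hz
    simp [lagrangianQuotient, hz]
  rw [ContinuousAt, Metric.tendsto_nhds]
  intro ε hε
  set k₀ := lagrangianQuotient G x₀ v₀ 0 with hk₀
  have hk₀' : k₀ = deriv (lagrangian G x₀ v₀) 0 := by simp [hk₀, lagrangianQuotient]
  set z₀ : Space n × Space n × ℝ := (x₀, v₀, 0) with hz₀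
  set R := ‖z₀‖ + 1
  obtain ⟨r, hr0, hr⟩ := hG.exists_isMaximizer R
  set q : Space n × Space n × ℝ → ℝ := fun z =>
    if z.2.2 = 0 then D z.1 z.2.1 else (G z.1 z.2.1 z.2.2 - G z.1 z.2.1 0) / z.2.2 with hq
  have hpt : ∀ p ∈ Metric.closedBall (0 : Space n) r,
      ∀ᶠ y : (Space n × Space n × ℝ) × Space n in 𝓝 (z₀, p),
        (inner ℝ y.2 y.1.2.1 - G y.1.1 y.2 y.1.2.2 < lagrangian G y.1.1 y.1.2.1 y.1.2.2 ∧
          inner ℝ y.2 y.1.2.1 - G y.1.1 y.2 0 < lagrangian G y.1.1 y.1.2.1 0) ∨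
        |q (y.1.1, y.2, y.1.2.2) + k₀| < ε / 2 := by
    intro p _
    have c1 := hG.continuous_lagrangian_comp (X := (Space n × Space n × ℝ) × Space n)
      (x := fun y => y.1.1) (v := fun y => y.1.2.1) (u := fun y => y.1.2.2)
      (by fun_prop) (by fun_prop) (by fun_prop)
    have c2 := hG.continuous_lagrangian_comp (X := (Space n × Space n × ℝ) × Space n)
      (x := fun y => y.1.1) (v := fun y => y.1.2.1) (u := fun y => 0)
      (by fun_prop) (by fun_prop) (by fun_prop)
    have c3 := hG.h1.continuous_comp (X := (Space n × Space n × ℝ) × Space n)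
      (x := fun y => y.1.1) (p := fun y => y.2) (u := fun y => y.1.2.2)
      (by fun_prop) (by fun_prop) (by fun_prop)
    have c4 := hG.h1.continuous_comp (X := (Space n × Space n × ℝ) × Space n)
      (x := fun y => y.1.1) (p := fun y => y.2) (u := fun y => 0)
      (by fun_prop) (by fun_prop) (by fun_prop)
    have c0 : Continuous fun y : (Space n × Space n × ℝ) × Space n => inner ℝ y.2 y.1.2.1 := by
      fun_prop
    have c5 : Continuous fun y : (Space n × Space n × ℝ) × Space n =>
        |q (y.1.1, y.2, y.1.2.2) + k₀| := by
      have := hD.comp (f := fun y : (Space n × Space n × ℝ) × Space n => (y.1.1, y.2, y.1.2.2))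
        (by fun_prop)
      exact (this.add continuous_const).abs
    -- Each `p` in the compact ball either fails to be a maximizer, which persists nearby, or has
    -- the common value of `D`.
    by_cases hp : IsMaximizer G x₀ v₀ 0 p
    · have hz : q (x₀, p, 0) + k₀ = 0 := by
        rw [hk₀', hG.deriv_lagrangian hD (hL x₀ v₀) hp]
        simp [hq]
      have := c5.continuousAt.eventually_lt (continuousAt_const (y := ε / 2))
        (x₀ := (z₀, p)) (by simp only [hz₀, hz, abs_zero]; positivity)
      filter_upwards [this] with y hy using Or.inr hy
    · rw [hG.isMaximizer_iff, not_le] at hp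
      have t1 := ContinuousAt.eventually_lt (x₀ := (z₀, p))
        (f := fun y : (Space n × Space n × ℝ) × Space n =>
          inner ℝ y.2 y.1.2.1 - G y.1.1 y.2 y.1.2.2) (c0.sub c3).continuousAt c1.continuousAt hp
      have t2 := ContinuousAt.eventually_lt (x₀ := (z₀, p))
        (f := fun y : (Space n × Space n × ℝ) × Space n =>
          inner ℝ y.2 y.1.2.1 - G y.1.1 y.2 0) (c0.sub c4).continuousAt c2.continuousAt hp
      filter_upwards [t1, t2] with y hy1 hy2 using Or.inl ⟨hy1, hy2⟩
  have htube := (isCompact_closedBall (0 : Space n) r).eventually_forall_of_forall_eventually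
    (P := fun (z : Space n × Space n × ℝ) p => (inner ℝ p z.2.1 - G z.1 p z.2.2 < lagrangian G z.1 z.2.1 z.2.2 ∧
          inner ℝ p z.2.1 - G z.1 p 0 < lagrangian G z.1 z.2.1 0) ∨
        |q (z.1, p, z.2.2) + k₀| < ε / 2) hpt
  have hev : ∀ᶠ z in 𝓝 z₀, ‖z‖ < R :=
    continuous_norm.continuousAt.eventually_lt continuousAt_const (lt_add_one _)
  filter_upwards [hev, htube] with z hz ht
  have e1 : ‖z.1‖ ≤ R := (norm_fst_le z).trans hz.le
  have e2 : ‖z.2.1‖ ≤ R := (norm_fst_le z.2).trans ((norm_snd_le z).trans hz.le)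
  have e3 : |z.2.2| ≤ R := (norm_snd_le z.2).trans ((norm_snd_le z).trans hz.le)
  have hR0 : |(0 : ℝ)| ≤ R := by simp [R]; positivity
  obtain ⟨⟨p₁, hp₁⟩, hb₁⟩ := hr _ _ _ e1 e2 e3
  obtain ⟨⟨p₀, hp₀⟩, hb₀⟩ := hr _ _ _ e1 e2 hR0
  have f₀ : |q (z.1, p₀, z.2.2) + k₀| < ε / 2 := by
    rcases ht p₀ (by simpa using hb₀ p₀ hp₀) with h | h
    · exact absurd h.2 (not_lt.2 hp₀.lagrangian_eq.le)
    · exact h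
  have f₁ : |q (z.1, p₁, z.2.2) + k₀| < ε / 2 := by
    rcases ht p₁ (by simpa using hb₁ p₁ hp₁) with h | h
    · exact absurd h.1 (not_lt.2 hp₁.lagrangian_eq.le)
    · exact h
  have := hG.lagrangianQuotient_between hD hL hp₀ hp₁ (a := -k₀ - ε / 2) (b := -k₀ + ε / 2) (by
    intro p hp
    have f : |q (z.1, p, z.2.2) + k₀| < ε / 2 := by
      rcases hp with rfl | rfl
      exacts [f₀, f₁]
    have f' := abs_lt.1 f
    simp only [hq] at f'
    constructor <;> linarith [f'.1, f'.2])
  rw [Real.dist_eq, abs_lt]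
  constructor <;> linarith [this.1, this.2]

theorem lagrangianQuotient_le (hL : ∀ x v : Space n, DifferentiableAt ℝ (lagrangian G x v) 0)
    (R : ℝ) : ∃ κ > 0, ∀ x v u, ‖x‖ ≤ R → ‖v‖ ≤ R → |u| ≤ R →
      lagrangianQuotient G x v u ≤ -κ := by
  obtain ⟨D, hD⟩ := hG.quotient
  obtain ⟨r, hr0, hr⟩ := hG.exists_isMaximizer R
  obtain ⟨κ, hκ, hinc⟩ := hG.increasing r hr0
  refine ⟨κ, hκ, fun x v u hx hv hu => ?_⟩
  obtain ⟨⟨p₁, hp₁⟩, hb₁⟩ := hr _ _ _ hx hv hu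
  obtain ⟨⟨p₀, hp₀⟩, hb₀⟩ := hr x v 0 hx hv (by simpa using (norm_nonneg x).trans hx)
  have hquot : ∀ p, ‖p‖ ≤ r → ∀ u ≠ 0, κ ≤ (G x p u - G x p 0) / u := by
    intro p hp u hu
    rcases lt_or_gt_of_ne hu with h | h
    · rw [le_div_iff_of_neg h]
      linarith [hinc x p hp u 0 h.le]
    · rw [le_div_iff₀ h]
      linarith [hinc x p hp 0 u h.le]
  have hlow : ∀ p, ‖p‖ ≤ r → κ ≤ if u = 0 then D x p else (G x p u - G x p 0) / u := by
    intro p hp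
    split_ifs with h
    · have := (hD.comp (f := fun u : ℝ => (x, p, u)) (by fun_prop)).tendsto 0
      simp only [Function.comp_def, if_true] at this
      refine ge_of_tendsto (this.mono_left (nhdsWithin_le_nhds (s := {0}ᶜ))) ?_
      filter_upwards [self_mem_nhdsWithin] with s hs
      rw [if_neg (show s ≠ 0 from hs)]
      exact hquot p hp s hs
    · exact hquot p hp u h
  set q : Space n → ℝ := fun p => if u = 0 then D x p else (G x p u - G x p 0) / u with hq
  -- Only the lower bound `κ` matters; `b` is merely some upper bound for the two quotients.
  refine (hG.lagrangianQuotient_between hD hL hp₀ hp₁ (a := κ) (b := max (q p₀) (q p₁)) ?_).2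
  intro p hp
  rcases hp with rfl | rfl
  · exact ⟨hlow _ (hb₀ _ hp₀), le_max_left _ _⟩
  · exact ⟨hlow _ (hb₁ _ hp₁), le_max_right _ _⟩

end IsTonelli

/-- The discount index is the extended difference quotient. -/
theorem discountIndex_eq {G : Hamiltonian n} {lam : ℝ} (hlam : 0 < lam) (u : Space n → ℝ)
    {x v : Space n} (hL : DifferentiableAt ℝ (lagrangian G x v) 0) :
    discountIndex (lagrangian G) lam u x v = lagrangianQuotient G x v (lam * u x) := by
  unfold discountIndex lagrangianQuotient
  by_cases h : u x = 0
  · rw [if_pos h, if_pos (by simp [h]), hL.derivWithin (uniqueDiffOn_Ici 0 0 self_mem_Ici)]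
  · rw [if_neg h, if_neg (mul_ne_zero hlam.ne' h)]

/-- The modulus in (H3) makes the quotients converge locally uniformly as `u → 0⁺`, so the
derivative at `u = 0` is jointly continuous in `(x, p)`. The same modulus, which covers both signs
of `u`, then gives continuity at `u = 0`. -/
theorem continuous_differenceQuotient {H : Hamiltonian n} (h1 : AssumptionH1 H)
    (h3 : AssumptionH3 H) : Continuous fun z : Space n × Space n × ℝ =>
      if z.2.2 = 0 then deriv (H z.1 z.2.1) 0 else (H z.1 z.2.1 z.2.2 - H z.1 z.2.1 0) / z.2.2 := by
  have hH0 : Continuous fun z : Space n × Space n × ℝ => H z.1 z.2.1 0 :=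
    h1.continuous_comp (by fun_prop) (by fun_prop) (by fun_prop)
  have hDc : Continuous fun z : Space n × Space n => deriv (H z.1 z.2) 0 := by
    have hlim : TendstoLocallyUniformly
        (fun (u : ℝ) (z : Space n × Space n) => (H z.1 z.2 u - H z.1 z.2 0) / u)
        (fun z => deriv (H z.1 z.2) 0) (𝓝[>] (0 : ℝ)) := by
      rw [Metric.tendstoLocallyUniformly_iff]
      intro ε hε z₀
      obtain ⟨ω, hω, hb⟩ := h3.modulus (‖z₀‖ + 1) (by positivity)
      refine ⟨Metric.ball z₀ 1, Metric.ball_mem_nhds _ one_pos, ?_⟩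
      filter_upwards [hω.eventually (gt_mem_nhds hε), self_mem_nhdsWithin] with u hu hu0 z hz
      have hu0 : 0 < u := hu0
      have hzn : ‖z‖ ≤ ‖z₀‖ + 1 := by
        rw [Metric.mem_ball, dist_eq_norm] at hz
        linarith [norm_sub_norm_le z z₀]
      have := hb z.1 z.2 ((norm_fst_le z).trans hzn) ((norm_snd_le z).trans hzn) u hu0.ne'
      rw [abs_of_pos hu0] at this
      rw [dist_comm, Real.dist_eq]
      linarith
    refine hlim.continuous (Frequently.of_forall fun u => ?_)
    have e1 : Continuous fun z : Space n × Space n => H z.1 z.2 u :=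
      h1.continuous_comp continuous_fst continuous_snd continuous_const
    have e2 : Continuous fun z : Space n × Space n => H z.1 z.2 0 :=
      h1.continuous_comp continuous_fst continuous_snd continuous_const
    exact (e1.sub e2).div_const u
  rw [continuous_iff_continuousAt]
  rintro ⟨x₀, p₀, u₀⟩
  rcases ne_or_eq u₀ 0 with hu | rfl
  · have hc : ContinuousAt (fun z : Space n × Space n × ℝ =>
        (H z.1 z.2.1 z.2.2 - H z.1 z.2.1 0) / z.2.2) (x₀, p₀, u₀) :=
      ContinuousAt.div (h1.continuous.sub hH0).continuousAt (by fun_prop) hu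
    refine hc.congr ?_
    filter_upwards [(continuous_snd.comp continuous_snd).continuousAt.eventually_ne hu] with z hz
    exact (if_neg hz).symm
  rw [ContinuousAt, Metric.tendsto_nhds]
  intro ε hε
  set z₀ : Space n × Space n × ℝ := (x₀, p₀, 0) with hz₀
  obtain ⟨ω, hω, hb⟩ := h3.modulus (‖z₀‖ + 1) (by positivity)
  obtain ⟨δ, hδ, hωδ⟩ := Metric.mem_nhdsWithin_iff.1
    (hω.eventually (gt_mem_nhds (show (0 : ℝ) < ε / 2 by positivity)))
  have hDz : Continuous fun z : Space n × Space n × ℝ => deriv (H z.1 z.2.1) 0 :=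
    hDc.comp (f := fun z : Space n × Space n × ℝ => (z.1, z.2.1)) (by fun_prop)
  filter_upwards [Metric.tendsto_nhds.1 (hDz.tendsto z₀) (ε / 2) (by positivity),
    Metric.ball_mem_nhds z₀ one_pos, Metric.ball_mem_nhds z₀ hδ] with z hz1 hz2 hz3
  simp only [hz₀, if_true] at hz1 ⊢
  split_ifs with hzu
  · exact hz1.trans (by linarith)
  have hzn : ‖z‖ ≤ ‖z₀‖ + 1 := by
    rw [Metric.mem_ball, dist_eq_norm] at hz2
    linarith [norm_sub_norm_le z z₀]
  have h4 := hb z.1 z.2.1 ((norm_fst_le z).trans hzn)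
    ((norm_fst_le z.2).trans ((norm_snd_le z).trans hzn)) z.2.2 hzu
  have h5 : |z.2.2| < δ := by
    rw [Metric.mem_ball, dist_eq_norm] at hz3
    have := (norm_snd_le (z - z₀).2).trans ((norm_snd_le (z - z₀)).trans hz3.le)
    have h6 := (norm_snd_le (z - z₀).2).trans_lt ((norm_snd_le (z - z₀)).trans_lt hz3)
    simpa [hz₀] using h6
  have h6 : ω |z.2.2| < ε / 2 := hωδ ⟨by simpa using h5, abs_pos.2 hzu⟩
  rw [← Real.dist_eq] at h4
  linarith [dist_triangle ((H z.1 z.2.1 z.2.2 - H z.1 z.2.1 0) / z.2.2) (deriv (H z.1 z.2.1) 0)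
    (deriv (H x₀ p₀) 0)]

theorem isTonelli_of_isSuperlinear {H : Hamiltonian n} (h1 : AssumptionH1 H) (h3 : AssumptionH3 H)
    (hs : IsSuperlinear H) : IsTonelli H where
  h1 := h1
  superlinear := hs
  quotient := ⟨fun x p => deriv (H x p) 0, continuous_differenceQuotient h1 h3⟩
  increasing R hR := by
    obtain ⟨κ, hκ, κ', -, h⟩ := h3.le_sub hR
    exact ⟨κ, hκ, fun x p hp u v huv => (h x p hp u v huv).1⟩

/-! ### The superlinear modification -/

theorem hasDerivAt_max_sq (t : ℝ) :
    HasDerivAt (fun s : ℝ => (max 0 s) ^ 2) (2 * max 0 t) t := by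
  rcases lt_trichotomy t 0 with h | rfl | h
  · rw [max_eq_left h.le, mul_zero]
    refine (hasDerivAt_const t (0 : ℝ)).congr_of_eventuallyEq ?_
    filter_upwards [gt_mem_nhds h] with s hs
    simp [max_eq_left hs.le]
  · rw [max_self, mul_zero, hasDerivAt_iff_isLittleO]
    simp only [max_self, sub_zero, smul_zero, ne_eq, OfNat.ofNat_ne_zero, not_false_eq_true,
      zero_pow]
    have h2 : (fun s : ℝ => s ^ 2) =o[𝓝 0] fun s : ℝ => s := by
      simpa using Asymptotics.isLittleO_pow_pow (𝕜 := ℝ) (show 1 < 2 by norm_num)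
    refine (Asymptotics.IsBigO.of_bound 1 (Eventually.of_forall fun s => ?_)).trans_isLittleO h2
    rw [one_mul, norm_pow, norm_pow]
    gcongr
    rcases le_total s 0 with hs | hs
    · simp [max_eq_left hs]
    · simp [max_eq_right hs]
  · rw [max_eq_right h.le]
    have := (hasDerivAt_pow 2 t)
    refine (by simpa using this : HasDerivAt (fun s : ℝ => s ^ 2) (2 * t) t).congr_of_eventuallyEq ?_
    filter_upwards [lt_mem_nhds h] with s hs
    simp [max_eq_right hs.le]

/-- The slope of `t ↦ t + (max 0 (t - c))²`. -/
noncomputable def superSlope (c a b : ℝ) : ℝ :=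
  1 + ∫ s in (0 : ℝ)..1, 2 * max 0 (a + s * (b - a) - c)

theorem continuous_superSlope (c : ℝ) : Continuous fun z : ℝ × ℝ => superSlope c z.1 z.2 := by
  unfold superSlope
  refine continuous_const.add ?_
  exact intervalIntegral.continuous_parametric_intervalIntegral_of_continuous' (by fun_prop) 0 1

/-- The factor is continuous also at `a = b`. Thus the difference quotient of the modified
Hamiltonian is a continuous multiple of that of `H`. -/
theorem superSlope_mul_sub (c a b : ℝ) :
    superSlope c a b * (b - a) = (b + (max 0 (b - c)) ^ 2) - (a + (max 0 (a - c)) ^ 2) := by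
  have hd : ∀ s : ℝ, HasDerivAt (fun s => (max 0 (a + s * (b - a) - c)) ^ 2)
      ((2 * max 0 (a + s * (b - a) - c)) * (b - a)) s := by
    intro s
    have e : HasDerivAt (fun s : ℝ => a + s * (b - a) - c) (b - a) s := by
      simpa using (((hasDerivAt_id s).mul_const (b - a)).const_add a).sub_const c
    exact (hasDerivAt_max_sq _).comp s e
  have := intervalIntegral.integral_eq_sub_of_hasDerivAt (a := 0) (b := 1) (fun s _ => hd s)
    (Continuous.intervalIntegrable (by fun_prop) _ _)
  rw [intervalIntegral.integral_mul_const] at this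
  rw [superSlope, add_mul, this]
  simp
  ring

theorem superlinearization_sub (H : Hamiltonian n) (x p : Space n) (u v : ℝ) :
    superlinearization H x p v - superlinearization H x p u =
      superSlope (criticalValue H) (H x p u) (H x p v) * (H x p v - H x p u) := by
  rw [superSlope_mul_sub]
  rfl

theorem le_superlinearization (H : Hamiltonian n) (x p : Space n) (u : ℝ) :
    H x p u ≤ superlinearization H x p u :=
  le_add_of_nonneg_right (by positivity)

theorem superlinearization_eq {H : Hamiltonian n} {x p : Space n} {u : ℝ}
    (h : H x p u ≤ criticalValue H) : superlinearization H x p u = H x p u := by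
  simp [superlinearization, h]

theorem AssumptionH1.superlinearized {H : Hamiltonian n} (h1 : AssumptionH1 H) :
    AssumptionH1 (superlinearization H) where
  continuous := by
    have := h1.continuous
    unfold superlinearization
    exact this.add ((continuous_const.max (this.sub continuous_const)).pow 2)
  monotone x p u v huv := by
    have := h1.monotone x p huv
    unfold superlinearization
    gcongr
  convex x u := by
    have hm : ConvexOn ℝ univ fun p => max 0 (H x p u - criticalValue H) :=
      (convexOn_const 0 convex_univ).sup ((h1.convex x u).sub (concaveOn_const _ convex_univ))
    have := hm.pow (fun p _ => le_max_left _ _) 2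
    exact (h1.convex x u).add this
  coercive K I hK hI M := by
    obtain ⟨r, hr⟩ := h1.coercive K I hK hI M
    exact ⟨r, fun x hx p hp u hu => (hr x hx p hp u hu).trans (le_superlinearization H x p u)⟩

/-- A convex coercive function grows at least linearly, so the added square grows quadratically. -/
theorem AssumptionH1.isSuperlinear_superlinearization {H : Hamiltonian n} (h1 : AssumptionH1 H) :
    IsSuperlinear (superlinearization H) := by
  intro K I hK hI M
  have hc : Continuous fun z : Space n × ℝ => H z.1 0 z.2 :=
    h1.continuous_comp continuous_fst continuous_const continuous_snd
  obtain ⟨B, hB⟩ := (hK.prod hI).exists_bound_of_continuousOn hc.continuousOn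
  obtain ⟨r₀, hr₀⟩ := h1.coercive K I hK hI (|B| + 1)
  set r := max 1 r₀ with hr
  have hr1 : 0 < r := by positivity
  set c := criticalValue H
  -- Convexity along the ray from `0`: at norm `r` the function is at least `|B| + 1`, at the origin
  -- it is at most `|B|`.
  have hlin : ∀ x ∈ K, ∀ p : Space n, r ≤ ‖p‖ → ∀ u ∈ I, ‖p‖ / r - |B| ≤ H x p u := by
    intro x hx p hp u hu
    have hp0 : 0 < ‖p‖ := hr1.trans_le hp
    have hθ : r / ‖p‖ ≤ 1 := (div_le_one hp0).2 hp
    have hθ0 : 0 < r / ‖p‖ := by positivity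
    have e1 := (h1.convex x u).2 (mem_univ p) (mem_univ (0 : Space n)) hθ0.le
      (sub_nonneg.2 hθ) (by ring)
    have e2 := hr₀ x hx ((r / ‖p‖) • p) (by
      rw [norm_smul, Real.norm_of_nonneg hθ0.le, div_mul_cancel₀ _ hp0.ne']
      exact le_max_right _ _) u hu
    have e3 := abs_le.1 (hB (x, u) ⟨hx, hu⟩)
    simp only [smul_zero, add_zero, smul_eq_mul] at e1 e3
    have hBa := le_abs_self B
    have e4 : (1 - r / ‖p‖) * H x 0 u ≤ (1 - r / ‖p‖) * |B| :=
      mul_le_mul_of_nonneg_left (e3.2.trans hBa) (sub_nonneg.2 hθ)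
    have e5 : 1 + r / ‖p‖ * |B| ≤ r / ‖p‖ * H x p u := by linarith
    have e6 : ‖p‖ / r * (1 + r / ‖p‖ * |B|) ≤ ‖p‖ / r * (r / ‖p‖ * H x p u) := by gcongr
    have e7 : ‖p‖ / r * (1 + r / ‖p‖ * |B|) = ‖p‖ / r + |B| := by field_simp
    have e8 : ‖p‖ / r * (r / ‖p‖ * H x p u) = H x p u := by field_simp
    linarith [abs_nonneg B]
  -- With `s = ‖p‖ / (2r)`, the second threshold ensures `H - c ≥ s`, and the third `s² ≥ (|M| +
  -- |B|) ‖p‖`.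
  refine ⟨max r (max (2 * r * (|B| + |c|)) (4 * r ^ 2 * (|M| + |B|))), fun x hx p hp u hu => ?_⟩
  have hpr : r ≤ ‖p‖ := (le_max_left _ _).trans hp
  have hp2 : 2 * r * (|B| + |c|) ≤ ‖p‖ := (le_max_left _ _).trans ((le_max_right _ _).trans hp)
  have hp3 : 4 * r ^ 2 * (|M| + |B|) ≤ ‖p‖ :=
    (le_max_right _ _).trans ((le_max_right _ _).trans hp)
  have hp1 : 1 ≤ ‖p‖ := (le_max_left _ _).trans hpr
  have hl := hlin x hx p hpr u hu
  set s := ‖p‖ / (2 * r) with hs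
  have hs0 : 0 ≤ s := by positivity
  have hs1 : ‖p‖ / r = s + s := by rw [hs]; field_simp; ring
  have hs2 : |B| + |c| ≤ s := by
    rw [hs, le_div_iff₀ (by positivity)]
    linarith
  have hsq : s ≤ max 0 (H x p u - c) := by
    refine le_trans ?_ (le_max_right _ _)
    linarith [le_abs_self c]
  have hsq2 : s ^ 2 ≤ (max 0 (H x p u - c)) ^ 2 := by gcongr
  have hs3 : (|M| + |B|) * ‖p‖ ≤ s ^ 2 := by
    rw [hs, div_pow, le_div_iff₀ (by positivity)]
    calc (|M| + |B|) * ‖p‖ * (2 * r) ^ 2 = 4 * r ^ 2 * (|M| + |B|) * ‖p‖ := by ring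
      _ ≤ ‖p‖ * ‖p‖ := by gcongr
      _ = ‖p‖ ^ 2 := by ring
  have hB1 : |B| ≤ |B| * ‖p‖ := le_mul_of_one_le_right (abs_nonneg _) hp1
  have hM : M * ‖p‖ ≤ |M| * ‖p‖ := by gcongr; exact le_abs_self M
  unfold superlinearization
  linarith

theorem isTonelli_superlinearization {H : Hamiltonian n} (h1 : AssumptionH1 H)
    (h3 : AssumptionH3 H) : IsTonelli (superlinearization H) where
  h1 := h1.superlinearized
  superlinear := h1.isSuperlinear_superlinearization
  quotient := by
    refine ⟨fun x p => superSlope (criticalValue H) (H x p 0) (H x p 0) * deriv (H x p) 0, ?_⟩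
    have hq := continuous_differenceQuotient h1 h3
    have hσ : Continuous fun z : Space n × Space n × ℝ =>
        superSlope (criticalValue H) (H z.1 z.2.1 0) (H z.1 z.2.1 z.2.2) :=
      (continuous_superSlope (criticalValue H)).comp
        (f := fun z : Space n × Space n × ℝ => (H z.1 z.2.1 0, H z.1 z.2.1 z.2.2))
        ((h1.continuous_comp (by fun_prop) (by fun_prop) (by fun_prop)).prodMk h1.continuous)
    refine (hσ.mul hq).congr fun z => ?_
    simp only [Pi.mul_apply]
    split_ifs with h
    · simp only [h]
    · rw [superlinearization_sub, mul_div_assoc]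
  increasing R hR := by
    obtain ⟨κ, hκ, κ', -, h⟩ := h3.le_sub hR
    refine ⟨κ, hκ, fun x p hp u v huv => (h x p hp u v huv).1.trans ?_⟩
    have hm := h1.monotone x p huv
    have : (max 0 (H x p u - criticalValue H)) ^ 2 ≤ (max 0 (H x p v - criticalValue H)) ^ 2 := by
      gcongr
    unfold superlinearization
    linarith

/-- The relation between `H` and the Hamiltonian that defines the Lagrangian. -/
theorem tonelli_data {H G : Hamiltonian n} (h1 : AssumptionH1 H) (h3 : AssumptionH3 H)
    (hG : (G = H ∧ IsSuperlinear H) ∨ G = superlinearization H) :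
    IsTonelli G ∧ (∀ x p u, H x p u ≤ criticalValue H → G x p u = H x p u) ∧
      ∀ x p u, H x p u ≤ G x p u := by
  rcases hG with ⟨rfl, hs⟩ | rfl
  · exact ⟨isTonelli_of_isSuperlinear h1 h3 hs, fun _ _ _ _ => rfl, fun _ _ _ => le_rfl⟩
  · exact ⟨isTonelli_superlinearization h1 h3, fun _ _ _ h => superlinearization_eq h,
      fun x p u => le_superlinearization H x p u⟩

/-- A subsolution sees only momenta at which `H ≤ c`, where the two Hamiltonians agree. -/
theorem IsSubsolution.congr {H G : Hamiltonian n} {c lam : ℝ} {u : Space n → ℝ}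
    (hle : ∀ x p u, H x p u ≤ c → G x p u = H x p u) (h : IsSubsolution H c lam u) :
    IsSubsolution G c lam u :=
  ⟨h.1, fun φ hφ x hx => by
    have := h.2 φ hφ x hx
    rwa [hle _ _ _ this]⟩

theorem IsSupersolution.congr {H G : Hamiltonian n} {c lam : ℝ} {u : Space n → ℝ}
    (hle : ∀ x p u, H x p u ≤ G x p u) (h : IsSupersolution H c lam u) :
    IsSupersolution G c lam u :=
  ⟨h.1, fun φ hφ x hx => (h.2 φ hφ x hx).trans (hle _ _ _)⟩

/-! ### Curves and the Lagrangian action -/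

/-- Local Lipschitz continuity, with Lipschitz constants on balls. -/
def LocallyLip (u : Space n → ℝ) : Prop :=
  ∀ R : ℝ, ∃ M, 0 ≤ M ∧ ∀ x y, ‖x‖ ≤ R → ‖y‖ ≤ R → |u y - u x| ≤ M * ‖y - x‖

theorem _root_.AbsolutelyContinuousOnInterval.comp_lipschitz {X Y : Type*} [PseudoMetricSpace X]
    [PseudoMetricSpace Y] {f : ℝ → X} {a b : ℝ} (hf : AbsolutelyContinuousOnInterval f a b)
    {g : X → Y} {K : ℝ} (hg : ∀ s ∈ uIcc a b, ∀ t ∈ uIcc a b,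
      dist (g (f s)) (g (f t)) ≤ K * dist (f s) (f t)) :
    AbsolutelyContinuousOnInterval (fun s => g (f s)) a b := by
  unfold AbsolutelyContinuousOnInterval at hf ⊢
  have h0 := Filter.Tendsto.const_mul K hf
  rw [mul_zero] at h0
  refine squeeze_zero' (Eventually.of_forall fun E => Finset.sum_nonneg fun _ _ => dist_nonneg) ?_ h0
  filter_upwards [mem_inf_of_right (mem_principal_self _)] with E hE
  rw [Finset.mul_sum]
  refine Finset.sum_le_sum fun i hi => ?_
  have := hE.1 i hi
  exact hg _ this.1 _ this.2

/-- The scalar theorem, applied to each coordinate. -/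
theorem ae_differentiableAt_of_absolutelyContinuous {γ : ℝ → Space n} {a b : ℝ}
    (hγ : AbsolutelyContinuousOnInterval γ a b) :
    ∀ᵐ s, s ∈ uIcc a b → DifferentiableAt ℝ γ s := by
  have h : ∀ i : Fin n, ∀ᵐ s, s ∈ uIcc a b → DifferentiableAt ℝ (fun s => γ s i) s := by
    intro i
    refine (hγ.comp_lipschitz (g := fun x : Space n => x i) (K := 1) fun s _ t _ => ?_)
      |>.ae_differentiableAt
    rw [one_mul, dist_eq_norm, dist_eq_norm]
    exact PiLp.norm_apply_le (γ s - γ t) i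
  filter_upwards [ae_all_iff.2 h] with s hs hm
  exact (differentiableAt_euclidean).2 fun i => hs i hm

theorem LocallyLip.comp_absolutelyContinuous {u : Space n → ℝ} (hu : LocallyLip u) {γ : ℝ → Space n}
    {a b : ℝ} (hγ : AbsolutelyContinuousOnInterval γ a b) :
    AbsolutelyContinuousOnInterval (fun s => u (γ s)) a b := by
  obtain ⟨R, hR⟩ := isCompact_uIcc.exists_bound_of_continuousOn hγ.continuousOn
  obtain ⟨M, -, hM⟩ := hu R
  refine hγ.comp_lipschitz (K := M) fun s hs t ht => ?_
  rw [Real.dist_eq, dist_eq_norm]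
  exact hM _ _ (hR t ht) (hR s hs)

theorem tendsto_sub_nhdsGT (s : ℝ) : Tendsto (fun t : ℝ => s - t) (𝓝[>] 0) (𝓝[≠] s) := by
  refine tendsto_nhdsWithin_iff.2 ⟨?_, ?_⟩
  · have : Tendsto (fun t : ℝ => s - t) (𝓝 0) (𝓝 (s - 0)) :=
      (continuous_const.sub continuous_id).tendsto 0
    rw [sub_zero] at this
    exact this.mono_left nhdsWithin_le_nhds
  · filter_upwards [self_mem_nhdsWithin] with t ht
    have ht : 0 < t := ht
    simp only [mem_compl_iff, mem_singleton_iff]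
    linarith

/-- The Lagrangian bounds the derivative of a subsolution along a curve. -/
theorem IsTonelli.deriv_comp_le {G : Hamiltonian n} (hG : IsTonelli G) {c lam : ℝ}
    {u : Space n → ℝ} (hu : IsSubsolution G c lam u) (hlip : LocallyLip u) {γ : ℝ → Space n}
    {s d : ℝ} {q : Space n} (hγ : HasDerivAt γ q s) (hd : HasDerivAt (fun s => u (γ s)) d s) :
    d ≤ lagrangian G (γ s) q (lam * u (γ s)) + c := by
  obtain ⟨huc, hus⟩ := isSubsolution_iff.1 hu
  have hF := hG.h1.frozen (w := fun x => lam * u x) (by fun_prop)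
  refine le_of_forall_pos_le_add fun ε hε => ?_
  set A := lagrangian G (γ s) q (lam * u (γ s)) + c + ε / 2 with hA
  have hslope := eventually_slope_le hF huc (x := γ s) (Eventually.of_forall hus) (q := q)
    (A := A) (ε := ε / 2) (by positivity) (fun p hp => by
      linarith [hG.inner_sub_le (γ s) q (lam * u (γ s)) p])
  obtain ⟨M, hM0, hM⟩ := hlip (‖γ s‖ + 1)
  have hback := tendsto_sub_nhdsGT s
  have hlim := (hasDerivAt_iff_tendsto_slope.1 hd).comp hback
  have hlimγ := (hasDerivAt_iff_tendsto_slope.1 hγ).comp hback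
  -- The subsolution may fail to be differentiable at `γ s`. Its increment along the curve is
  -- therefore compared with that along the straight line of velocity `q`; by the Lipschitz bound
  -- the difference is `o(t)`.
  have herr : Tendsto (fun t => M * ‖slope γ s (s - t) - q‖) (𝓝[>] 0) (𝓝 0) := by
    have := ((hlimγ.sub_const q).norm).const_mul M
    simpa using this
  have hcont : ∀ᶠ t in 𝓝[>] (0 : ℝ), ‖γ (s - t)‖ < ‖γ s‖ + 1 := by
    have h1 : Tendsto (fun t : ℝ => γ (s - t)) (𝓝[>] 0) (𝓝 (γ s)) :=
      hγ.continuousAt.tendsto.comp (hback.mono_right nhdsWithin_le_nhds)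
    exact h1.norm.eventually_lt_const (lt_add_one _)
  have hcont2 : ∀ᶠ t in 𝓝[>] (0 : ℝ), ‖γ s - t • q‖ < ‖γ s‖ + 1 := by
    refine Eventually.filter_mono nhdsWithin_le_nhds ?_
    exact ContinuousAt.eventually_lt (by fun_prop) (by fun_prop) (by simp)
  refine le_of_tendsto hlim ?_
  filter_upwards [hslope, hcont, hcont2, herr.eventually_lt_const (show 0 < ε / 2 by positivity),
    self_mem_nhdsWithin] with t h1 h2 h3 h4 ht
  have ht : 0 < t := ht
  have h5 := (abs_le.1 (hM (γ (s - t)) (γ s - t • q) h2.le h3.le)).2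
  have h6 : γ s - t • q - γ (s - t) = t • (slope γ s (s - t) - q) := by
    rw [slope_def_module, smul_sub, smul_smul]
    have : t * (s - t - s)⁻¹ = -1 := by
      rw [sub_sub_cancel_left, inv_neg, mul_neg, mul_inv_cancel₀ ht.ne']
    rw [this]
    module
  rw [h6, norm_smul, Real.norm_of_nonneg ht.le] at h5
  have h7 : M * (t * ‖slope γ s (s - t) - q‖) ≤ t * (ε / 2) := by
    rw [mul_left_comm]
    gcongr
  simp only [Function.comp_apply, slope_def_field]
  rw [sub_sub_cancel_left, div_neg, ← neg_div, div_le_iff₀ ht]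
  nlinarith

theorem IsTonelli.ae_deriv_le {G : Hamiltonian n} (hG : IsTonelli G) {c lam : ℝ}
    {u : Space n → ℝ} (hu : IsSubsolution G c lam u) (hlip : LocallyLip u) {γ : ℝ → Space n}
    {a b : ℝ} (hγ : AbsolutelyContinuousOnInterval γ a b) :
    ∀ᵐ s, s ∈ uIcc a b → HasDerivAt γ (deriv γ s) s ∧
      HasDerivAt (fun s => u (γ s)) (deriv (fun s => u (γ s)) s) s ∧
      deriv (fun s => u (γ s)) s ≤ lagrangian G (γ s) (deriv γ s) (lam * u (γ s)) + c := by
  filter_upwards [ae_differentiableAt_of_absolutelyContinuous hγ,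
    (hlip.comp_absolutelyContinuous hγ).ae_differentiableAt] with s h1 h2 hs
  exact ⟨(h1 hs).hasDerivAt, (h2 hs).hasDerivAt,
    hG.deriv_comp_le hu hlip (h1 hs).hasDerivAt (h2 hs).hasDerivAt⟩

/-- Subsolutions are dominated by the action. -/
theorem IsTonelli.le_action {G : Hamiltonian n} (hG : IsTonelli G) {c lam : ℝ}
    {u : Space n → ℝ} (hu : IsSubsolution G c lam u) (hlip : LocallyLip u) {z : Space n} {t : ℝ}
    (ht : 0 < t) {η : ℝ → Space n} (hη : IsAdmissible (lagrangian G) lam u z t η) :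
    u z ≤ action (lagrangian G) c lam u t η := by
  obtain ⟨hac, h0, hint⟩ := hη
  have hf := hlip.comp_absolutelyContinuous hac
  have hle : ∫ s in (-t)..0, deriv (fun s => u (η s)) s ≤
      ∫ s in (-t)..0, (lagrangian G (η s) (deriv η s) (lam * u (η s)) + c) := by
    refine intervalIntegral.integral_mono_ae_restrict (by linarith) hf.intervalIntegrable_deriv
      (hint.add intervalIntegrable_const) ?_
    filter_upwards [ae_restrict_mem measurableSet_Icc,
      ae_restrict_of_ae (hG.ae_deriv_le hu hlip hac)] with s hs hs'
    exact (hs' (by rwa [uIcc_of_le (by linarith)])).2.2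
  rw [hf.integral_deriv_eq_sub, h0] at hle
  unfold action
  linarith

set_option maxHeartbeats 1000000 in
/-- One step of a discrete minimizing scheme for a supersolution. -/
theorem IsTonelli.exists_step {G : Hamiltonian n} (hG : IsTonelli G) {c lam : ℝ}
    {u : Space n → ℝ} (hu : IsSupersolution G c lam u) (hlip : LocallyLip u) (R : ℝ) :
    ∃ V > 0, ∀ ε > 0, ∃ h₀ > 0, ∀ h, 0 < h → h ≤ h₀ → ∀ x₀, ‖x₀‖ ≤ R → ∃ v, ‖v‖ ≤ V ∧
      u (x₀ - h • v) + h * (lagrangian G x₀ v (lam * u x₀) + c - ε) ≤ u x₀ := by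
  have huc := hu.1
  obtain ⟨M, hM0, hM⟩ := hlip (R + 1)
  have hF := hG.h1.frozen (w := fun x => lam * u x) (by fun_prop)
  obtain ⟨B, hB⟩ := (isCompact_closedBall (0 : Space n) R).exists_bound_of_continuousOn
    (f := fun x => lam * u x) (by fun_prop)
  obtain ⟨V, hV, hvel⟩ := hG.exists_velocity (max R (max (2 * M) B))
  refine ⟨V, hV, fun ε₀ hε₀ => ?_⟩
  obtain ⟨ε, hε, hε1, hεε⟩ : ∃ ε > 0, ε ≤ 1 ∧ ε ≤ ε₀ :=
    ⟨min 1 ε₀, by positivity, min_le_left _ _, min_le_right _ _⟩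
  have huc' := ((isCompact_closedBall (0 : Space n) (R + 1)).prod
    (isCompact_closedBall (0 : Space n) (2 * M))).uniformContinuousOn_of_continuous
      hF.continuous.continuousOn
  obtain ⟨ρ', hρ', hρF'⟩ := Metric.uniformContinuousOn_iff.1 huc' (ε / 4) (by positivity)
  obtain ⟨ρ, hρ, hρ1, hρρ⟩ : ∃ ρ > 0, ρ ≤ 1 ∧ ρ < ρ' :=
    ⟨min 1 (ρ' / 2), by positivity, min_le_left _ _, (min_le_right _ _).trans_lt (by linarith)⟩
  refine ⟨ρ / (2 * V), by positivity, fun h hh hh₀ x₀ hx₀ => ?_⟩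
  have hhV : h * V ≤ ρ / 2 := by
    rw [le_div_iff₀ (by positivity)] at hh₀
    linarith
  set w := lam * u x₀ with hw
  -- The first condition keeps the minimizing `y` inside its ball; the second makes the error from
  -- replacing `y` by `x₀ - h • v` at most `h ε / 2`.
  obtain ⟨k, hk, hk1, hk2⟩ : ∃ k > 0, M < k * (ρ / 2) ∧ M * M ≤ k * (h * (ε / 2)) := by
    refine ⟨(M + 1) / (ρ / 2) + M * M / (h * (ε / 2)), by positivity, ?_, ?_⟩
    · rw [add_mul, div_mul_cancel₀ _ (by positivity)]
      have : 0 ≤ M * M / (h * (ε / 2)) * (ρ / 2) := by positivity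
      linarith
    · rw [add_mul, div_mul_cancel₀ _ (by positivity)]
      have : 0 ≤ (M + 1) / (ρ / 2) * (h * (ε / 2)) := by positivity
      linarith
  -- Duration `t`, velocity `v` and endpoint `y` are all free, and the endpoint is tied to `x₀ - t •
  -- v` by a penalty. The penalty is a test function for `u` at `y`, so the supersolution property
  -- can be applied.
  set Φ : ℝ × Space n × Space n → ℝ := fun z =>
    u z.2.2 + k * ‖z.2.2 - (x₀ - z.1 • z.2.1)‖ ^ 2 +
      z.1 * (lagrangian G x₀ z.2.1 w + c - ε / 2) with hΦ
  have hΦc : Continuous Φ := by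
    have := hG.continuous_lagrangian_comp (X := ℝ × Space n × Space n) (x := fun _ => x₀)
      (v := fun z => z.2.1) (u := fun _ => w) (by fun_prop) (by fun_prop) (by fun_prop)
    have e1 : Continuous fun z : ℝ × Space n × Space n =>
      u z.2.2 + k * ‖z.2.2 - (x₀ - z.1 • z.2.1)‖ ^ 2 := by fun_prop
    exact e1.add (continuous_fst.mul ((this.add continuous_const).sub continuous_const))
  obtain ⟨⟨t, v, y⟩, hmem, hmin⟩ := (isCompact_Icc.prod ((isCompact_closedBall (0 : Space n) V).prod
    (isCompact_closedBall x₀ ρ))).exists_isMinOn (s := Icc 0 h ×ˢ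
      Metric.closedBall (0 : Space n) V ×ˢ Metric.closedBall x₀ ρ)
    ⟨(0, 0, x₀), by simp [hh.le, hV.le, hρ.le]⟩ hΦc.continuousOn
  obtain ⟨ht, hv, hy⟩ : t ∈ Icc 0 h ∧ ‖v‖ ≤ V ∧ dist y x₀ ≤ ρ := by simpa using hmem
  have hmin' : ∀ t' v' y', t' ∈ Icc 0 h → ‖v'‖ ≤ V → dist y' x₀ ≤ ρ →
      Φ (t, v, y) ≤ Φ (t', v', y') := fun t' v' y' h1 h2 h3 =>
    hmin (show (t', v', y') ∈ _ by simp [h1.1, h1.2, h2, h3])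
  have hball : ∀ y', dist y' x₀ ≤ ρ → ‖y'‖ ≤ R + 1 := by
    intro y' hy'
    rw [dist_eq_norm] at hy'
    linarith [norm_sub_norm_le y' x₀]
  set a := x₀ - t • v with ha
  have hax : dist a x₀ ≤ ρ / 2 := by
    rw [dist_eq_norm, ha, sub_sub_cancel_left, norm_neg, norm_smul, Real.norm_of_nonneg ht.1]
    refine le_trans ?_ hhV
    gcongr
    exact ht.2
  have haM : |u y - u a| ≤ M * ‖y - a‖ := hM a y (hball a (by linarith)) (hball y hy)
  have hya : k * ‖y - a‖ ≤ M := by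
    have h1 := hmin' t v a ht hv (by linarith)
    simp only [hΦ, ← ha, sub_self, norm_zero] at h1
    have h2 := (abs_le.1 haM).1
    have h3 : k * ‖y - a‖ * ‖y - a‖ ≤ M * ‖y - a‖ := by nlinarith
    rcases (norm_nonneg (y - a)).eq_or_lt with h0 | h0
    · rw [← h0, mul_zero]
      exact hM0
    · exact le_of_mul_le_mul_right h3 h0
  have hyρ : dist y x₀ < ρ := by
    have h1 : ‖y - a‖ < ρ / 2 := lt_of_mul_lt_mul_left (hya.trans_lt hk1) hk.le
    rw [← dist_eq_norm] at h1
    linarith [dist_triangle y a x₀]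
  set p := (2 * k) • (a - y) with hp
  have hpM : ‖p‖ ≤ 2 * M := by
    rw [hp, norm_smul, Real.norm_of_nonneg (by positivity), norm_sub_rev]
    linarith
  have hsup : c ≤ G y p (lam * u y) := by
    have h1 := hu.2 (fun z => (-k) * ‖z - a‖ ^ 2) (contDiff_quadratic (-k) a) y (by
      have : ∀ᶠ y' in 𝓝 y, dist y' x₀ < ρ :=
        (continuous_id.dist continuous_const).continuousAt.eventually_lt_const hyρ
      filter_upwards [this] with y' hy'
      have := hmin' t v y' ht hv hy'.le
      simp only [hΦ, ← ha] at this
      linarith)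
    rw [(hasGradientAt_quadratic (-k) a y).gradient] at h1
    convert h1 using 2
    rw [hp]
    module
  have hFx : c - ε / 4 ≤ G x₀ p w := by
    have := hρF' (y, p) ⟨by simpa using hball y hy, by simpa using hpM⟩ (x₀, p)
      ⟨by simp; linarith, by simpa using hpM⟩ (by
        rw [Prod.dist_eq, dist_self]
        exact max_lt (hy.trans_lt hρρ) hρ')
    rw [Real.dist_eq, abs_lt] at this
    simp only [← hw] at this
    linarith [this.2]
  obtain ⟨v', hv', hdual⟩ := hvel x₀ p w (hx₀.trans (le_max_left _ _))
    (hpM.trans ((le_max_left _ _).trans (le_max_right _ _)))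
    ((hB x₀ (by simpa using hx₀)).trans ((le_max_right _ _).trans (le_max_right _ _))) (ε / 8)
    (by positivity) (by linarith)
  -- If time were left, the supersolution inequality and duality would provide a velocity `v'` that
  -- lowers `Φ` when followed for a further short time `s`.
  have hth : t = h := by
    by_contra hne
    have hlt : t < h := lt_of_le_of_ne ht.2 hne
    have hev : ∀ᶠ s in 𝓝[>] (0 : ℝ), t + s < h ∧ k * s * V ^ 2 < ε / 16 := by
      refine ((ContinuousAt.eventually_lt (by fun_prop) (by fun_prop) (by simpa)).and
        (ContinuousAt.eventually_lt (by fun_prop) (by fun_prop) (by simpa))).filter_mono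
          nhdsWithin_le_nhds
    obtain ⟨s, ⟨hs1, hs2⟩, hs0⟩ := (hev.and self_mem_nhdsWithin).exists
    have hs0 : 0 < s := hs0
    have hts : 0 < t + s := by linarith [ht.1]
    -- The average velocity merges both pieces into one straight step; convexity of the Lagrangian
    -- shows that it costs no more.
    set v'' := (t / (t + s)) • v + (s / (t + s)) • v' with hv''
    have hco : t / (t + s) + s / (t + s) = 1 := by field_simp
    have ht0 : 0 ≤ t / (t + s) := div_nonneg ht.1 hts.le
    have hs0' : 0 ≤ s / (t + s) := by positivity
    have hn : ‖v''‖ ≤ V := by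
      have := (convex_closedBall (0 : Space n) V) (x := v) (by simpa) (y := v') (by simpa)
        ht0 hs0' hco
      simpa using this
    have hc := hG.lagrangian_convex x₀ v v' w ht0 hs0' hco
    have hm := hmin' (t + s) v'' y ⟨hts.le, hs1.le⟩ hn hy
    have hsm : (t + s) • v'' = t • v + s • v' := by
      rw [hv'', smul_add, smul_smul, smul_smul, mul_div_cancel₀ _ hts.ne',
        mul_div_cancel₀ _ hts.ne']
    have hpos : y - (x₀ - (t + s) • v'') = (y - a) + s • v' := by
      rw [hsm, ha]
      abel
    simp only [hΦ] at hm
    rw [hpos, ← ha, norm_add_sq_real, inner_smul_right, norm_smul, mul_pow, Real.norm_eq_abs,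
      sq_abs] at hm
    have hin : inner ℝ p v' = -(2 * k * inner ℝ (y - a) v') := by
      rw [hp, inner_smul_left, ← neg_sub y a, inner_neg_left]
      simp
    have hc' : (t + s) * lagrangian G x₀ v'' w ≤
        t * lagrangian G x₀ v w + s * lagrangian G x₀ v' w := by
      have := mul_le_mul_of_nonneg_left hc hts.le
      rw [← hv''] at this
      refine this.trans (le_of_eq ?_)
      field_simp
    have hv2 : ‖v'‖ ^ 2 ≤ V ^ 2 := by gcongr
    have e1 : k * (s ^ 2 * ‖v'‖ ^ 2) ≤ s * (ε / 16) := by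
      calc k * (s ^ 2 * ‖v'‖ ^ 2) ≤ k * (s ^ 2 * V ^ 2) := by gcongr
        _ = s * (k * s * V ^ 2) := by ring
        _ ≤ s * (ε / 16) := by gcongr
    have e2 : s * lagrangian G x₀ v' w ≤ s * (inner ℝ p v' + ε / 8 - (c - ε / 4)) := by
      gcongr
      linarith
    rw [hin] at e2
    have hfin : 0 < s * ε := by positivity
    linarith
  refine ⟨v, hv, ?_⟩
  -- The comparison with standing still bounds the minimum by `u x₀`.
  have h1 := hmin' 0 0 x₀ ⟨le_rfl, hh.le⟩ (by simpa using hV.le) (by simpa using hρ.le)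
  simp only [hΦ, ← ha, zero_smul, sub_zero, sub_self, norm_zero, zero_mul] at h1
  rw [hth] at h1 ha
  rw [← ha]
  have h2 := (abs_le.1 haM).1
  have h3 : M * ‖y - a‖ ≤ h * (ε / 2) := by
    have : k * (M * ‖y - a‖) ≤ k * (h * (ε / 2)) := by
      calc k * (M * ‖y - a‖) = M * (k * ‖y - a‖) := by ring
        _ ≤ M * M := by gcongr
        _ ≤ _ := hk2
    exact le_of_mul_le_mul_left this hk
  have h4 : 0 ≤ k * ‖y - a‖ ^ 2 := by positivity
  have h5 : h * (ε - ε₀) ≤ 0 := mul_nonpos_of_nonneg_of_nonpos hh.le (by linarith)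
  linarith

/-! ### Confinement and existence of calibrated curves -/

/-- Bounds that confine minimizing curves of `u` that start in the ball of radius `R₁` to the ball
of radius `R`. -/
structure Confinement (G : Hamiltonian n) (c lam : ℝ) (u : Space n → ℝ)
    (ε δ R₀ R₁ m N R : ℝ) : Prop where
  eps_pos : 0 < ε
  delta_pos : 0 < δ
  radius_pos : 0 < R₀
  radius_le : R₀ + 1 ≤ R₁
  lower : ∀ x, -N ≤ u x
  upper : ∀ x, ‖x‖ ≤ R₁ → u x ≤ m
  radius_lt : R₁ + (m + N) / ε < R
  small : ∀ x, R₀ ≤ ‖x‖ → ‖x‖ ≤ R → ∀ p, ‖p‖ ≤ ε → G x p (lam * u x) ≤ c - δ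

namespace Confinement

variable {G : Hamiltonian n} {c lam : ℝ} {u : Space n → ℝ} {ε δ R₀ R₁ m N R : ℝ}
  (hC : Confinement G c lam u ε δ R₀ R₁ m N R)

include hC

theorem lt_radius : R₁ < R := by
  have h1 := hC.lower 0
  have h2 := hC.upper 0 (by rw [norm_zero]; linarith [hC.radius_pos, hC.radius_le])
  have h3 : 0 ≤ (m + N) / ε := div_nonneg (by linarith) hC.eps_pos.le
  linarith [hC.radius_lt]

/-- The quantity `u x + ε (‖x‖ - R₁)` serves as a Lyapunov function for the minimizing sequences. -/
theorem norm_lt {x : Space n} (hx : u x + ε * (‖x‖ - R₁) ≤ m) : ‖x‖ < R := by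
  have h1 := hC.lower x
  have h2 : ‖x‖ - R₁ ≤ (m + N) / ε := by
    rw [le_div_iff₀ hC.eps_pos]
    linarith
  linarith [hC.radius_lt]

/-- In the supremum that defines the Lagrangian, the momentum of norm `ε` in the direction of `v` is
tested. -/
theorem le_lagrangian (hG : IsTonelli G) {x v : Space n} (hx : R₀ ≤ ‖x‖) (hxR : ‖x‖ ≤ R) :
    ε * ‖v‖ + δ ≤ lagrangian G x v (lam * u x) + c := by
  have hε := hC.eps_pos
  obtain ⟨p, hp, hpv⟩ : ∃ p : Space n, ‖p‖ ≤ ε ∧ inner ℝ p v = ε * ‖v‖ := by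
    rcases eq_or_ne v 0 with rfl | hv
    · exact ⟨0, by simpa using hε.le, by simp⟩
    · have hv0 : 0 < ‖v‖ := norm_pos_iff.2 hv
      refine ⟨(ε / ‖v‖) • v, ?_, ?_⟩
      · rw [norm_smul, Real.norm_of_nonneg (by positivity), div_mul_cancel₀ _ hv0.ne']
      · rw [inner_smul_left, real_inner_self_eq_norm_sq]
        simp
        field_simp
  have h1 := hG.inner_sub_le x v (lam * u x) p
  have h2 := hC.small x hx hxR p hp
  linarith

/-- Discrete minimizing sequences stay in the ball of radius `R`. -/
theorem exists_discrete (hG : IsTonelli G) (hu : IsSupersolution G c lam u) (hlip : LocallyLip u)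
    {z : Space n} (hz : ‖z‖ ≤ R₁) :
    ∃ V > 0, ∀ ε' > 0, ∃ h₀ > 0, ∀ h, 0 < h → h ≤ h₀ → ∃ x : ℕ → Space n, x 0 = z ∧
      ∀ i, ‖x i‖ ≤ R ∧ ‖x (i + 1) - x i‖ ≤ V * h ∧ ∀ p, u (x (i + 1)) +
        inner ℝ p (x i - x (i + 1)) + h * (c - ε' - G (x i) p (lam * u (x i))) ≤ u (x i) := by
  obtain ⟨V, hV, hstep⟩ := hG.exists_step hu hlip R
  refine ⟨V, hV, fun ε' hε' => ?_⟩
  -- An error of at most `δ` is absorbed by the gain in the outer region.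
  obtain ⟨h₀, hh₀, hstep⟩ := hstep (min ε' δ) (lt_min hε' hC.delta_pos)
  -- Steps of length at most `1` cannot leave the ball of radius `R₁ ≥ R₀ + 1` directly from the
  -- inner ball.
  refine ⟨min h₀ (1 / V), by positivity, fun h hh hle => ?_⟩
  have hhV : h * V ≤ 1 := by
    have := hle.trans (min_le_right _ _)
    rwa [le_div_iff₀ hV] at this
  have hstep' : ∀ y : Space n, ∃ v : Space n, ‖y‖ ≤ R → ‖v‖ ≤ V ∧
      u (y - h • v) + h * (lagrangian G y v (lam * u y) + c - min ε' δ) ≤ u y := by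
    intro y
    by_cases hy : ‖y‖ ≤ R
    · obtain ⟨v, hv⟩ := hstep h hh (hle.trans (min_le_left _ _)) y hy
      exact ⟨v, fun _ => hv⟩
    · exact ⟨0, fun h => absurd h hy⟩
  choose v hv using hstep'
  set x : ℕ → Space n := fun i => (fun y => y - h • v y)^[i] z with hx
  have hxs : ∀ i, x (i + 1) = x i - h • v (x i) := fun i => by
    simp only [hx, Function.iterate_succ_apply']
  -- A step from the inner ball lands in the ball of radius `R₁`. A step from the outer region
  -- lowers `u` by at least `ε` times its length, so the Lyapunov bound persists.
  have hinv : ∀ i, ‖x i‖ ≤ R₁ ∨ u (x i) + ε * (‖x i‖ - R₁) ≤ m := by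
    intro i
    induction i with
    | zero => exact Or.inl hz
    | succ i ih =>
      have hR : ‖x i‖ ≤ R := by
        rcases ih with h1 | h1
        · exact h1.trans hC.lt_radius.le
        · exact (hC.norm_lt h1).le
      obtain ⟨hv1, hv2⟩ := hv (x i) hR
      have hn : ‖x (i + 1)‖ ≤ ‖x i‖ + h * ‖v (x i)‖ := by
        rw [hxs]
        refine (norm_sub_le _ _).trans ?_
        rw [norm_smul, Real.norm_of_nonneg hh.le]
      rcases lt_or_ge ‖x i‖ R₀ with hlt | hge
      · left
        have : h * ‖v (x i)‖ ≤ h * V := by gcongr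
        linarith [hC.radius_le]
      · right
        have hlag := hC.le_lagrangian hG (v := v (x i)) hge hR
        have e1 : h * (ε * ‖v (x i)‖) ≤
            h * (lagrangian G (x i) (v (x i)) (lam * u (x i)) + c - min ε' δ) := by
          gcongr
          linarith [min_le_right ε' δ]
        rw [← hxs] at hv2
        have e2 : ε * ‖x (i + 1)‖ ≤ ε * (‖x i‖ + h * ‖v (x i)‖) := by
          have := hC.eps_pos
          gcongr
        have e3 : u (x i) + ε * (‖x i‖ - R₁) ≤ m := by
          rcases ih with h1 | h1
          · have := hC.upper _ h1
            have : ε * (‖x i‖ - R₁) ≤ 0 :=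
              mul_nonpos_of_nonneg_of_nonpos hC.eps_pos.le (by linarith)
            linarith
          · exact h1
        linarith
  refine ⟨x, rfl, fun i => ?_⟩
  have hR : ‖x i‖ ≤ R := by
    rcases hinv i with h1 | h1
    · exact h1.trans hC.lt_radius.le
    · exact (hC.norm_lt h1).le
  obtain ⟨hv1, hv2⟩ := hv (x i) hR
  refine ⟨hR, ?_, fun p => ?_⟩
  · rw [hxs, sub_sub_cancel_left, norm_neg, norm_smul, Real.norm_of_nonneg hh.le, mul_comm]
    gcongr
  · have h1 := hG.inner_sub_le (x i) (v (x i)) (lam * u (x i)) p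
    rw [hxs, sub_sub_cancel, inner_smul_right]
    have e1 : h * (inner ℝ p (v (x i)) - G (x i) p (lam * u (x i)) + c - ε') ≤
        h * (lagrangian G (x i) (v (x i)) (lam * u (x i)) + c - min ε' δ) := by
      gcongr
      · exact min_le_left _ _
    linarith

end Confinement

/-! ### From discrete sequences to calibrated curves -/

/-- Telescoping the inequality of one step. -/
theorem telescope_step {u : Space n → ℝ} {x : ℕ → Space n} {p : Space n} {h B : ℝ} (hh : 0 ≤ h)
    {g : ℕ → ℝ} (hx : ∀ i, u (x (i + 1)) + inner ℝ p (x i - x (i + 1)) + h * g i ≤ u (x i))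
    (i m : ℕ) (hg : ∀ l, l < m → B ≤ g (i + l)) :
    u (x (i + m)) + inner ℝ p (x i - x (i + m)) + (h * m) * B ≤ u (x i) := by
  induction m with
  | zero => simp
  | succ m ih =>
    have h1 := ih fun l hl => hg l (hl.trans (Nat.lt_succ_self m))
    have h2 := hx (i + m)
    have h3 : h * B ≤ h * g (i + m) := mul_le_mul_of_nonneg_left (hg m (Nat.lt_succ_self m)) hh
    rw [← add_assoc]
    have h4 : inner ℝ p (x i - x (i + m + 1)) =
        inner ℝ p (x i - x (i + m)) + inner ℝ p (x (i + m) - x (i + m + 1)) := by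
      rw [← inner_add_right]
      congr 1
      abel
    push_cast
    linarith

theorem norm_sub_le_of_steps {x : ℕ → Space n} {a : ℝ}
    (hx : ∀ i, ‖x (i + 1) - x i‖ ≤ a) (i m : ℕ) : ‖x (i + m) - x i‖ ≤ a * m := by
  induction m with
  | zero => simp
  | succ m ih =>
    have h1 := hx (i + m)
    have h2 := norm_add_le (x (i + m + 1) - x (i + m)) (x (i + m) - x i)
    rw [sub_add_sub_cancel] at h2
    rw [← add_assoc]
    push_cast
    linarith

/-- The number of grid steps between two times, up to one step. The lower bound needs `0 ≤ s`,
because the natural floor sends all negative numbers to `0`. -/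
theorem floor_add_le {h s t : ℝ} (hh : 0 < h) (hst : s ≤ t) :
    ∃ m : ℕ, ⌊t / h⌋₊ = ⌊s / h⌋₊ + m ∧ h * m ≤ |t - s| + h ∧
      (0 ≤ s → t - s - h ≤ h * m) := by
  have hmono : ⌊s / h⌋₊ ≤ ⌊t / h⌋₊ := Nat.floor_mono (by gcongr)
  obtain ⟨m, hm⟩ := Nat.exists_eq_add_of_le hmono
  refine ⟨m, hm, ?_, fun hs => ?_⟩
  · rw [abs_of_nonneg (by linarith)]
    rcases le_or_gt 0 t with ht | ht
    · have h1 := Nat.floor_le (show 0 ≤ t / h by positivity)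
      have h2 := Nat.lt_floor_add_one (s / h)
      rw [hm] at h1
      push_cast at h1
      have h3 : (m : ℝ) ≤ t / h - s / h + 1 := by linarith
      calc h * m ≤ h * (t / h - s / h + 1) := by gcongr
        _ = t - s + h := by field_simp
    · have h1 : ⌊t / h⌋₊ = 0 := Nat.floor_of_nonpos (div_nonpos_of_nonpos_of_nonneg ht.le hh.le)
      have : m = 0 := by omega
      rw [this]
      simp
      linarith
  · have h1 := Nat.floor_le (show 0 ≤ s / h by positivity)
    have h2 := Nat.lt_floor_add_one (t / h)
    rw [hm] at h2
    push_cast at h2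
    have h3 : t / h - s / h - 1 ≤ (m : ℝ) := by linarith
    calc t - s - h = h * (t / h - s / h - 1) := by field_simp
      _ ≤ h * m := by gcongr

/-- Existence of a Lipschitz curve along which the difference quotients of a supersolution are
bounded below. -/
theorem Confinement.exists_curve {G : Hamiltonian n} {c lam : ℝ} {u : Space n → ℝ}
    {ε δ R₀ R₁ m N R : ℝ} (hC : Confinement G c lam u ε δ R₀ R₁ m N R) (hG : IsTonelli G)
    (hu : IsSupersolution G c lam u) (hlip : LocallyLip u) {z : Space n} (hz : ‖z‖ ≤ R₁) :
    ∃ (γ : ℝ → Space n) (V : ℝ), 0 < V ∧ (∀ s t, ‖γ s - γ t‖ ≤ V * ‖s - t‖) ∧ γ 0 = z ∧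
      ∀ s ≤ 0, ∀ p, ∀ ε₁ > 0, ∀ᶠ t in 𝓝[>] (0 : ℝ), inner ℝ p (γ s - γ (s - t)) +
        t * (c - G (γ s) p (lam * u (γ s)) - ε₁) ≤ u (γ s) - u (γ (s - t)) := by
  have huc := hu.1
  obtain ⟨V, hV, hdis⟩ := hC.exists_discrete hG hu hlip hz
  set ek : ℕ → ℝ := fun k => 1 / ((k : ℝ) + 1) with hek
  have hek0 : ∀ k, 0 < ek k := fun k => by positivity
  have hekl : Tendsto ek atTop (𝓝 0) := tendsto_one_div_add_atTop_nhds_zero_nat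
  choose h₀ hh₀ hdis using fun k => hdis (ek k) (hek0 k)
  set h : ℕ → ℝ := fun k => min (h₀ k) (ek k) with hhdef
  have hh : ∀ k, 0 < h k := fun k => lt_min (hh₀ k) (hek0 k)
  have hhl : Tendsto h atTop (𝓝 0) :=
    squeeze_zero (fun k => (hh k).le) (fun k => min_le_right _ _) hekl
  choose x hx0 hx using fun k => hdis k (h k) (hh k) (min_le_left _ _)
  -- Step curves in backward time, constant on `s ≥ 0`. They are Lipschitz up to the error `V * h
  -- k`, which suffices for compactness.
  set γk : ℕ → ℝ → Space n := fun k s => x k ⌊(-s) / h k⌋₊ with hγk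
  have hγlip' : ∀ k s t, s ≤ t → ‖γk k s - γk k t‖ ≤ V * ‖s - t‖ + V * h k := by
    intro k s t hst
    obtain ⟨m, hm, hm1, -⟩ := floor_add_le (hh k) (neg_le_neg hst)
    have h1 := norm_sub_le_of_steps (fun i => ((hx k) i).2.1) ⌊(-t) / h k⌋₊ m
    simp only [hγk, hm]
    refine h1.trans ?_
    rw [Real.norm_eq_abs]
    have h2 : |-s - -t| = |s - t| := by rw [neg_sub_neg, abs_sub_comm]
    rw [h2] at hm1
    calc V * h k * m = V * (h k * m) := by ring
      _ ≤ V * (|s - t| + h k) := by gcongr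
      _ = _ := by ring
  have hγlip : ∀ k s t, ‖γk k s - γk k t‖ ≤ V * ‖s - t‖ + V * h k := by
    intro k s t
    rcases le_total s t with hst | hst
    · exact hγlip' k s t hst
    · rw [norm_sub_rev, norm_sub_rev s t]
      exact hγlip' k t s hst
  obtain ⟨γ, φ, hφ, hlim, hγL⟩ := exists_subseq_tendstoLocallyUniformly (f := γk)
    (M := fun _ => V) (δ := fun k => V * h k) (fun s => ⟨R, fun k => ((hx k) _).1⟩)
    (by simpa using hhl.const_mul V) (fun _ k s t _ _ => hγlip k s t)
  have hpt : ∀ s, Tendsto (fun k => γk (φ k) s) atTop (𝓝 (γ s)) := fun s =>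
    hlim.tendstoLocallyUniformlyOn.tendsto_at (mem_univ s)
  have hγV : ∀ s t, ‖γ s - γ t‖ ≤ V * ‖s - t‖ := fun s t =>
    hγL (max ‖s‖ ‖t‖) s t (le_max_left _ _) (le_max_right _ _)
  refine ⟨γ, V, hV, hγV, ?_, ?_⟩
  · refine tendsto_nhds_unique (hpt 0) ?_
    simp [hγk, hx0]
  intro s hs p ε₁ hε₁
  set F₀ := G (γ s) p (lam * u (γ s)) with hF₀
  have hFc : Continuous fun y => G y p (lam * u y) :=
    hG.h1.continuous_comp continuous_id continuous_const (by fun_prop)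
  obtain ⟨r, hr, hrF⟩ := Metric.continuous_iff.1 hFc (γ s) ε₁ hε₁
  have hev : ∀ᶠ t in 𝓝[>] (0 : ℝ), V * t < r / 4 := by
    refine Eventually.filter_mono nhdsWithin_le_nhds ?_
    exact ContinuousAt.eventually_lt (by fun_prop) (by fun_prop) (by simpa)
  filter_upwards [hev, self_mem_nhdsWithin] with t ht ht0
  have ht0 : 0 < t := ht0
  have hhφ := hhl.comp hφ.tendsto_atTop
  have hekφ := hekl.comp hφ.tendsto_atTop
  have hB : Tendsto (fun k => c - F₀ - ε₁ - ek (φ k)) atTop (𝓝 (c - F₀ - ε₁ - 0)) :=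
    tendsto_const_nhds.sub hekφ
  -- With `p` fixed, the inequality involves only positions and sums telescopically. It therefore
  -- passes to the limit although the discrete velocities need not converge.
  have key : ∀ᶠ k in atTop, u (γk (φ k) (s - t)) +
      inner ℝ p (γk (φ k) s - γk (φ k) (s - t)) + (t * (c - F₀ - ε₁ - ek (φ k)) -
        h (φ k) * |c - F₀ - ε₁ - ek (φ k)|) ≤ u (γk (φ k) s) := by
    have hVh : Tendsto (fun k => V * h (φ k)) atTop (𝓝 0) := by
      simpa using hhφ.const_mul V
    filter_upwards [(Metric.tendsto_nhds.1 (hpt s)) (r / 4) (by positivity),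
      hVh.eventually_lt_const (show 0 < r / 4 by positivity)] with k hk1 hk2
    obtain ⟨m, hm, hm1, hm2⟩ := floor_add_le (hh (φ k)) (show -s ≤ -(s - t) by linarith)
    have hm2 := hm2 (by linarith)
    have e0 : -(s - t) - -s = t := by ring
    rw [e0] at hm1 hm2
    rw [abs_of_pos ht0] at hm1
    set i := ⌊(-s) / h (φ k)⌋₊ with hi
    have hstep := fun i => ((hx (φ k)) i).2.2 p
    have hg : ∀ l, l < m → c - F₀ - ε₁ - ek (φ k) ≤ c - ek (φ k) -
        G (x (φ k) (i + l)) p (lam * u (x (φ k) (i + l))) := by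
      intro l hl
      have h1 := norm_sub_le_of_steps (fun i => ((hx (φ k)) i).2.1) i l
      have h2 : V * h (φ k) * l ≤ V * t + V * h (φ k) := by
        have : (l : ℝ) ≤ m := by exact_mod_cast hl.le
        calc V * h (φ k) * l ≤ V * h (φ k) * m := by
              have := hh (φ k)
              gcongr
          _ = V * (h (φ k) * m) := by ring
          _ ≤ V * (t + h (φ k)) := by gcongr
          _ = _ := by ring
      have h3 : dist (x (φ k) (i + l)) (γ s) < r := by
        have h4 : dist (x (φ k) i) (γ s) < r / 4 := hk1
        have h5 := dist_triangle (x (φ k) (i + l)) (x (φ k) i) (γ s)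
        rw [dist_eq_norm (x (φ k) (i + l)) (x (φ k) i)] at h5
        linarith
      have h6 := hrF _ h3
      rw [Real.dist_eq, abs_lt] at h6
      linarith [h6.2]
    have htel := telescope_step (hh (φ k)).le hstep i m hg
    have hγ1 : γk (φ k) (s - t) = x (φ k) (i + m) := by simp only [hγk, hm]
    have hγ2 : γk (φ k) s = x (φ k) i := rfl
    rw [hγ1, hγ2]
    set b := c - F₀ - ε₁ - ek (φ k)
    -- The elapsed grid time differs from `t` by at most one step, and the sign of `b` decides which
    -- side is used.
    have hbb : t * b - h (φ k) * |b| ≤ h (φ k) * m * b := by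
      rcases le_or_gt 0 b with hb | hb
      · rw [abs_of_nonneg hb]
        have := mul_le_mul_of_nonneg_right hm2 hb
        linarith
      · rw [abs_of_neg hb]
        have := mul_le_mul_of_nonpos_right hm1 hb.le
        linarith
    linarith
  have hlimL : Tendsto (fun k => u (γk (φ k) (s - t)) +
      inner ℝ p (γk (φ k) s - γk (φ k) (s - t)) + (t * (c - F₀ - ε₁ - ek (φ k)) -
        h (φ k) * |c - F₀ - ε₁ - ek (φ k)|)) atTop (𝓝 (u (γ (s - t)) +
      inner ℝ p (γ s - γ (s - t)) + (t * (c - F₀ - ε₁ - 0) - 0 * |c - F₀ - ε₁ - 0|))) := by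
    refine Tendsto.add (((huc.tendsto _).comp (hpt (s - t))).add ?_)
      ((hB.const_mul t).sub (hhφ.mul hB.abs))
    exact Filter.Tendsto.inner tendsto_const_nhds ((hpt s).sub (hpt (s - t)))
  have := le_of_tendsto_of_tendsto hlimL ((huc.tendsto _).comp (hpt s)) key
  simp only [zero_mul, sub_zero] at this
  linarith

/-- Lower bounds for difference quotients along a curve give lower bounds for the derivative. -/
theorem IsTonelli.le_deriv_comp {G : Hamiltonian n} (hG : IsTonelli G) {c lam : ℝ}
    {u : Space n → ℝ} {γ : ℝ → Space n} {s d : ℝ} {q : Space n} (hγ : HasDerivAt γ q s)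
    (hd : HasDerivAt (fun s => u (γ s)) d s)
    (h : ∀ p, ∀ ε₁ > 0, ∀ᶠ t in 𝓝[>] (0 : ℝ), inner ℝ p (γ s - γ (s - t)) +
        t * (c - G (γ s) p (lam * u (γ s)) - ε₁) ≤ u (γ s) - u (γ (s - t))) :
    lagrangian G (γ s) q (lam * u (γ s)) + c ≤ d := by
  have hlim := (hasDerivAt_iff_tendsto_slope.1 hd).comp (tendsto_sub_nhdsGT s)
  have hlimγ := (hasDerivAt_iff_tendsto_slope.1 hγ).comp (tendsto_sub_nhdsGT s)
  -- The momentum that attains the Lagrangian at the actual velocity makes the family of bounds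
  -- sharp.
  obtain ⟨p, hp⟩ := hG.exists_maximizer (γ s) q (lam * u (γ s))
  rw [hp.lagrangian_eq]
  refine le_of_forall_pos_le_add fun ε₁ hε₁ => ?_
  have hlim2 : Tendsto (fun t => inner ℝ p (slope γ s (s - t)) +
      (c - G (γ s) p (lam * u (γ s)) - ε₁)) (𝓝[>] 0)
      (𝓝 (inner ℝ p q + (c - G (γ s) p (lam * u (γ s)) - ε₁))) :=
    (Filter.Tendsto.inner tendsto_const_nhds hlimγ).add tendsto_const_nhds
  have := le_of_tendsto_of_tendsto hlim2 hlim (by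
    filter_upwards [h p ε₁ hε₁, self_mem_nhdsWithin] with t h1 ht
    have ht : 0 < t := ht
    simp only [Function.comp_apply, slope_def_field, slope_def_module]
    rw [sub_sub_cancel_left, inner_smul_right, ← neg_sub (γ s) (γ (s - t)), inner_neg_right,
      inv_neg, neg_mul_neg, div_neg, ← neg_div, neg_sub, le_div_iff₀ ht, add_mul,
      mul_comm t⁻¹, inv_mul_cancel_right₀ ht.ne']
    linarith)
  linarith

theorem IsTonelli.measurable_lagrangian_curve {G : Hamiltonian n} (hG : IsTonelli G)
    {γ : ℝ → Space n} (hγ : Measurable γ) {w : ℝ → ℝ} (hw : Measurable w) :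
    Measurable fun s => lagrangian G (γ s) (deriv γ s) (w s) :=
  Measurable.comp (g := fun z : Space n × Space n × ℝ => lagrangian G z.1 z.2.1 z.2.2)
    (f := fun s => (γ s, deriv γ s, w s)) hG.continuous_lagrangian.measurable
    (hγ.prodMk ((measurable_deriv γ).prodMk hw))

theorem IsTonelli.intervalIntegrable_lagrangian {G : Hamiltonian n} (hG : IsTonelli G)
    {γ : ℝ → Space n} {V : ℝ} (hγ : Continuous γ) (hV : ∀ s, ‖deriv γ s‖ ≤ V) {w : ℝ → ℝ}
    (hw : Continuous w) (a b : ℝ) :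
    IntervalIntegrable (fun s => lagrangian G (γ s) (deriv γ s) (w s)) volume a b := by
  obtain ⟨B₁, hB₁⟩ := (isCompact_uIcc (a := a) (b := b)).exists_bound_of_continuousOn
    hγ.continuousOn
  obtain ⟨B₂, hB₂⟩ := (isCompact_uIcc (a := a) (b := b)).exists_bound_of_continuousOn
    hw.continuousOn
  obtain ⟨B, hB⟩ := ((isCompact_closedBall (0 : Space n) B₁).prod
    ((isCompact_closedBall (0 : Space n) V).prod
      (isCompact_closedBall (0 : ℝ) B₂))).exists_bound_of_continuousOn
    hG.continuous_lagrangian.continuousOn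
  refine (intervalIntegrable_const (c := B)).mono_fun
    (hG.measurable_lagrangian_curve hγ.measurable hw.measurable).aestronglyMeasurable ?_
  filter_upwards [ae_restrict_mem measurableSet_uIoc] with s hs
  have hs' := uIoc_subset_uIcc hs
  exact (hB (γ s, deriv γ s, w s) ⟨by simpa using hB₁ s hs', by simpa using hV s,
    by simpa using hB₂ s hs'⟩).trans (le_abs_self B)

/-- Existence of infinite minimizers. -/
theorem Confinement.exists_infiniteMinimizer {G : Hamiltonian n} {c lam : ℝ} {u : Space n → ℝ}
    {ε δ R₀ R₁ m N R : ℝ} (hC : Confinement G c lam u ε δ R₀ R₁ m N R) (hG : IsTonelli G)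
    (hu : IsSolution G c lam u) (hlip : LocallyLip u) {z : Space n} (hz : ‖z‖ ≤ R₁) :
    ∃ γ, IsInfiniteMinimizer (lagrangian G) c lam u z γ := by
  obtain ⟨γ, V, hV, hγV, hγ0, hγ⟩ := hC.exists_curve hG hu.2 hlip hz
  have huc := hu.1.1
  have hγL : LipschitzWith V.toNNReal γ := LipschitzWith.of_dist_le_mul fun s t => by
    rw [Real.coe_toNNReal V hV.le]
    simpa [dist_eq_norm] using hγV s t
  have hγc := hγL.continuous
  have hder : ∀ s, ‖deriv γ s‖ ≤ V := fun s => by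
    simpa [Real.coe_toNNReal V hV.le] using norm_deriv_le_of_lipschitz hγL (x₀ := s)
  refine ⟨γ, fun t ht => ?_⟩
  have hac : AbsolutelyContinuousOnInterval γ (-t) 0 :=
    (hγL.lipschitzOnWith).absolutelyContinuousOnInterval
  have hint : IntervalIntegrable (fun s => lagrangian G (γ s) (deriv γ s) (lam * u (γ s)))
      volume (-t) 0 :=
    hG.intervalIntegrable_lagrangian hγc hder (w := fun s => lam * u (γ s)) (by fun_prop) _ _
  have hadm : IsAdmissible (lagrangian G) lam u z t γ := ⟨hac, hγ0, hint⟩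
  refine ⟨hadm, le_antisymm (hG.le_action hu.1 hlip ht hadm) ?_,
    fun η hη => hG.le_action hu.1 hlip ht hη⟩
  have hf := hlip.comp_absolutelyContinuous hac
  have hle : ∫ s in (-t)..0, (lagrangian G (γ s) (deriv γ s) (lam * u (γ s)) + c) ≤
      ∫ s in (-t)..0, deriv (fun s => u (γ s)) s := by
    refine intervalIntegral.integral_mono_ae_restrict (by linarith)
      (hint.add intervalIntegrable_const) hf.intervalIntegrable_deriv ?_
    filter_upwards [ae_restrict_mem measurableSet_Icc,
      ae_restrict_of_ae (hG.ae_deriv_le hu.1 hlip hac)] with s hs hs'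
    obtain ⟨hd1, hd2, -⟩ := hs' (by rwa [uIcc_of_le (by linarith)])
    exact hG.le_deriv_comp hd1 hd2 (hγ s hs.2)
  rw [hf.integral_deriv_eq_sub, hγ0] at hle
  unfold action
  linarith

/-! ### Bounds for infinite minimizers -/

theorem IsInfiniteMinimizer.absolutelyContinuous {L : Space n → Space n → ℝ → ℝ} {c lam : ℝ}
    {u : Space n → ℝ} {z : Space n} {γ : ℝ → Space n} (h : IsInfiniteMinimizer L c lam u z γ)
    {a b : ℝ} (ha : a ≤ 0) (hb : b ≤ 0) : AbsolutelyContinuousOnInterval γ a b := by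
  refine (h (1 - min a b) (by linarith [min_le_left a b])).1.1.mono ?_
  have h1 := min_le_left a b
  have h2 := min_le_right a b
  rw [uIcc_of_le (show -(1 - min a b) ≤ 0 by linarith)]
  refine uIcc_subset_Icc ⟨by linarith, ha⟩ ⟨by linarith, hb⟩

theorem IsInfiniteMinimizer.continuousOn {L : Space n → Space n → ℝ → ℝ} {c lam : ℝ}
    {u : Space n → ℝ} {z : Space n} {γ : ℝ → Space n} (h : IsInfiniteMinimizer L c lam u z γ) :
    ContinuousOn γ (Iic 0) := by
  intro s hs
  have hs : s ≤ 0 := hs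
  have h1 := (h.absolutelyContinuous (a := s - 1) (b := 0) (by linarith) le_rfl).continuousOn
  rw [uIcc_of_le (by linarith)] at h1
  refine (h1 s ⟨by linarith, hs⟩).mono_of_mem_nhdsWithin ?_
  rw [mem_nhdsWithin]
  exact ⟨Ioi (s - 1), isOpen_Ioi, by simp, fun t ht => ⟨ht.1.le, ht.2⟩⟩

theorem IsInfiniteMinimizer.apply_zero {L : Space n → Space n → ℝ → ℝ} {c lam : ℝ}
    {u : Space n → ℝ} {z : Space n} {γ : ℝ → Space n} (h : IsInfiniteMinimizer L c lam u z γ) :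
    γ 0 = z :=
  (h 1 one_pos).1.2.1

/-- Infinite minimizers are calibrated. -/
theorem IsTonelli.ae_deriv_eq {G : Hamiltonian n} (hG : IsTonelli G) {c lam : ℝ}
    {u : Space n → ℝ} (hu : IsSubsolution G c lam u) (hlip : LocallyLip u) {z : Space n}
    {γ : ℝ → Space n} (hγ : IsInfiniteMinimizer (lagrangian G) c lam u z γ) :
    ∀ᵐ s, s ≤ 0 → HasDerivAt γ (deriv γ s) s ∧
      HasDerivAt (fun s => u (γ s)) (lagrangian G (γ s) (deriv γ s) (lam * u (γ s)) + c) s := by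
  have key : ∀ k : ℕ, ∀ᵐ s, s ∈ Ioc (-((k : ℝ) + 1)) 0 → HasDerivAt γ (deriv γ s) s ∧
      HasDerivAt (fun s => u (γ s)) (lagrangian G (γ s) (deriv γ s) (lam * u (γ s)) + c) s := by
    intro k
    have hk : (0 : ℝ) < (k : ℝ) + 1 := by positivity
    obtain ⟨⟨hac, h0, hint⟩, hval, -⟩ := hγ ((k : ℝ) + 1) hk
    have hf := hlip.comp_absolutelyContinuous hac
    have hle := hG.ae_deriv_le hu hlip hac
    have hk' : -((k : ℝ) + 1) ≤ 0 := by linarith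
    rw [uIcc_of_le hk'] at hle
    have hi1 := hf.intervalIntegrable_deriv
    have hi2 := hint.add (intervalIntegrable_const (c := c))
    have heq : ∫ s in Ioc (-((k : ℝ) + 1)) 0, deriv (fun s => u (γ s)) s =
        ∫ s in Ioc (-((k : ℝ) + 1)) 0,
          (lagrangian G (γ s) (deriv γ s) (lam * u (γ s)) + c) := by
      rw [← intervalIntegral.integral_of_le hk', ← intervalIntegral.integral_of_le hk',
        hf.integral_deriv_eq_sub, h0]
      unfold action at hval
      linarith
    -- Minimality equates the integrals of two functions ordered almost everywhere, so these agree
    -- almost everywhere.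
    rw [integral_eq_iff_of_ae_le hi1.1 hi2.1 (by
      filter_upwards [ae_restrict_of_ae hle, ae_restrict_mem measurableSet_Ioc] with s hs hs'
      exact (hs (Ioc_subset_Icc_self hs')).2.2)] at heq
    filter_upwards [hle, (ae_restrict_iff' measurableSet_Ioc).1 heq] with s hs1 hs2 hs
    obtain ⟨e1, e2, -⟩ := hs1 (Ioc_subset_Icc_self hs)
    rw [hs2 hs] at e2
    exact ⟨e1, e2⟩
  filter_upwards [ae_all_iff.2 key] with s hs hs0
  obtain ⟨k, hk⟩ := exists_nat_gt (-s)
  exact hs k ⟨by linarith, hs0⟩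

/-- A substitute for the chain rule when `g` is only Lipschitz; the strict bound keeps nearby points
of the curve in the ball. -/
theorem abs_deriv_comp_le {g : Space n → ℝ} {R M : ℝ}
    (hg : ∀ x y, ‖x‖ ≤ R → ‖y‖ ≤ R → |g y - g x| ≤ M * ‖y - x‖) {γ : ℝ → Space n} {s d : ℝ}
    {q : Space n} (hγ : HasDerivAt γ q s) (hd : HasDerivAt (fun s => g (γ s)) d s)
    (hs : ‖γ s‖ < R) : |d| ≤ M * ‖q‖ := by
  have h1 := (hasDerivAt_iff_tendsto_slope.1 hd).abs
  have h2 := (hasDerivAt_iff_tendsto_slope.1 hγ).norm.const_mul M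
  refine le_of_tendsto_of_tendsto h1 h2 ?_
  have hev : ∀ᶠ t in 𝓝[≠] s, ‖γ t‖ < R :=
    (hγ.continuousAt.norm.eventually_lt_const hs).filter_mono nhdsWithin_le_nhds
  filter_upwards [hev] with t ht
  have := hg _ _ hs.le ht.le
  simp only [slope_def_module, norm_smul, smul_eq_mul, abs_mul, Real.norm_eq_abs]
  calc |(t - s)⁻¹| * |g (γ t) - g (γ s)| ≤ |(t - s)⁻¹| * (M * ‖γ t - γ s‖) := by gcongr
    _ = _ := by ring

/-- Infinite minimizers are confined. -/
theorem Confinement.norm_lt_of_isInfiniteMinimizer {G : Hamiltonian n} {c lam : ℝ}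
    {u : Space n → ℝ} {ε δ R₀ R₁ m N R : ℝ} (hC : Confinement G c lam u ε δ R₀ R₁ m N R)
    (hG : IsTonelli G) (hu : IsSubsolution G c lam u) (hlip : LocallyLip u) {z : Space n}
    (hz : ‖z‖ ≤ R₁) {γ : ℝ → Space n} (hγ : IsInfiniteMinimizer (lagrangian G) c lam u z γ)
    {s : ℝ} (hs : s ≤ 0) : ‖γ s‖ < R := by
  by_contra! hcon
  have hc : ContinuousOn (fun s => ‖γ s‖) (Iic 0) := hγ.continuousOn.norm
  have hclosed : ∀ (a : ℝ) (A : Set ℝ), IsClosed A →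
      IsCompact (Icc a 0 ∩ (fun s => ‖γ s‖) ⁻¹' A) := fun a A hA =>
    isCompact_Icc.of_isClosed_subset ((hc.mono Icc_subset_Iic_self).preimage_isClosed_of_isClosed
      isClosed_Icc hA) inter_subset_left
  -- `T` is the last time in `[s, 0]` at radius at least `R`, and `S` the first later time at radius
  -- at most `R₁`. Between them the curve crosses the annulus inward, and `u` rises by at least `ε`
  -- times the radial drop, more than its bounds allow.
  obtain ⟨T, ⟨⟨hTs, hT0⟩, hTR⟩, hTmax⟩ :=
    (hclosed s (Ici R) isClosed_Ici).exists_isGreatest ⟨s, ⟨le_rfl, hs⟩, hcon⟩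
  obtain ⟨S, ⟨⟨hTS, hS0⟩, hSR⟩, hSmin⟩ :=
    (hclosed T (Iic R₁) isClosed_Iic).exists_isLeast
      ⟨0, ⟨hT0, le_rfl⟩, by simpa [hγ.apply_zero] using hz⟩
  simp only [mem_preimage, mem_Ici, mem_Iic] at hTR hSR
  have hmid : ∀ t ∈ Ioo T S, R₁ < ‖γ t‖ ∧ ‖γ t‖ < R := by
    rintro t ⟨ht1, ht2⟩
    refine ⟨?_, ?_⟩ <;> by_contra! hle
    · exact absurd (hSmin ⟨⟨ht1.le, ht2.le.trans hS0⟩, hle⟩) (not_le.2 ht2)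
    · exact absurd (hTmax ⟨⟨hTs.trans ht1.le, ht2.le.trans hS0⟩, hle⟩) (not_le.2 ht1)
  have hac := hγ.absolutelyContinuous hT0 hS0
  have hr : AbsolutelyContinuousOnInterval (fun s => ‖γ s‖) T S :=
    hac.comp_lipschitz (g := fun x => ‖x‖) (K := 1) fun a _ b _ => by
      rw [one_mul, Real.dist_eq, dist_eq_norm]
      exact abs_norm_sub_norm_le _ _
  have hf := hlip.comp_absolutelyContinuous hac
  have hle : ∫ t in T..S, (-ε) * deriv (fun s => ‖γ s‖) t ≤
      ∫ t in T..S, deriv (fun s => u (γ s)) t := by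
    refine intervalIntegral.integral_mono_ae_restrict hTS (hr.intervalIntegrable_deriv.const_mul _)
      hf.intervalIntegrable_deriv ?_
    rw [← Measure.restrict_congr_set Ioo_ae_eq_Icc]
    filter_upwards [ae_restrict_mem measurableSet_Ioo,
      ae_restrict_of_ae (hG.ae_deriv_eq hu hlip hγ), ae_restrict_of_ae hr.ae_differentiableAt]
      with t ht ht1 ht2
    obtain ⟨hd1, hd2⟩ := ht1 (ht.2.le.trans hS0)
    obtain ⟨hm1, hm2⟩ := hmid t ht
    have hd3 := (ht2 (by rw [uIcc_of_le hTS]; exact Ioo_subset_Icc_self ht)).hasDerivAt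
    have h1 := abs_deriv_comp_le (g := fun x => ‖x‖) (R := R) (M := 1)
      (fun x y _ _ => by rw [one_mul]; exact abs_norm_sub_norm_le _ _) hd1 hd3 hm2
    have h2 := hC.le_lagrangian hG (v := deriv γ t)
      (show R₀ ≤ ‖γ t‖ by linarith [hC.radius_le]) hm2.le
    rw [hd2.deriv]
    have h3 : (-ε) * deriv (fun s => ‖γ s‖) t ≤ ε * ‖deriv γ t‖ := by
      have := mul_le_mul_of_nonneg_left ((neg_le_abs _).trans h1) hC.eps_pos.le
      linarith
    linarith [hC.delta_pos]
  rw [intervalIntegral.integral_const_mul, hr.integral_deriv_eq_sub,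
    hf.integral_deriv_eq_sub] at hle
  have h1 := hC.upper _ hSR
  have h2 := hC.lower (γ T)
  have h3 := hC.radius_lt
  have h4 : (m + N) / ε < ‖γ T‖ - ‖γ S‖ := by linarith
  rw [div_lt_iff₀ hC.eps_pos] at h4
  linarith

/-- A momentum of norm `|M| + 1` along `v` shows that the Lagrangian grows faster than `M ‖v‖`. -/
theorem IsTonelli.exists_speed_bound {G : Hamiltonian n} (hG : IsTonelli G) (R M B c : ℝ) :
    ∃ V, 0 < V ∧ ∀ x v u, ‖x‖ ≤ R → |u| ≤ B → lagrangian G x v u + c ≤ M * ‖v‖ → ‖v‖ ≤ V := by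
  obtain ⟨A, hA⟩ := ((isCompact_closedBall (0 : Space n) R).prod
    ((isCompact_closedBall (0 : Space n) (|M| + 1)).prod
    (isCompact_closedBall (0 : ℝ) B))).exists_bound_of_continuousOn hG.h1.continuous.continuousOn
  refine ⟨|A| + |c| + 1, by positivity, fun x v u hx hu h => ?_⟩
  rcases eq_or_ne v 0 with rfl | hv
  · rw [norm_zero]
    positivity
  have hv0 : 0 < ‖v‖ := norm_pos_iff.2 hv
  set p : Space n := ((|M| + 1) / ‖v‖) • v with hp
  have hpn : ‖p‖ = |M| + 1 := by
    rw [hp, norm_smul, Real.norm_of_nonneg (by positivity), div_mul_cancel₀ _ hv0.ne']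
  have hpv : inner ℝ p v = (|M| + 1) * ‖v‖ := by
    rw [hp, real_inner_smul_left, real_inner_self_eq_norm_sq]
    field_simp
  have h1 := hG.inner_sub_le x v u p
  have h2 := hA (x, p, u) ⟨by simpa using hx, by simp [hpn], by simpa using hu⟩
  have h3 : G x p u ≤ |A| := (le_abs_self _).trans (h2.trans (le_abs_self _))
  have h4 : M * ‖v‖ ≤ |M| * ‖v‖ := by
    gcongr
    exact le_abs_self M
  have h5 := neg_abs_le c
  linarith

/-! ### Uniform estimates for the maximal solutions -/

/-- Maximality puts every `u lam` above the same bounded subsolution, to which the uniform bounds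
apply. -/
theorem exists_family_bounds {H : Hamiltonian n} (h1 : AssumptionH1 H) (h2 : AssumptionH2 H)
    (h3 : AssumptionH3 H) {u : ℝ → Space n → ℝ}
    (hu : ∀ lam, 0 < lam → IsMaximalSolution H lam (u lam)) :
    ∃ (M C : ℝ → ℝ) (N : ℝ), (∀ R, 0 ≤ M R) ∧ (∀ R, 0 ≤ C R) ∧ ∀ lam, 0 < lam → lam ≤ 1 →
      (∀ x, -N ≤ u lam x) ∧
      (∀ R x y, ‖x‖ ≤ R → ‖y‖ ≤ R → |u lam y - u lam x| ≤ M R * ‖y - x‖) ∧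
      ∀ R x, ‖x‖ ≤ R → |u lam x| ≤ C R := by
  obtain ⟨w, N, hN, hwN, hw⟩ := exists_bounded_subsolution h1 h2
  obtain ⟨M, C, hM0, hC0, hMC⟩ := exists_uniform_bounds h1 h2 h3 hN 1
  refine ⟨M, fun R => max (C R) N, N, hM0, fun R => (hC0 R).trans (le_max_left _ _),
    fun lam hlam hlam1 => ?_⟩
  have hge : ∀ x, -N ≤ u lam x := fun x =>
    (hwN x).1.trans ((hu lam hlam).ge_of_isSubsolution h1 h2 h3 hlam (hw lam hlam.le) x)
  obtain ⟨hL, hB⟩ := hMC lam (u lam) hlam hlam1 (hu lam hlam).1.1 hge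
  exact ⟨hge, hL, fun R x hx => abs_le.2
    ⟨(neg_le_neg (le_max_right _ _)).trans (hge x), (hB R x hx).trans (le_max_left _ _)⟩⟩

/-- Existence of infinite minimizers, and uniform bounds for all of them. -/
theorem exists_minimizer_bounds {H G : Hamiltonian n} (h1 : AssumptionH1 H) (h2 : AssumptionH2 H)
    (h3 : AssumptionH3 H) (hG : (G = H ∧ IsSuperlinear H) ∨ G = superlinearization H)
    {u : ℝ → Space n → ℝ} (hu : ∀ lam, 0 < lam → IsMaximalSolution H lam (u lam)) (z : Space n) :
    ∃ lam₀, 0 < lam₀ ∧ lam₀ ≤ 1 ∧ ∃ R V, 0 < R ∧ 0 < V ∧ ∀ lam, 0 < lam → lam ≤ lam₀ →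
      (∃ γ, IsInfiniteMinimizer (lagrangian G) (criticalValue H) lam (u lam) z γ) ∧
      ∀ γ, IsInfiniteMinimizer (lagrangian G) (criticalValue H) lam (u lam) z γ →
        (∀ s ≤ 0, ‖γ s‖ ≤ R) ∧ ∀ᵐ s, s ≤ 0 → ‖deriv γ s‖ ≤ V := by
  obtain ⟨hT, hGeq, hHG⟩ := tonelli_data h1 h3 hG
  obtain ⟨M, C, N, hM0, hC0, hfam⟩ := exists_family_bounds h1 h2 h3 hu
  obtain ⟨-, -, ε, hε, R₀, hR₀, a, ha, hlev⟩ := exists_level_lt_criticalValue h1 h2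
  obtain ⟨κ, -, κ', hκ', hinc⟩ := h3.le_sub hε
  set c := criticalValue H
  set R₁ := max (R₀ + 1) ‖z‖
  set m := C R₁
  set R := R₁ + |m + N| / ε + 1 with hR
  have hR₁ : 0 < R₁ := lt_of_lt_of_le (by linarith) (le_max_left _ _)
  have hRpos : 0 < R := by positivity
  -- Chosen after `R`: on the ball of radius `R` the discount term then raises the outer level `a`
  -- by at most half of its distance to the critical value.
  set lam₀ := min 1 ((c - a) / 2 / (κ' * (C R + 1))) with hlam₀
  have hCR := hC0 R
  have hca : 0 < (c - a) / 2 := by linarith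
  have hlam₀pos : 0 < lam₀ := lt_min one_pos (by positivity)
  obtain ⟨V, hV, hspeed⟩ := hT.exists_speed_bound R (M R) (C R) c
  refine ⟨lam₀, hlam₀pos, min_le_left _ _, R, V, hRpos, hV, fun lam hlam hlam' => ?_⟩
  have hlam1 : lam ≤ 1 := hlam'.trans (min_le_left _ _)
  obtain ⟨hge, hL, hB⟩ := hfam lam hlam hlam1
  have hsol : IsSolution G c lam (u lam) :=
    ⟨(hu lam hlam).1.1.congr hGeq, (hu lam hlam).1.2.congr hHG⟩
  have hlip : LocallyLip (u lam) := fun R => ⟨M R, hM0 R, hL R⟩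
  have hC : Confinement G c lam (u lam) ε ((c - a) / 2) R₀ R₁ m N R := by
    refine ⟨hε, hca, hR₀, le_max_left _ _, hge, fun x hx => (le_abs_self _).trans (hB _ x hx), ?_, ?_⟩
    · have : (m + N) / ε ≤ |m + N| / ε := by
        gcongr
        exact le_abs_self _
      linarith
    · intro x hx0 hxR p hp
      have e1 := hlev x hx0 p hp
      have e2 : lam * u lam x ≤ lam * C R := by
        gcongr
        exact (le_abs_self _).trans (hB R x hxR)
      have e3 := h1.monotone x p e2
      have e4 := (hinc x p hp 0 (lam * C R) (by positivity)).2
      have e5 : κ' * (lam * C R) ≤ (c - a) / 2 := by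
        have h5 : lam ≤ (c - a) / 2 / (κ' * (C R + 1)) := hlam'.trans (min_le_right _ _)
        rw [le_div_iff₀ (by positivity)] at h5
        have h6 : 0 ≤ lam * κ' := by positivity
        linarith
      have e6 : H x p (lam * u lam x) ≤ c - (c - a) / 2 := by linarith
      rw [hGeq x p _ (by linarith)]
      exact e6
  have hz : ‖z‖ ≤ R₁ := le_max_right _ _
  refine ⟨hC.exists_infiniteMinimizer hT hsol hlip hz, fun γ hγ => ?_⟩
  have hconf : ∀ s ≤ 0, ‖γ s‖ < R := fun s hs =>
    hC.norm_lt_of_isInfiniteMinimizer hT hsol.1 hlip hz hγ hs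
  refine ⟨fun s hs => (hconf s hs).le, ?_⟩
  filter_upwards [hT.ae_deriv_eq hsol.1 hlip hγ] with s hs hs0
  obtain ⟨hd1, hd2⟩ := hs hs0
  have e1 := abs_deriv_comp_le (hL R) hd1 hd2 (hconf s hs0)
  -- By calibration, `L + c` is the derivative of `u` along the curve, which the Lipschitz constant
  -- bounds by `M R` times the speed.
  refine hspeed (γ s) (deriv γ s) (lam * u lam (γ s)) (hconf s hs0).le ?_ ((le_abs_self _).trans e1)
  rw [abs_mul, abs_of_pos hlam]
  exact (mul_le_of_le_one_left (abs_nonneg _) hlam1).trans (hB R _ (hconf s hs0).le)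

/-! ### Exponential weights -/

section Weight

variable {K : ℝ → ℝ} {lam k₁ k₂ : ℝ}

theorem intervalIntegrable_of_bounds (hK : AEStronglyMeasurable K (volume.restrict (Iic 0)))
    (hb : ∀ᵐ s, s ≤ 0 → K s ∈ Icc (-k₂) (-k₁)) {a b : ℝ} (ha : a ≤ 0) (hb0 : b ≤ 0) :
    IntervalIntegrable K volume a b := by
  have hsub : uIoc a b ⊆ Iic 0 := fun s hs => hs.2.trans (max_le ha hb0)
  refine (intervalIntegrable_const (c := max |k₁| |k₂|)).mono_fun
    (hK.mono_measure (Measure.restrict_mono hsub le_rfl)) ?_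
  filter_upwards [ae_restrict_mem measurableSet_uIoc, ae_restrict_of_ae hb] with s hs hs'
  obtain ⟨e1, e2⟩ := hs' (hsub hs)
  rw [Real.norm_eq_abs, Real.norm_eq_abs, abs_of_nonneg (le_max_of_le_left (abs_nonneg k₁)), abs_le]
  have := le_abs_self k₂
  have := neg_abs_le k₁
  have := le_max_left |k₁| |k₂|
  have := le_max_right |k₁| |k₂|
  constructor <;> linarith

theorem weight_integral_mem (hK : AEStronglyMeasurable K (volume.restrict (Iic 0)))
    (hb : ∀ᵐ s, s ≤ 0 → K s ∈ Icc (-k₂) (-k₁)) {s : ℝ} (hs : s ≤ 0) :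
    ∫ τ in s..0, K τ ∈ Icc (k₂ * s) (k₁ * s) := by
  have hint := intervalIntegrable_of_bounds hK hb hs le_rfl
  constructor
  · have := intervalIntegral.integral_mono_ae_restrict hs (intervalIntegrable_const (c := -k₂)) hint
      (by filter_upwards [ae_restrict_mem measurableSet_Icc, ae_restrict_of_ae hb] with t ht ht'
          exact (ht' ht.2).1)
    simp at this
    linarith
  · have := intervalIntegral.integral_mono_ae_restrict hs hint (intervalIntegrable_const (c := -k₁))
      (by filter_upwards [ae_restrict_mem measurableSet_Icc, ae_restrict_of_ae hb] with t ht ht'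
          exact (ht' ht.2).2)
    simp at this
    linarith

theorem absolutelyContinuous_weight (hK : AEStronglyMeasurable K (volume.restrict (Iic 0)))
    (hb : ∀ᵐ s, s ≤ 0 → K s ∈ Icc (-k₂) (-k₁)) {a : ℝ} (ha : a ≤ 0) :
    AbsolutelyContinuousOnInterval (fun s => Real.exp (lam * ∫ τ in s..0, K τ)) a 0 := by
  have hint := intervalIntegrable_of_bounds hK hb ha le_rfl
  have h1 := hint.absolutelyContinuousOnInterval_intervalIntegral (c := 0) right_mem_uIcc
  obtain ⟨B, hB⟩ := isCompact_uIcc.exists_bound_of_continuousOn h1.continuousOn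
  have hexp : ContDiff ℝ 1 fun y : ℝ => Real.exp (-(lam * y)) := by fun_prop
  obtain ⟨A, hA⟩ := hexp.contDiffOn.exists_lipschitzOnWith (n := 1) (by norm_num)
    (convex_closedBall (0 : ℝ) B) (isCompact_closedBall (0 : ℝ) B)
  have := h1.comp_lipschitz (g := fun y : ℝ => Real.exp (-(lam * y))) (K := A) fun s hs t ht =>
    hA.dist_le_mul _ (by simpa using hB s hs) _ (by simpa using hB t ht)
  refine (congrArg (fun f => AbsolutelyContinuousOnInterval f a 0) ?_).mp this
  ext s
  rw [intervalIntegral.integral_symm s 0]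
  ring_nf

end Weight

section Weight

variable {K : ℝ → ℝ} {lam k₁ k₂ : ℝ}

/-- Since `K` is negative and bounded away from zero, the weight decays exponentially as `s → -∞`.
-/
theorem weight_mem (hK : AEStronglyMeasurable K (volume.restrict (Iic 0)))
    (hb : ∀ᵐ s, s ≤ 0 → K s ∈ Icc (-k₂) (-k₁)) (hlam : 0 < lam) {s : ℝ} (hs : s ≤ 0) :
    Real.exp (lam * ∫ τ in s..0, K τ) ∈
      Icc (Real.exp (lam * k₂ * s)) (Real.exp (lam * k₁ * s)) := by
  obtain ⟨h1, h2⟩ := weight_integral_mem hK hb hs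
  constructor <;> rw [mul_assoc] <;> gcongr

theorem continuousOn_weight (hK : AEStronglyMeasurable K (volume.restrict (Iic 0)))
    (hb : ∀ᵐ s, s ≤ 0 → K s ∈ Icc (-k₂) (-k₁)) :
    ContinuousOn (fun s => Real.exp (lam * ∫ τ in s..0, K τ)) (Iic 0) := by
  intro s hs
  have hs : s ≤ 0 := hs
  have h1 := (absolutelyContinuous_weight (lam := lam) hK hb
    (show s - 1 ≤ 0 by linarith)).continuousOn
  rw [uIcc_of_le (by linarith)] at h1
  refine (h1 s ⟨by linarith, hs⟩).mono_of_mem_nhdsWithin ?_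
  rw [mem_nhdsWithin]
  exact ⟨Ioi (s - 1), isOpen_Ioi, by simp, fun t ht => ⟨ht.1.le, ht.2⟩⟩

theorem integrableOn_weight (hK : AEStronglyMeasurable K (volume.restrict (Iic 0)))
    (hb : ∀ᵐ s, s ≤ 0 → K s ∈ Icc (-k₂) (-k₁)) (hlam : 0 < lam) (hk₁ : 0 < k₁) :
    IntegrableOn (fun s => Real.exp (lam * ∫ τ in s..0, K τ)) (Iic 0) := by
  refine (integrableOn_exp_mul_Iic (mul_pos hlam hk₁) 0).mono'
    ((continuousOn_weight hK hb).aestronglyMeasurable measurableSet_Iic) ?_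
  filter_upwards [ae_restrict_mem measurableSet_Iic] with s hs
  rw [Real.norm_of_nonneg (Real.exp_pos _).le]
  exact (weight_mem hK hb hlam hs).2

theorem integral_weight_mem (hK : AEStronglyMeasurable K (volume.restrict (Iic 0)))
    (hb : ∀ᵐ s, s ≤ 0 → K s ∈ Icc (-k₂) (-k₁)) (hlam : 0 < lam) (hk₁ : 0 < k₁) (hk₂ : 0 < k₂) :
    ∫ s in Iic (0 : ℝ), Real.exp (lam * ∫ τ in s..0, K τ) ∈
      Icc (1 / (lam * k₂)) (1 / (lam * k₁)) := by
  have h1 := integral_exp_mul_Iic (mul_pos hlam hk₁) 0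
  have h2 := integral_exp_mul_Iic (mul_pos hlam hk₂) 0
  simp only [mul_zero, Real.exp_zero] at h1 h2
  rw [← h1, ← h2]
  constructor
  · exact setIntegral_mono_on (integrableOn_exp_mul_Iic (mul_pos hlam hk₂) 0)
      (integrableOn_weight hK hb hlam hk₁) measurableSet_Iic
      fun s hs => (weight_mem hK hb hlam hs).1
  · exact setIntegral_mono_on (integrableOn_weight hK hb hlam hk₁)
      (integrableOn_exp_mul_Iic (mul_pos hlam hk₁) 0) measurableSet_Iic
      fun s hs => (weight_mem hK hb hlam hs).2

theorem integrableOn_weight_mul (hK : AEStronglyMeasurable K (volume.restrict (Iic 0)))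
    (hb : ∀ᵐ s, s ≤ 0 → K s ∈ Icc (-k₂) (-k₁)) (hlam : 0 < lam) (hk₁ : 0 < k₁) {g : ℝ → ℝ} {B : ℝ}
    (hg : AEStronglyMeasurable g (volume.restrict (Iic 0))) (hgB : ∀ᵐ s, s ≤ 0 → |g s| ≤ B) :
    IntegrableOn (fun s => Real.exp (lam * ∫ τ in s..0, K τ) * g s) (Iic 0) := by
  refine (integrableOn_weight hK hb hlam hk₁).mul_bdd (c := B) hg ?_
  filter_upwards [ae_restrict_mem measurableSet_Iic, ae_restrict_of_ae hgB] with s hs hs'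
  exact hs' hs

/-- Integration by parts against an exponential weight on the half line. -/
theorem integral_weight_mul_deriv (hK : AEStronglyMeasurable K (volume.restrict (Iic 0)))
    (hb : ∀ᵐ s, s ≤ 0 → K s ∈ Icc (-k₂) (-k₁)) (hlam : 0 < lam) (hk₁ : 0 < k₁) {g : ℝ → ℝ}
    {B B' : ℝ} (hg : ∀ a ≤ 0, AbsolutelyContinuousOnInterval g a 0)
    (hgm : AEStronglyMeasurable g (volume.restrict (Iic 0)))
    (hgB : ∀ s ≤ 0, |g s| ≤ B) (hgB' : ∀ᵐ s, s ≤ 0 → |deriv g s| ≤ B') :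
    g 0 + lam * ∫ s in Iic (0 : ℝ), Real.exp (lam * ∫ τ in s..0, K τ) * (K s * g s) =
      ∫ s in Iic (0 : ℝ), Real.exp (lam * ∫ τ in s..0, K τ) * deriv g s := by
  set ρ : ℝ → ℝ := fun s => Real.exp (lam * ∫ τ in s..0, K τ) with hρ
  have hi1 : IntegrableOn (fun s => ρ s * (K s * g s)) (Iic 0) := by
    refine integrableOn_weight_mul hK hb hlam hk₁ (B := (|k₁| + |k₂|) * B) (hK.mul hgm) ?_
    filter_upwards [hb] with s hs hs0
    have hB0 := (abs_nonneg _).trans (hgB s hs0)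
    rw [abs_mul]
    have : |K s| ≤ |k₁| + |k₂| := by
      obtain ⟨e1, e2⟩ := hs hs0
      have := le_abs_self k₂
      have := neg_abs_le k₁
      rw [abs_le]
      constructor <;> linarith [abs_nonneg k₁, abs_nonneg k₂]
    exact mul_le_mul this (hgB s hs0) (abs_nonneg _) (by positivity)
  have hi2 : IntegrableOn (fun s => ρ s * deriv g s) (Iic 0) :=
    integrableOn_weight_mul hK hb hlam hk₁ (measurable_deriv g).aestronglyMeasurable hgB'
  have hρ0 : ρ 0 = 1 := by simp [hρ]
  -- Both factors are absolutely continuous on bounded intervals, and the derivative of the weight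
  -- is `-lam` times `K` times the weight.
  have hparts : ∀ a ≤ 0, (∫ s in a..0, (-lam * (ρ s * (K s * g s)) + ρ s * deriv g s)) =
      g 0 - ρ a * g a := by
    intro a ha
    have hac := absolutelyContinuous_weight (lam := lam) hK hb ha
    have := hac.integral_deriv_mul_eq_sub (hg a ha)
    rw [show Real.exp (lam * ∫ τ in (0 : ℝ)..0, K τ) = 1 by simp, one_mul] at this
    rw [← this]
    refine intervalIntegral.integral_congr_ae ?_
    have hint := intervalIntegrable_of_bounds hK hb ha le_rfl
    filter_upwards [hint.ae_hasDerivAt_integral] with s hs hs'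
    have hd := hs (uIoc_subset_uIcc hs') 0 right_mem_uIcc
    have hd2 : HasDerivAt ρ (-lam * (ρ s * K s)) s := by
      have h1 : HasDerivAt (fun s => lam * ∫ τ in s..0, K τ) (lam * -K s) s := by
        refine HasDerivAt.const_mul lam ?_
        refine hd.neg.congr_of_eventuallyEq (Eventually.of_forall fun t => ?_)
        exact intervalIntegral.integral_symm _ _
      convert h1.exp using 1
      ring
    rw [hd2.deriv]
    ring
  have hlim1 := intervalIntegral_tendsto_integral_Iic 0 ((hi1.const_mul (-lam)).add hi2) tendsto_id
  -- The boundary term at `-∞` vanishes, because `g` is bounded and the weight decays.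
  have hlim2 : Tendsto (fun a => g 0 - ρ a * g a) atBot (𝓝 (g 0 - 0)) := by
    refine tendsto_const_nhds.sub ?_
    have he : Tendsto (fun a : ℝ => Real.exp (lam * k₁ * a) * B) atBot (𝓝 (0 * B)) := by
      refine Tendsto.mul_const B (Real.tendsto_exp_atBot.comp ?_)
      exact tendsto_id.const_mul_atBot (mul_pos hlam hk₁)
    rw [zero_mul] at he
    refine squeeze_zero_norm' ?_ he
    filter_upwards [Iic_mem_atBot (0 : ℝ)] with a ha
    rw [norm_mul, Real.norm_of_nonneg (Real.exp_pos _).le]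
    exact mul_le_mul (weight_mem hK hb hlam ha).2 (hgB a ha) (norm_nonneg _) (Real.exp_pos _).le
  have heq := tendsto_nhds_unique hlim1 (hlim2.congr' (by
    filter_upwards [Iic_mem_atBot (0 : ℝ)] with a ha
    exact (hparts a ha).symm))
  simp only [Pi.add_apply] at heq
  rw [integral_add (hi1.const_mul (-lam)) hi2, integral_const_mul] at heq
  linarith

end Weight

/-! ### Measures with compact support -/

section Compact

variable {E : Type*} [TopologicalSpace E] {K : Set E}

/-- Lets convergence tested on compactly supported functions be used for all continuous ones, once
the measures live on `K`. -/
theorem exists_hasCompactSupport_eqOn [T2Space E] [LocallyCompactSpace E] (hK : IsCompact K)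
    {φ : E → ℝ} (hφ : Continuous φ) :
    ∃ ψ : E → ℝ, Continuous ψ ∧ HasCompactSupport ψ ∧ EqOn ψ φ K := by
  obtain ⟨χ, h1, -, hc, -⟩ := exists_continuous_one_zero_of_isCompact hK isClosed_empty
    (disjoint_empty K)
  exact ⟨fun q => χ q * φ q, by fun_prop, hc.mul_right, fun q hq => by simp [h1 hq]⟩

variable [MeasurableSpace E] [BorelSpace E]

theorem integrable_of_ae_mem {μ : Measure E} [IsFiniteMeasure μ] (hK : IsCompact K)
    (hμ : ∀ᵐ q ∂μ, q ∈ K) {φ : E → ℝ} (hφ : Continuous φ) : Integrable φ μ := by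
  obtain ⟨B, hB⟩ := hK.exists_bound_of_continuousOn hφ.continuousOn
  refine (integrable_const B).mono' hφ.measurable.aestronglyMeasurable ?_
  filter_upwards [hμ] with q hq using hB q hq

variable [T2Space E] [LocallyCompactSpace E]

/-- By regularity, the measure of a compact set is the infimum of integrals of cutoff functions
equal to `1` on it. -/
theorem ae_mem_of_one_le_integral {μ : Measure E} [IsProbabilityMeasure μ] [μ.Regular]
    (hK : IsCompact K) (h : ∀ f : E → ℝ, Continuous f → HasCompactSupport f → EqOn f 1 K →
      1 ≤ ∫ q, f q ∂μ) : ∀ᵐ q ∂μ, q ∈ K := by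
  have h1 : 1 ≤ μ K := by
    rw [hK.measure_eq_biInf_integral_hasCompactSupport]
    refine le_iInf fun f => le_iInf fun hf => le_iInf fun hfc => le_iInf fun hfK =>
      le_iInf fun _ => ?_
    rw [← ENNReal.ofReal_one]
    exact ENNReal.ofReal_le_ofReal (h f hf hfc hfK)
  have h2 : μ K = 1 := le_antisymm prob_le_one h1
  exact (prob_compl_eq_zero_iff hK.measurableSet).2 h2

/-- Weak convergence of measures with support in a fixed compact set, tested on a uniformly
convergent sequence of functions. -/
theorem tendsto_integral_of_ae_mem {ν : ℕ → Measure E} {μ : Measure E} [IsProbabilityMeasure μ]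
    (hK : IsCompact K) (hν1 : ∀ j, IsProbabilityMeasure (ν j)) (hν : ∀ᶠ j in atTop, ∀ᵐ q ∂ν j, q ∈ K)
    (hμ : ∀ᵐ q ∂μ, q ∈ K) (hlim : ∀ φ : E → ℝ, Continuous φ → HasCompactSupport φ →
      Tendsto (fun j => ∫ q, φ q ∂(ν j)) atTop (𝓝 (∫ q, φ q ∂μ)))
    {f : ℕ → E → ℝ} {g : E → ℝ} (hf : ∀ᶠ j in atTop, Continuous (f j)) (hg : Continuous g)
    (hfg : TendstoUniformlyOn f g atTop K) :
    Tendsto (fun j => ∫ q, f j q ∂(ν j)) atTop (𝓝 (∫ q, g q ∂μ)) := by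
  obtain ⟨ψ, hψ, hψc, hψg⟩ := exists_hasCompactSupport_eqOn hK hg
  have h1 := hlim ψ hψ hψc
  have h2 : ∫ q, ψ q ∂μ = ∫ q, g q ∂μ :=
    integral_congr_ae (by filter_upwards [hμ] with q hq using hψg hq)
  rw [h2] at h1
  have h3 : Tendsto (fun j => ∫ q, f j q ∂(ν j) - ∫ q, ψ q ∂(ν j)) atTop (𝓝 0) := by
    rw [Metric.tendsto_nhds]
    intro ε hε
    filter_upwards [hf, hν, Metric.tendstoUniformlyOn_iff.1 hfg (ε / 2) (by positivity)]
      with j hj1 hj2 hj3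
    have := hν1 j
    rw [dist_zero_right, ← integral_sub (integrable_of_ae_mem hK hj2 hj1)
      (integrable_of_ae_mem hK hj2 hψ)]
    refine lt_of_le_of_lt (norm_integral_le_of_norm_le_const (C := ε / 2) ?_) ?_
    · filter_upwards [hj2] with q hq
      rw [hψg hq, ← dist_eq_norm, dist_comm]
      exact (hj3 q hq).le
    · simp
      linarith
  simpa using h3.add h1

end Compact

/-! ### Discounted measures of bounded curves -/

/-- Curves on `(-∞, 0]` with bounded position and velocity. -/
structure IsBoundedCurve (γ : ℝ → Space n) (z : Space n) (R V : ℝ) : Prop where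
  absolutelyContinuous : ∀ a ≤ 0, AbsolutelyContinuousOnInterval γ a 0
  continuousOn : ContinuousOn γ (Iic 0)
  apply_zero : γ 0 = z
  norm_le : ∀ s ≤ 0, ‖γ s‖ ≤ R
  ae_deriv : ∀ᵐ s, s ≤ 0 → HasDerivAt γ (deriv γ s) s ∧ ‖deriv γ s‖ ≤ V

namespace IsBoundedCurve

variable {γ : ℝ → Space n} {z : Space n} {R V : ℝ} (hγ : IsBoundedCurve γ z R V)

include hγ

theorem aemeasurable : AEMeasurable (fun s => (γ s, deriv γ s)) (volume.restrict (Iic 0)) :=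
  (hγ.continuousOn.aemeasurable measurableSet_Iic).prodMk (measurable_deriv γ).aemeasurable

theorem aestronglyMeasurable_comp {φ : Space n × Space n → ℝ} (hφ : Continuous φ) :
    AEStronglyMeasurable (fun s => φ (γ s, deriv γ s)) (volume.restrict (Iic 0)) :=
  (hφ.measurable.comp_aemeasurable hγ.aemeasurable).aestronglyMeasurable

theorem ae_mem : ∀ᵐ s, s ≤ 0 →
    (γ s, deriv γ s) ∈ Metric.closedBall (0 : Space n) R ×ˢ Metric.closedBall (0 : Space n) V := by
  filter_upwards [hγ.ae_deriv] with s hs hs0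
  exact ⟨by simpa using hγ.norm_le s hs0, by simpa using (hs hs0).2⟩

theorem exists_ae_bound {φ : Space n × Space n → ℝ} (hφ : Continuous φ) :
    ∃ B, ∀ᵐ s, s ≤ 0 → |φ (γ s, deriv γ s)| ≤ B := by
  obtain ⟨B, hB⟩ := ((isCompact_closedBall (0 : Space n) R).prod
    (isCompact_closedBall (0 : Space n) V)).exists_bound_of_continuousOn hφ.continuousOn
  refine ⟨B, ?_⟩
  filter_upwards [hγ.ae_mem] with s hs hs0 using hB _ (hs hs0)

end IsBoundedCurve

/-- Bounds for the rate `Q` of the exponential weight along a bounded curve. -/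
structure IsDiscount (Q : Space n × Space n → ℝ) (lam k₁ k₂ R V : ℝ) : Prop where
  continuous : Continuous Q
  lam_pos : 0 < lam
  lower_pos : 0 < k₁
  upper_pos : 0 < k₂
  mem : ∀ q ∈ Metric.closedBall (0 : Space n) R ×ˢ Metric.closedBall (0 : Space n) V,
    Q q ∈ Icc (-k₂) (-k₁)

/-- The exponential weight with rate `Q` along a curve. -/
noncomputable def discountWeight (Q : Space n × Space n → ℝ) (lam : ℝ) (γ : ℝ → Space n) (s : ℝ) :
    ℝ :=
  Real.exp (lam * ∫ τ in s..0, Q (γ τ, deriv γ τ))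

namespace IsDiscount

variable {Q : Space n × Space n → ℝ} {lam k₁ k₂ R V : ℝ} (hQ : IsDiscount Q lam k₁ k₂ R V)
  {γ : ℝ → Space n} {z : Space n} (hγ : IsBoundedCurve γ z R V)

include hQ hγ

theorem ae_mem : ∀ᵐ s, s ≤ 0 → Q (γ s, deriv γ s) ∈ Icc (-k₂) (-k₁) := by
  filter_upwards [hγ.ae_mem] with s hs hs0 using hQ.mem _ (hs hs0)

theorem integrableOn : IntegrableOn (discountWeight Q lam γ) (Iic 0) :=
  integrableOn_weight (hγ.aestronglyMeasurable_comp hQ.continuous) (hQ.ae_mem hγ) hQ.lam_pos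
    hQ.lower_pos

theorem integrableOn_mul {φ : Space n × Space n → ℝ} (hφ : Continuous φ) :
    IntegrableOn (fun s => discountWeight Q lam γ s * φ (γ s, deriv γ s)) (Iic 0) := by
  obtain ⟨B, hB⟩ := hγ.exists_ae_bound hφ
  exact integrableOn_weight_mul (hγ.aestronglyMeasurable_comp hQ.continuous) (hQ.ae_mem hγ)
    hQ.lam_pos hQ.lower_pos (hγ.aestronglyMeasurable_comp hφ) hB

theorem integral_mem : ∫ s in Iic (0 : ℝ), discountWeight Q lam γ s ∈
    Icc (1 / (lam * k₂)) (1 / (lam * k₁)) :=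
  integral_weight_mem (hγ.aestronglyMeasurable_comp hQ.continuous) (hQ.ae_mem hγ) hQ.lam_pos
    hQ.lower_pos hQ.upper_pos

theorem integral_pos : 0 < ∫ s in Iic (0 : ℝ), discountWeight Q lam γ s :=
  lt_of_lt_of_le (one_div_pos.2 (mul_pos hQ.lam_pos hQ.upper_pos)) (hQ.integral_mem hγ).1

/-- The normalized weight is a probability density on the half line; the measure is its image under
position and velocity. -/
theorem exists_measure : ∃ ν : Measure (Space n × Space n), IsProbabilityMeasure ν ∧
    ∀ φ : Space n × Space n → ℝ, Continuous φ → ∫ q, φ q ∂ν =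
      (∫ s in Iic (0 : ℝ), discountWeight Q lam γ s * φ (γ s, deriv γ s)) /
        ∫ s in Iic (0 : ℝ), discountWeight Q lam γ s := by
  set Z := ∫ s in Iic (0 : ℝ), discountWeight Q lam γ s with hZ
  have hZ0 : 0 < Z := hQ.integral_pos hγ
  set μ₀ := (volume.restrict (Iic (0 : ℝ))).withDensity
    fun s => ENNReal.ofReal (discountWeight Q lam γ s / Z) with hμ₀
  have hint := (hQ.integrableOn hγ).div_const Z
  have hm : AEMeasurable (fun s => ENNReal.ofReal (discountWeight Q lam γ s / Z))
      (volume.restrict (Iic (0 : ℝ))) := hint.aestronglyMeasurable.aemeasurable.ennreal_ofReal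
  have hpos : ∀ s, 0 ≤ discountWeight Q lam γ s / Z := fun s =>
    div_nonneg (Real.exp_pos _).le hZ0.le
  have hprob : IsProbabilityMeasure μ₀ := by
    constructor
    rw [hμ₀, withDensity_apply _ MeasurableSet.univ, Measure.restrict_univ,
      ← ofReal_integral_eq_lintegral_ofReal hint (Eventually.of_forall hpos), integral_div,
      div_self hZ0.ne', ENNReal.ofReal_one]
  have hγm : AEMeasurable (fun s => (γ s, deriv γ s)) μ₀ :=
    hγ.aemeasurable.mono_ac (withDensity_absolutelyContinuous _ _)
  refine ⟨μ₀.map fun s => (γ s, deriv γ s), Measure.isProbabilityMeasure_map hγm, fun φ hφ => ?_⟩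
  rw [integral_map hγm hφ.measurable.aestronglyMeasurable, hμ₀,
    integral_withDensity_eq_integral_toReal_smul₀ hm (Eventually.of_forall fun s =>
      ENNReal.ofReal_lt_top), ← integral_div]
  refine integral_congr_ae (Eventually.of_forall fun s => ?_)
  simp only [smul_eq_mul, ENNReal.toReal_ofReal (hpos s)]
  ring

/-- The discounted measures of a bounded curve have compact support. -/
theorem ae_mem_and_integral_eq {ν : Measure (Space n × Space n)} (hν1 : IsProbabilityMeasure ν)
    (hν : ∀ φ : Space n × Space n → ℝ, Continuous φ → HasCompactSupport φ → ∫ q, φ q ∂ν =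
      (∫ s in Iic (0 : ℝ), discountWeight Q lam γ s * φ (γ s, deriv γ s)) /
        ∫ s in Iic (0 : ℝ), discountWeight Q lam γ s) :
    (∀ᵐ q ∂ν, q ∈ Metric.closedBall (0 : Space n) R ×ˢ Metric.closedBall (0 : Space n) V) ∧
    ∀ φ : Space n × Space n → ℝ, Continuous φ → ∫ q, φ q ∂ν =
      (∫ s in Iic (0 : ℝ), discountWeight Q lam γ s * φ (γ s, deriv γ s)) /
        ∫ s in Iic (0 : ℝ), discountWeight Q lam γ s := by
  have hK := (isCompact_closedBall (0 : Space n) R).prod (isCompact_closedBall (0 : Space n) V)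
  have hZ0 := hQ.integral_pos hγ
  have hcongr : ∀ φ ψ : Space n × Space n → ℝ, EqOn φ ψ
      (Metric.closedBall (0 : Space n) R ×ˢ Metric.closedBall (0 : Space n) V) →
      ∫ s in Iic (0 : ℝ), discountWeight Q lam γ s * φ (γ s, deriv γ s) =
      ∫ s in Iic (0 : ℝ), discountWeight Q lam γ s * ψ (γ s, deriv γ s) := by
    intro φ ψ h
    refine integral_congr_ae ?_
    filter_upwards [ae_restrict_mem measurableSet_Iic, ae_restrict_of_ae hγ.ae_mem] with s hs hs'
    rw [h (hs' hs)]
  have hmem := ae_mem_of_one_le_integral hK (μ := ν) fun f hf hfc hfK => by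
    rw [hν f hf hfc, hcongr f 1 hfK]
    simp only [Pi.one_apply, mul_one]
    rw [div_self hZ0.ne']
  refine ⟨hmem, fun φ hφ => ?_⟩
  obtain ⟨ψ, hψ, hψc, hψφ⟩ := exists_hasCompactSupport_eqOn hK hφ
  rw [← hcongr ψ φ hψφ, ← hν ψ hψ hψc]
  exact integral_congr_ae (by filter_upwards [hmem] with q hq using (hψφ hq).symm)

/-- Integration by parts along a bounded curve. -/
theorem integral_weight_mul_deriv {w : Space n → ℝ} (hwc : Continuous w) (hw : LocallyLip w) :
    (∃ B, ∀ᵐ s, s ≤ 0 → DifferentiableAt ℝ (fun s => w (γ s)) s ∧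
      |deriv (fun s => w (γ s)) s| ≤ B) ∧
    w z + lam * ∫ s in Iic (0 : ℝ), discountWeight Q lam γ s * (Q (γ s, deriv γ s) * w (γ s)) =
      ∫ s in Iic (0 : ℝ), discountWeight Q lam γ s * deriv (fun s => w (γ s)) s := by
  obtain ⟨M, hM0, hM⟩ := hw (R + 1)
  have hac : ∀ a ≤ 0, AbsolutelyContinuousOnInterval (fun s => w (γ s)) a 0 := fun a ha =>
    hw.comp_absolutelyContinuous (hγ.absolutelyContinuous a ha)
  have hd : ∀ᵐ s, s ≤ 0 → DifferentiableAt ℝ (fun s => w (γ s)) s := by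
    filter_upwards [ae_all_iff.2 fun k : ℕ => (hac (-(k : ℝ)) (by simp)).ae_differentiableAt]
      with s hs hs0
    obtain ⟨k, hk⟩ := exists_nat_gt (-s)
    exact hs k (by rw [uIcc_of_le (by simp)]; exact ⟨by linarith, hs0⟩)
  have hb : ∀ᵐ s, s ≤ 0 → |deriv (fun s => w (γ s)) s| ≤ M * V := by
    filter_upwards [hd, hγ.ae_deriv] with s hs1 hs2 hs0
    have h1 := abs_deriv_comp_le hM (hs2 hs0).1 (hs1 hs0).hasDerivAt
      (by linarith [hγ.norm_le s hs0])
    exact h1.trans (mul_le_mul_of_nonneg_left (hs2 hs0).2 hM0)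
  obtain ⟨B, hB⟩ := (isCompact_closedBall (0 : Space n) R).exists_bound_of_continuousOn
    hwc.continuousOn
  have := ContactHJ.integral_weight_mul_deriv (hγ.aestronglyMeasurable_comp hQ.continuous)
    (hQ.ae_mem hγ) hQ.lam_pos hQ.lower_pos (g := fun s => w (γ s)) hac
    ((hwc.comp_continuousOn hγ.continuousOn).aestronglyMeasurable measurableSet_Iic)
    (fun s hs => hB (γ s) (by simpa using hγ.norm_le s hs)) hb
  simp only [hγ.apply_zero] at this
  refine ⟨⟨M * V, ?_⟩, this⟩
  filter_upwards [hd, hb] with s h1 h2 h0 using ⟨h1 h0, h2 h0⟩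

end IsDiscount

theorem IsTonelli.exists_lagrangianQuotient_mem {G : Hamiltonian n} (hG : IsTonelli G)
    (hL : ∀ x v : Space n, DifferentiableAt ℝ (lagrangian G x v) 0) (R : ℝ) :
    ∃ k₁ k₂, 0 < k₁ ∧ 0 < k₂ ∧ ∀ x v u, ‖x‖ ≤ R → ‖v‖ ≤ R → |u| ≤ R →
      lagrangianQuotient G x v u ∈ Icc (-k₂) (-k₁) := by
  obtain ⟨k₁, hk₁, h⟩ := hG.lagrangianQuotient_le hL R
  obtain ⟨B, hB⟩ := ((isCompact_closedBall (0 : Space n) R).prod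
    ((isCompact_closedBall (0 : Space n) R).prod
    (isCompact_closedBall (0 : ℝ) R))).exists_bound_of_continuousOn
    (hG.continuous_lagrangianQuotient hL).continuousOn
  refine ⟨k₁, |B| + 1, hk₁, by positivity, fun x v u hx hv hu => ⟨?_, h x v u hx hv hu⟩⟩
  have h1 := hB (x, v, u) ⟨by simpa using hx, by simpa using hv, by simpa using hu⟩
  have h2 := neg_abs_le (lagrangianQuotient G x v u)
  have h3 := le_abs_self B
  rw [Real.norm_eq_abs] at h1
  linarith

theorem IsTonelli.continuous_lagrangianQuotient_comp {G : Hamiltonian n} (hG : IsTonelli G)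
    (hL : ∀ x v : Space n, DifferentiableAt ℝ (lagrangian G x v) 0) {X : Type*}
    [TopologicalSpace X] {x v : X → Space n} {u : X → ℝ} (hx : Continuous x) (hv : Continuous v)
    (hu : Continuous u) : Continuous fun z => lagrangianQuotient G (x z) (v z) (u z) :=
  (hG.continuous_lagrangianQuotient hL).comp (f := fun z => (x z, v z, u z)) (by fun_prop)

/-- The weighted action inequality along an infinite minimizer. -/
theorem IsDiscount.weighted_inequalities {G : Hamiltonian n} (hG : IsTonelli G) {c lam : ℝ}
    {u : Space n → ℝ} {k₁ k₂ R V : ℝ}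
    (hQ : IsDiscount (fun q : Space n × Space n => lagrangianQuotient G q.1 q.2 (lam * u q.1))
      lam k₁ k₂ R V) (hu : IsSubsolution G c lam u) (hlip : LocallyLip u)
    {γ : ℝ → Space n} {z : Space n} (hγ : IsBoundedCurve γ z R V)
    (hmin : IsInfiniteMinimizer (lagrangian G) c lam u z γ) {ν : Measure (Space n × Space n)}
    (hν : ∀ φ : Space n × Space n → ℝ, Continuous φ → ∫ q, φ q ∂ν =
      (∫ s in Iic (0 : ℝ), discountWeight
        (fun q : Space n × Space n => lagrangianQuotient G q.1 q.2 (lam * u q.1)) lam γ s *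
          φ (γ s, deriv γ s)) /
        ∫ s in Iic (0 : ℝ), discountWeight
          (fun q : Space n × Space n => lagrangianQuotient G q.1 q.2 (lam * u q.1)) lam γ s) :
    ∃ θ, lam * k₁ ≤ θ ∧ θ ≤ lam * k₂ ∧
      θ * u z = ∫ q : Space n × Space n, (lagrangian G q.1 q.2 0 + c) ∂ν ∧
      ∀ lam' w, IsSubsolution G c lam' w → LocallyLip w →
        θ * w z + lam * ∫ q : Space n × Space n,
            lagrangianQuotient G q.1 q.2 (lam * u q.1) * w q.1 ∂ν ≤
          ∫ q : Space n × Space n, (lagrangian G q.1 q.2 (lam' * w q.1) + c) ∂ν := by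
  set Q : Space n × Space n → ℝ := fun q => lagrangianQuotient G q.1 q.2 (lam * u q.1) with hQdef
  set ρ := discountWeight Q lam γ
  set Z := ∫ s in Iic (0 : ℝ), ρ s with hZ
  have hZ0 : 0 < Z := hQ.integral_pos hγ
  have hlam := hQ.lam_pos
  have hk₁ := hQ.lower_pos
  have hk₂ := hQ.upper_pos
  obtain ⟨hZ1, hZ2⟩ := hQ.integral_mem hγ
  have hLc : ∀ (lam' : ℝ) (w : Space n → ℝ), Continuous w → Continuous
      fun q : Space n × Space n => lagrangian G q.1 q.2 (lam' * w q.1) + c := fun lam' w hw =>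
    (hG.continuous_lagrangian_comp continuous_fst continuous_snd (by fun_prop)).add
      continuous_const
  have hQw : ∀ w : Space n → ℝ, Continuous w → Continuous
      fun q : Space n × Space n => lagrangianQuotient G q.1 q.2 (lam * u q.1) * w q.1 :=
    fun w hw => hQ.continuous.mul (hw.comp continuous_fst)
  -- The normalization of the measure, which is comparable to `lam` because the total weight is
  -- comparable to `1 / lam`.
  refine ⟨1 / Z, ?_, ?_, ?_, ?_⟩
  · rw [le_div_iff₀ hZ0]
    rw [le_div_iff₀ (by positivity)] at hZ2
    linarith
  · rw [div_le_iff₀ hZ0]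
    rw [div_le_iff₀ (by positivity)] at hZ1
    linarith
  · have hL0 : Continuous fun q : Space n × Space n => lagrangian G q.1 q.2 0 + c :=
      (hG.continuous_lagrangian_comp continuous_fst continuous_snd continuous_const).add
        continuous_const
    obtain ⟨-, hid⟩ := hQ.integral_weight_mul_deriv hγ hu.1 hlip
    rw [hν _ hL0]
    have h1 : IntegrableOn (fun s => ρ s * (Q (γ s, deriv γ s) * u (γ s))) (Iic 0) :=
      hQ.integrableOn_mul hγ (hQw u hu.1)
    have h2 : IntegrableOn (fun s => ρ s * (lagrangian G (γ s) (deriv γ s) 0 + c)) (Iic 0) :=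
      hQ.integrableOn_mul hγ hL0
    have h3 : ∫ s in Iic (0 : ℝ), ρ s * deriv (fun s => u (γ s)) s =
        ∫ s in Iic (0 : ℝ), (lam * (ρ s * (Q (γ s, deriv γ s) * u (γ s))) +
          ρ s * (lagrangian G (γ s) (deriv γ s) 0 + c)) := by
      refine integral_congr_ae ?_
      filter_upwards [ae_restrict_mem measurableSet_Iic,
        ae_restrict_of_ae (hG.ae_deriv_eq hu hlip hmin)] with s hs hs'
      -- Splitting the cost at `lam * u` into its value at `0` and `lam * u` times the index
      -- produces exactly the term that integration by parts cancels.
      have h4 := mul_lagrangianQuotient G (γ s) (deriv γ s) (lam * u (γ s))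
      rw [(hs' hs).2.deriv]
      have h5 : lagrangian G (γ s) (deriv γ s) (lam * u (γ s)) =
          lam * u (γ s) * Q (γ s, deriv γ s) + lagrangian G (γ s) (deriv γ s) 0 := by
        rw [hQdef]
        linarith
      rw [h5]
      ring
    rw [integral_add (h1.const_mul lam) h2, integral_const_mul] at h3
    rw [h3] at hid
    have h6 : u z = ∫ s in Iic (0 : ℝ), ρ s * (lagrangian G (γ s) (deriv γ s) 0 + c) := by
      linarith
    rw [← h6]
    ring
  · intro lam' w hw hwl
    obtain ⟨⟨B, hB⟩, hid⟩ := hQ.integral_weight_mul_deriv hγ hw.1 hwl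
    rw [hν _ (hLc lam' w hw.1), hν _ (hQw w hw.1)]
    have h1 := hQ.integrableOn_mul hγ (hLc lam' w hw.1)
    have hB1 : ∀ᵐ s, s ≤ 0 → |deriv (fun s => w (γ s)) s| ≤ B := by
      filter_upwards [hB] with s hs h0 using (hs h0).2
    have h2 := integrableOn_weight_mul (hγ.aestronglyMeasurable_comp hQ.continuous)
      (hQ.ae_mem hγ) hlam hk₁ (measurable_deriv fun s => w (γ s)).aestronglyMeasurable hB1
    have h3 : ∫ s in Iic (0 : ℝ), ρ s * deriv (fun s => w (γ s)) s ≤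
        ∫ s in Iic (0 : ℝ), ρ s * (lagrangian G (γ s) (deriv γ s) (lam' * w (γ s)) + c) := by
      refine integral_mono_ae h2 h1 ?_
      filter_upwards [ae_restrict_mem measurableSet_Iic, ae_restrict_of_ae hB,
        ae_restrict_of_ae hγ.ae_deriv] with s hs hs1 hs2
      exact mul_le_mul_of_nonneg_left (hG.deriv_comp_le hw hwl (hs2 hs).1 (hs1 hs).1.hasDerivAt)
        (Real.exp_pos _).le
    rw [← hid] at h3
    rw [le_div_iff₀ hZ0]
    refine le_trans (le_of_eq ?_) h3
    rw [add_mul, mul_assoc lam, div_mul_cancel₀ _ hZ0.ne']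
    field_simp
    rfl

/-- Uniform properties of the discounted measures of the infinite minimizers ending at `z`. -/
theorem exists_discounted_data {H G : Hamiltonian n} (h1 : AssumptionH1 H) (h2 : AssumptionH2 H)
    (h3 : AssumptionH3 H) (hG : (G = H ∧ IsSuperlinear H) ∨ G = superlinearization H)
    (hL : ∀ x v : Space n, DifferentiableAt ℝ (lagrangian G x v) 0)
    {u : ℝ → Space n → ℝ} (hu : ∀ lam, 0 < lam → IsMaximalSolution H lam (u lam)) (z : Space n) :
    ∃ lam₀, 0 < lam₀ ∧ lam₀ ≤ 1 ∧ ∃ (K : Set (Space n × Space n)) (k₁ k₂ : ℝ), IsCompact K ∧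
      0 < k₁ ∧ ∀ lam, 0 < lam → lam ≤ lam₀ →
      (∃ γ, IsInfiniteMinimizer (lagrangian G) (criticalValue H) lam (u lam) z γ) ∧
      ∀ γ, IsInfiniteMinimizer (lagrangian G) (criticalValue H) lam (u lam) z γ →
        (∃ ν, IsDiscountedMeasure (lagrangian G) lam (u lam) γ ν) ∧
        ∀ ν, IsDiscountedMeasure (lagrangian G) lam (u lam) γ ν → (∀ᵐ q ∂ν, q ∈ K) ∧
          ∃ θ, lam * k₁ ≤ θ ∧ θ ≤ lam * k₂ ∧
            θ * u lam z =
              ∫ q : Space n × Space n, (lagrangian G q.1 q.2 0 + criticalValue H) ∂ν ∧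
            ∀ lam' w, IsSubsolution G (criticalValue H) lam' w → LocallyLip w →
              θ * w z + lam * ∫ q : Space n × Space n,
                  lagrangianQuotient G q.1 q.2 (lam * u lam q.1) * w q.1 ∂ν ≤
                ∫ q : Space n × Space n,
                  (lagrangian G q.1 q.2 (lam' * w q.1) + criticalValue H) ∂ν := by
  obtain ⟨hT, hGeq, hHG⟩ := tonelli_data h1 h3 hG
  obtain ⟨M, C, N, hM0, hC0, hfam⟩ := exists_family_bounds h1 h2 h3 hu
  obtain ⟨lam₀, hlam₀, hlam₁, R, V, hR, hV, hmin⟩ := exists_minimizer_bounds h1 h2 h3 hG hu z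
  -- One radius that dominates positions, velocities and the values `lam * u`.
  obtain ⟨k₁, k₂, hk₁, hk₂, hk⟩ := hT.exists_lagrangianQuotient_mem hL (max R (max V (C R)))
  refine ⟨lam₀, hlam₀, hlam₁, Metric.closedBall 0 R ×ˢ Metric.closedBall 0 V, k₁, k₂,
    (isCompact_closedBall _ _).prod (isCompact_closedBall _ _), hk₁, fun lam hlam hle => ?_⟩
  obtain ⟨hex, hbd⟩ := hmin lam hlam hle
  obtain ⟨-, hLip, hB⟩ := hfam lam hlam (hle.trans hlam₁)
  have hsub : IsSubsolution G (criticalValue H) lam (u lam) := (hu lam hlam).1.1.congr hGeq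
  have hlip : LocallyLip (u lam) := fun R => ⟨M R, hM0 R, hLip R⟩
  refine ⟨hex, fun γ hγ => ?_⟩
  obtain ⟨hγR, hγV⟩ := hbd γ hγ
  have hbc : IsBoundedCurve γ z R V := by
    refine ⟨fun a ha => hγ.absolutelyContinuous ha le_rfl, hγ.continuousOn, hγ.apply_zero, hγR, ?_⟩
    filter_upwards [hγV, hT.ae_deriv_eq hsub hlip hγ] with s hs1 hs2 hs0
    exact ⟨(hs2 hs0).1, hs1 hs0⟩
  have huc := hsub.1
  have hQ : IsDiscount (fun q : Space n × Space n => lagrangianQuotient G q.1 q.2 (lam * u lam q.1))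
      lam k₁ k₂ R V := by
    refine ⟨hT.continuous_lagrangianQuotient_comp hL continuous_fst continuous_snd (by fun_prop),
      hlam, hk₁, hk₂, ?_⟩
    rintro ⟨x, v⟩ ⟨hx, hv⟩
    have hx : ‖x‖ ≤ R := by simpa using hx
    have hv : ‖v‖ ≤ V := by simpa using hv
    refine hk x v _ (hx.trans (le_max_left _ _))
      (hv.trans ((le_max_left _ _).trans (le_max_right _ _))) ?_
    refine le_trans ?_ ((le_max_right _ _).trans (le_max_right _ _))
    rw [abs_mul, abs_of_pos hlam]
    exact (mul_le_of_le_one_left (abs_nonneg _) (hle.trans hlam₁)).trans (hB R x hx)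
  have hweight : weight (lagrangian G) lam (u lam) γ = discountWeight
      (fun q : Space n × Space n => lagrangianQuotient G q.1 q.2 (lam * u lam q.1)) lam γ := by
    ext s
    simp only [weight, discountWeight, discountIndex_eq hlam (u lam) (hL _ _)]
  unfold IsDiscountedMeasure
  rw [hweight]
  refine ⟨?_, fun ν hν => ?_⟩
  · obtain ⟨ν, hν1, hν⟩ := hQ.exists_measure hbc
    exact ⟨ν, hν1, fun φ hφ _ => hν φ hφ⟩
  · obtain ⟨hmem, hint⟩ := hQ.ae_mem_and_integral_eq hbc hν.1 hν.2
    exact ⟨hmem, hQ.weighted_inequalities hT hsub hlip hbc hγ hint⟩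

/-! ### Limits of discounted measures -/

/-- Joint convergence in index and point is stable under products and composition with continuous
maps, so uniform convergence is checked in this form. -/
theorem tendstoLocallyUniformly_of_tendsto_prod {E : Type*} [TopologicalSpace E]
    {F : ℕ → E → ℝ} {g : E → ℝ} (hg : Continuous g)
    (h : ∀ x, Tendsto (fun p : ℕ × E => F p.1 p.2) (atTop ×ˢ 𝓝 x) (𝓝 (g x))) :
    TendstoLocallyUniformly F g atTop := by
  rw [Metric.tendstoLocallyUniformly_iff]
  intro ε hε x
  have h1 := Metric.tendsto_nhds.1 (h x) (ε / 2) (by positivity)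
  obtain ⟨pa, ha, pb, hb, hab⟩ := eventually_prod_iff.1 h1
  have h2 := Metric.tendsto_nhds.1 (hg.tendsto x) (ε / 2) (by positivity)
  refine ⟨_, hb.and h2, ?_⟩
  filter_upwards [ha] with j hj y hy
  have e1 := hab hj hy.1
  have e2 : dist (g y) (g x) < ε / 2 := hy.2
  have e3 := dist_triangle_right (g y) (F j y) (g x)
  linarith

theorem tendsto_prod_of_tendstoLocallyUniformly {E : Type*} [TopologicalSpace E]
    {F : ℕ → E → ℝ} {g : E → ℝ} (hg : Continuous g) (h : TendstoLocallyUniformly F g atTop) (x : E) :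
    Tendsto (fun p : ℕ × E => F p.1 p.2) (atTop ×ˢ 𝓝 x) (𝓝 (g x)) := by
  rw [Metric.tendstoLocallyUniformly_iff] at h
  rw [Metric.tendsto_nhds]
  intro ε hε
  obtain ⟨t, ht, hj⟩ := h (ε / 2) (by positivity) x
  have h2 := Metric.tendsto_nhds.1 (hg.tendsto x) (ε / 2) (by positivity)
  filter_upwards [hj.prod_mk (h2.and ht)] with p hp
  have e1 := hp.1 p.2 hp.2.2
  have e2 := hp.2.1
  have e3 := dist_triangle_left (F p.1 p.2) (g x) (g p.2)
  linarith

/-- Uniform convergence of the discount indices on compact sets. -/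
theorem IsTonelli.tendstoUniformlyOn_quotient {G : Hamiltonian n} (hG : IsTonelli G)
    (hL : ∀ x v : Space n, DifferentiableAt ℝ (lagrangian G x v) 0) {lam : ℕ → ℝ}
    (hlam : Tendsto lam atTop (𝓝 0)) {u w : ℕ → Space n → ℝ} {C : ℝ → ℝ}
    (hu : ∀ᶠ j in atTop, ∀ R x, ‖x‖ ≤ R → |u j x| ≤ C R) {U : Space n → ℝ} (hU : Continuous U)
    (hw : TendstoLocallyUniformly w U atTop) {K : Set (Space n × Space n)} (hK : IsCompact K) :
    TendstoUniformlyOn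
      (fun j (q : Space n × Space n) => lagrangianQuotient G q.1 q.2 (lam j * u j q.1) * w j q.1)
      (fun q => lagrangianQuotient G q.1 q.2 0 * U q.1) atTop K := by
  refine tendstoLocallyUniformly_iff_forall_isCompact.1
    (tendstoLocallyUniformly_of_tendsto_prod ?_ fun q => ?_) K hK
  · exact (hG.continuous_lagrangianQuotient_comp hL continuous_fst continuous_snd
      continuous_const).mul (hU.comp continuous_fst)
  have hq : Tendsto (fun p : ℕ × (Space n × Space n) => p.2) (atTop ×ˢ 𝓝 q) (𝓝 q) := tendsto_snd
  have hq1 : Tendsto (fun p : ℕ × (Space n × Space n) => p.2.1) (atTop ×ˢ 𝓝 q) (𝓝 q.1) :=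
    (continuous_fst.tendsto q).comp hq
  have hq2 : Tendsto (fun p : ℕ × (Space n × Space n) => p.2.2) (atTop ×ˢ 𝓝 q) (𝓝 q.2) :=
    (continuous_snd.tendsto q).comp hq
  have hzero : Tendsto (fun p : ℕ × (Space n × Space n) => lam p.1 * u p.1 p.2.1)
      (atTop ×ˢ 𝓝 q) (𝓝 0) := by
    have h1 : Tendsto (fun p : ℕ × (Space n × Space n) => |lam p.1| * C (‖q.1‖ + 1))
        (atTop ×ˢ 𝓝 q) (𝓝 (|0| * C (‖q.1‖ + 1))) :=
      ((hlam.comp tendsto_fst).abs).mul_const _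
    rw [abs_zero, zero_mul] at h1
    refine squeeze_zero_norm' ?_ h1
    filter_upwards [hu.prod_inl (𝓝 q), hq1.norm.eventually_lt_const (lt_add_one ‖q.1‖)]
      with p hp1 hp2
    rw [norm_mul, Real.norm_eq_abs, Real.norm_eq_abs]
    gcongr
    exact hp1 _ _ hp2.le
  have hw' : Tendsto (fun p : ℕ × (Space n × Space n) => w p.1 p.2.1) (atTop ×ˢ 𝓝 q)
      (𝓝 (U q.1)) :=
    (tendsto_prod_of_tendstoLocallyUniformly hU hw q.1).comp (tendsto_fst.prodMk hq1)
  have hQ := (hG.continuous_lagrangianQuotient hL).tendsto (q.1, q.2, 0)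
  exact (hQ.comp (hq1.prodMk_nhds (hq2.prodMk_nhds hzero))).mul hw'

/-- No mass escapes: a cutoff equal to `1` on `K` has integral `1` for all late measures, hence in
the limit. -/
theorem ae_mem_of_tendsto {E : Type*} [TopologicalSpace E] [T2Space E] [LocallyCompactSpace E]
    [MeasurableSpace E] [BorelSpace E] {K : Set E} {ν : ℕ → Measure E} {μ : Measure E}
    [IsProbabilityMeasure μ] [μ.Regular] (hK : IsCompact K)
    (hν1 : ∀ j, IsProbabilityMeasure (ν j)) (hν : ∀ᶠ j in atTop, ∀ᵐ q ∂ν j, q ∈ K)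
    (hlim : ∀ φ : E → ℝ, Continuous φ → HasCompactSupport φ →
      Tendsto (fun j => ∫ q, φ q ∂(ν j)) atTop (𝓝 (∫ q, φ q ∂μ))) : ∀ᵐ q ∂μ, q ∈ K := by
  refine ae_mem_of_one_le_integral hK fun f hf hfc hfK => ?_
  refine le_of_tendsto_of_tendsto tendsto_const_nhds (hlim f hf hfc) ?_
  filter_upwards [hν] with j hj
  have := hν1 j
  have h1 : ∫ q, f q ∂(ν j) = ∫ _, (1 : ℝ) ∂(ν j) :=
    integral_congr_ae (by filter_upwards [hj] with q hq using hfK hq)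
  rw [h1]
  simp

/-- Prokhorov's theorem; a common compact set makes the family tight. -/
theorem exists_subseq_of_ae_mem {K : Set (Space n × Space n)} (hK : IsCompact K)
    {ν : ℕ → Measure (Space n × Space n)} (hν1 : ∀ j, IsProbabilityMeasure (ν j))
    (hν : ∀ j, ∀ᵐ q ∂ν j, q ∈ K) :
    ∃ (μ : Measure (Space n × Space n)) (φ : ℕ → ℕ), IsProbabilityMeasure μ ∧ StrictMono φ ∧
      ∀ f : Space n × Space n → ℝ, Continuous f → HasCompactSupport f →
        Tendsto (fun j => ∫ q, f q ∂(ν (φ j))) atTop (𝓝 (∫ q, f q ∂μ)) := by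
  set P : ℕ → ProbabilityMeasure (Space n × Space n) := fun j => ⟨ν j, hν1 j⟩
  have htight : IsTightMeasureSet
      {((μ : ProbabilityMeasure (Space n × Space n)) : Measure (Space n × Space n)) |
        μ ∈ range P} := by
    rw [isTightMeasureSet_iff_exists_isCompact_measure_compl_le]
    refine fun ε _ => ⟨K, hK, ?_⟩
    rintro _ ⟨_, ⟨j, rfl⟩, rfl⟩
    have : ν j Kᶜ = 0 := hν j
    exact this.le.trans zero_le
  obtain ⟨μ, -, φ, hφ, hlim⟩ := (isCompact_closure_of_isTightMeasureSet htight).tendsto_subseq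
    (x := P) fun j => subset_closure ⟨j, rfl⟩
  refine ⟨μ, φ, inferInstance, hφ, fun f hf hfc => ?_⟩
  obtain ⟨B, hB⟩ := hfc.exists_bound_of_continuous hf
  exact (ProbabilityMeasure.tendsto_iff_forall_integral_tendsto.1 hlim)
    (BoundedContinuousFunction.ofNormedAddCommGroup f hf B hB)

theorem lagrangianQuotient_zero (G : Hamiltonian n) (x v : Space n) :
    lagrangianQuotient G x v 0 = deriv (lagrangian G x v) 0 :=
  if_pos rfl

/-- Limiting measures are minimizing and closed. -/
theorem limitingMeasures_spec {H G : Hamiltonian n} (h1 : AssumptionH1 H) (h2 : AssumptionH2 H)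
    (h3 : AssumptionH3 H) (hG : (G = H ∧ IsSuperlinear H) ∨ G = superlinearization H)
    (hL : ∀ x v : Space n, DifferentiableAt ℝ (lagrangian G x v) 0)
    {u : ℝ → Space n → ℝ} (hu : ∀ lam, 0 < lam → IsMaximalSolution H lam (u lam))
    {μ : Measure (Space n × Space n)}
    (hμ : μ ∈ limitingMeasures (lagrangian G) (criticalValue H) u) :
    IsProbabilityMeasure μ ∧ (∃ K, IsCompact K ∧ ∀ᵐ q ∂μ, q ∈ K) ∧
      ∫ q : Space n × Space n, (lagrangian G q.1 q.2 0 + criticalValue H) ∂μ = 0 ∧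
      ∀ lam' w, IsSubsolution G (criticalValue H) lam' w → LocallyLip w →
        0 ≤ ∫ q : Space n × Space n, (lagrangian G q.1 q.2 (lam' * w q.1) + criticalValue H) ∂μ := by
  obtain ⟨hμ1, z, lam, γ, ν, hlam, hlim, hγ, hν, hconv⟩ := hμ
  obtain ⟨hT, hGeq, hHG⟩ := tonelli_data h1 h3 hG
  obtain ⟨M, C, N, hM0, hC0, hfam⟩ := exists_family_bounds h1 h2 h3 hu
  obtain ⟨lam₀, hlam₀, hlam₁, K, k₁, k₂, hK, hk₁, hdata⟩ :=
    exists_discounted_data h1 h2 h3 hG hL hu z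
  have hsmall : ∀ᶠ j in atTop, lam j ≤ lam₀ :=
    (hlim.eventually_lt_const hlam₀).mono fun j hj => hj.le
  have hdata' := fun j hj => ((hdata (lam j) (hlam j) hj).2 (γ j) (hγ j)).2 (ν j) (hν j)
  have hν1 : ∀ j, IsProbabilityMeasure (ν j) := fun j => (hν j).1
  have hνK : ∀ᶠ j in atTop, ∀ᵐ q ∂ν j, q ∈ K := hsmall.mono fun j hj => (hdata' j hj).1
  have hμK := ae_mem_of_tendsto hK hν1 hνK hconv
  -- The factor is meaningful only for small parameters; elsewhere it is set to `0`.
  have hθ : ∀ j, ∃ θ, lam j ≤ lam₀ → lam j * k₁ ≤ θ ∧ θ ≤ lam j * k₂ ∧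
      θ * u (lam j) z =
        ∫ q : Space n × Space n, (lagrangian G q.1 q.2 0 + criticalValue H) ∂(ν j) ∧
      ∀ lam' w, IsSubsolution G (criticalValue H) lam' w → LocallyLip w →
        θ * w z + lam j * ∫ q : Space n × Space n,
            lagrangianQuotient G q.1 q.2 (lam j * u (lam j) q.1) * w q.1 ∂(ν j) ≤
          ∫ q : Space n × Space n,
            (lagrangian G q.1 q.2 (lam' * w q.1) + criticalValue H) ∂(ν j) := by
    intro j
    by_cases hj : lam j ≤ lam₀
    · obtain ⟨θ, h⟩ := (hdata' j hj).2
      exact ⟨θ, fun _ => h⟩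
    · exact ⟨0, fun h => absurd h hj⟩
  choose θ hθ using hθ
  have hθ0 : Tendsto θ atTop (𝓝 0) := by
    refine squeeze_zero' ?_ ?_ (show Tendsto (fun j => lam j * k₂) atTop (𝓝 0) by
      simpa using hlim.mul_const k₂)
    · filter_upwards [hsmall] with j hj
      exact (mul_pos (hlam j) hk₁).le.trans (hθ j hj).1
    · filter_upwards [hsmall] with j hj
      exact (hθ j hj).2.1
  have hconst : ∀ g : Space n × Space n → ℝ, Continuous g →
      Tendsto (fun j => ∫ q, g q ∂(ν j)) atTop (𝓝 (∫ q, g q ∂μ)) := fun g hg =>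
    tendsto_integral_of_ae_mem hK hν1 hνK hμK hconv (f := fun _ => g)
      (Eventually.of_forall fun _ => hg) hg
      (Metric.tendstoUniformlyOn_iff.2 fun ε hε => Eventually.of_forall fun j q _ => by
        simpa using hε)
  refine ⟨hμ1, ⟨K, hK, hμK⟩, ?_, fun lam' w hw hwl => ?_⟩
  · have hc : Continuous fun q : Space n × Space n =>
        lagrangian G q.1 q.2 0 + criticalValue H :=
      (hT.continuous_lagrangian_comp continuous_fst continuous_snd continuous_const).add
        continuous_const
    have h0 : Tendsto (fun j => θ j * u (lam j) z) atTop (𝓝 0) := by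
      have h1 : Tendsto (fun j => |θ j| * C ‖z‖) atTop (𝓝 0) := by
        simpa using hθ0.abs.mul_const (C ‖z‖)
      refine squeeze_zero_norm' ?_ h1
      filter_upwards [hsmall] with j hj
      rw [norm_mul, Real.norm_eq_abs, Real.norm_eq_abs]
      gcongr
      exact (hfam (lam j) (hlam j) (hj.trans hlam₁)).2.2 _ z le_rfl
    refine tendsto_nhds_unique (hconst _ hc) (h0.congr' ?_)
    filter_upwards [hsmall] with j hj using (hθ j hj).2.2.1
  · have hwc := hw.1
    have hc : Continuous fun q : Space n × Space n =>
        lagrangian G q.1 q.2 (lam' * w q.1) + criticalValue H :=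
      (hT.continuous_lagrangian_comp continuous_fst continuous_snd (by fun_prop)).add
        continuous_const
    have hq := tendsto_integral_of_ae_mem hK hν1 hνK hμK hconv
      (f := fun j q => lagrangianQuotient G q.1 q.2 (lam j * u (lam j) q.1) * w q.1)
      (g := fun q => lagrangianQuotient G q.1 q.2 0 * w q.1)
      (Eventually.of_forall fun j => by
        have := (hu (lam j) (hlam j)).1.1.1
        exact (hT.continuous_lagrangianQuotient_comp hL continuous_fst continuous_snd
          (by fun_prop)).mul (by fun_prop))
      ((hT.continuous_lagrangianQuotient_comp hL continuous_fst continuous_snd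
          (by fun_prop)).mul (by fun_prop))
      (hT.tendstoUniformlyOn_quotient hL hlim (u := fun j => u (lam j)) (w := fun _ => w) (C := C)
        (hsmall.mono fun j hj => (hfam (lam j) (hlam j) (hj.trans hlam₁)).2.2) hwc
        (tendstoLocallyUniformly_of_tendsto_prod hwc fun x => (hwc.tendsto x).comp tendsto_snd) hK)
    -- Both terms on the left carry a vanishing factor, `θ` or `lam`, while the integrals converge.
    have hleft := (hθ0.mul_const (w z)).add (hlim.mul hq)
    rw [zero_mul, zero_mul, add_zero] at hleft
    refine le_of_tendsto_of_tendsto hleft (hconst _ hc) ?_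
    filter_upwards [hsmall] with j hj using (hθ j hj).2.2.2 lam' w hw hwl

/-- Limits of the maximal solutions satisfy the constraints. -/
theorem mem_constrainedSubsolutions_of_tendsto {H G : Hamiltonian n} (h1 : AssumptionH1 H)
    (h2 : AssumptionH2 H) (h3 : AssumptionH3 H)
    (hG : (G = H ∧ IsSuperlinear H) ∨ G = superlinearization H)
    (hL : ∀ x v : Space n, DifferentiableAt ℝ (lagrangian G x v) 0)
    {u : ℝ → Space n → ℝ} (hu : ∀ lam, 0 < lam → IsMaximalSolution H lam (u lam))
    {lam : ℕ → ℝ} (hlam : ∀ j, 0 < lam j) (hlim : Tendsto lam atTop (𝓝 0)) {U : Space n → ℝ}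
    (hU : IsSubsolution H (criticalValue H) 0 U)
    (hconv : TendstoLocallyUniformly (fun j => u (lam j)) U atTop) :
    U ∈ constrainedSubsolutions H (lagrangian G)
      (limitingMeasures (lagrangian G) (criticalValue H) u) := by
  refine ⟨hU, fun μ hμ => ?_⟩
  obtain ⟨hμ1, ⟨K, hK, hμK⟩, hzero, hpos⟩ := limitingMeasures_spec h1 h2 h3 hG hL hu hμ
  obtain ⟨hT, hGeq, hHG⟩ := tonelli_data h1 h3 hG
  obtain ⟨M, C, N, hM0, hC0, hfam⟩ := exists_family_bounds h1 h2 h3 hu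
  have hUc := hU.1
  have hc0 : Continuous fun q : Space n × Space n => lagrangianQuotient G q.1 q.2 0 * U q.1 :=
    (hT.continuous_lagrangianQuotient_comp hL continuous_fst continuous_snd continuous_const).mul
      (by fun_prop)
  have heq : (fun q : Space n × Space n => U q.1 * deriv (lagrangian G q.1 q.2) 0) =
      fun q => lagrangianQuotient G q.1 q.2 0 * U q.1 := by
    ext q
    rw [lagrangianQuotient_zero, mul_comm]
  rw [heq]
  refine ⟨integrable_of_ae_mem hK hμK hc0, ?_⟩
  have hsmall : ∀ᶠ j in atTop, lam j ≤ 1 :=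
    (hlim.eventually_lt_const one_pos).mono fun j hj => hj.le
  have hcj : ∀ j, Continuous fun q : Space n × Space n =>
      lagrangianQuotient G q.1 q.2 (lam j * u (lam j) q.1) * u (lam j) q.1 := fun j => by
    have := (hu (lam j) (hlam j)).1.1.1
    exact (hT.continuous_lagrangianQuotient_comp hL continuous_fst continuous_snd
      (by fun_prop)).mul (by fun_prop)
  -- Here the measure is fixed and only the integrands vary.
  have hq := tendsto_integral_of_ae_mem hK (ν := fun _ => μ) (fun _ => hμ1)
    (Eventually.of_forall fun _ => hμK) hμK (fun _ _ _ => tendsto_const_nhds)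
    (Eventually.of_forall hcj) hc0
    (hT.tendstoUniformlyOn_quotient hL hlim (u := fun j => u (lam j)) (w := fun j => u (lam j))
      (C := C) (hsmall.mono fun j hj => (hfam (lam j) (hlam j) hj).2.2) hUc hconv hK)
  refine ge_of_tendsto hq ?_
  filter_upwards [hsmall] with j hj
  obtain ⟨-, hLip, -⟩ := hfam (lam j) (hlam j) hj
  -- The solutions themselves serve as competitors with their own parameter. As `μ` integrates `L(x,
  -- v, 0) + c` to zero, only `lam j` times the integral of the discount index against `u` remains.
  have hp := hpos (lam j) (u (lam j)) ((hu (lam j) (hlam j)).1.1.congr hGeq)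
    fun R => ⟨M R, hM0 R, hLip R⟩
  have hcL : Continuous fun q : Space n × Space n => lagrangian G q.1 q.2 0 + criticalValue H :=
    (hT.continuous_lagrangian_comp continuous_fst continuous_snd continuous_const).add
      continuous_const
  have hsplit : ∀ q : Space n × Space n,
      lagrangian G q.1 q.2 (lam j * u (lam j) q.1) + criticalValue H =
      lam j * (lagrangianQuotient G q.1 q.2 (lam j * u (lam j) q.1) * u (lam j) q.1) +
        (lagrangian G q.1 q.2 0 + criticalValue H) := fun q => by
    have := mul_lagrangianQuotient G q.1 q.2 (lam j * u (lam j) q.1)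
    linarith
  simp only [hsplit] at hp
  rw [integral_add ((integrable_of_ae_mem hK hμK (hcj j)).const_mul _)
    (integrable_of_ae_mem hK hμK hcL), hzero, add_zero, integral_const_mul] at hp
  exact nonneg_of_mul_nonneg_right hp (hlam j)

/-- Limits of the maximal solutions dominate the constrained subsolutions. -/
theorem le_of_mem_constrainedSubsolutions {H G : Hamiltonian n} (h1 : AssumptionH1 H)
    (h2 : AssumptionH2 H) (h3 : AssumptionH3 H)
    (hG : (G = H ∧ IsSuperlinear H) ∨ G = superlinearization H)
    (hL : ∀ x v : Space n, DifferentiableAt ℝ (lagrangian G x v) 0)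
    {u : ℝ → Space n → ℝ} (hu : ∀ lam, 0 < lam → IsMaximalSolution H lam (u lam))
    {lam : ℕ → ℝ} (hlam : ∀ j, 0 < lam j) (hlim : Tendsto lam atTop (𝓝 0)) {z : Space n} {a : ℝ}
    (hconv : Tendsto (fun j => u (lam j) z) atTop (𝓝 a)) {w : Space n → ℝ}
    (hw : w ∈ constrainedSubsolutions H (lagrangian G)
      (limitingMeasures (lagrangian G) (criticalValue H) u)) : w z ≤ a := by
  obtain ⟨hws, hwμ⟩ := hw
  obtain ⟨hT, hGeq, hHG⟩ := tonelli_data h1 h3 hG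
  obtain ⟨M, C, N, hM0, hC0, hfam⟩ := exists_family_bounds h1 h2 h3 hu
  obtain ⟨lam₀, hlam₀, hlam₁, K, k₁, k₂, hK, hk₁, hdata⟩ :=
    exists_discounted_data h1 h2 h3 hG hL hu z
  -- The shift by `J` makes every parameter small enough for minimizers and measures to exist.
  obtain ⟨J, hJ⟩ := eventually_atTop.1 ((hlim.eventually_lt_const hlam₀).mono fun j hj => hj.le)
  have hsmall : ∀ j, lam (j + J) ≤ lam₀ := fun j => hJ _ (Nat.le_add_left _ _)
  choose γ hγ using fun j => (hdata (lam (j + J)) (hlam _) (hsmall j)).1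
  have hdata' := fun j => (hdata (lam (j + J)) (hlam _) (hsmall j)).2 (γ j) (hγ j)
  choose ν hν using fun j => (hdata' j).1
  choose hνK θ hθ1 hθ2 hθu hθw using fun j => (hdata' j).2 (ν j) (hν j)
  obtain ⟨μ, φ, hμ1, hφ, hφlim⟩ := exists_subseq_of_ae_mem hK (fun j => (hν j).1) hνK
  have htend : Tendsto (fun j => φ j + J) atTop atTop :=
    (tendsto_add_atTop_nat J).comp hφ.tendsto_atTop
  have hlimφ : Tendsto (fun j => lam (φ j + J)) atTop (𝓝 0) := hlim.comp htend
  have hμmem : μ ∈ limitingMeasures (lagrangian G) (criticalValue H) u :=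
    ⟨hμ1, z, fun j => lam (φ j + J), fun j => γ (φ j), fun j => ν (φ j), fun j => hlam _, hlimφ,
      fun j => hγ _, fun j => hν _, hφlim⟩
  obtain ⟨-, hpos⟩ := hwμ μ hμmem
  obtain ⟨M', hM0', hM'⟩ := h1.exists_lipschitz (criticalValue H) 0
  have hwl : LocallyLip w := fun R => ⟨M' R, hM0' R, hM' 0 w hws (by simp) R⟩
  have hwc := hws.1
  have hνK' : ∀ᶠ j in atTop, ∀ᵐ q ∂ν (φ j), q ∈ K := Eventually.of_forall fun j => hνK _
  have hq := tendsto_integral_of_ae_mem hK (fun j => (hν (φ j)).1) hνK'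
    (ae_mem_of_tendsto hK (fun j => (hν (φ j)).1) hνK' hφlim) hφlim
    (f := fun j q => lagrangianQuotient G q.1 q.2 (lam (φ j + J) * u (lam (φ j + J)) q.1) * w q.1)
    (g := fun q => lagrangianQuotient G q.1 q.2 0 * w q.1)
    (Eventually.of_forall fun j => by
      have := (hu (lam (φ j + J)) (hlam _)).1.1.1
      exact (hT.continuous_lagrangianQuotient_comp hL continuous_fst continuous_snd
        (by fun_prop)).mul (by fun_prop))
    ((hT.continuous_lagrangianQuotient_comp hL continuous_fst continuous_snd
        (by fun_prop)).mul (by fun_prop))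
    (hT.tendstoUniformlyOn_quotient hL hlimφ (u := fun j => u (lam (φ j + J))) (w := fun _ => w)
      (C := C) (Eventually.of_forall fun j =>
        (hfam (lam (φ j + J)) (hlam _) ((hsmall _).trans hlam₁)).2.2) hwc
      (tendstoLocallyUniformly_of_tendsto_prod hwc fun x => (hwc.tendsto x).comp tendsto_snd) hK)
  have heq : (fun q : Space n × Space n => w q.1 * deriv (lagrangian G q.1 q.2) 0) =
      fun q => lagrangianQuotient G q.1 q.2 0 * w q.1 := by
    ext q
    rw [lagrangianQuotient_zero, mul_comm]
  rw [heq] at hpos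
  by_contra! hlt
  set η := (w z - a) / 2 with hη
  have hη0 : 0 < η := by linarith
  have hev : ∀ᶠ j in atTop, u (lam (φ j + J)) z < a + η :=
    (hconv.comp htend).eventually_lt_const (by linarith)
  -- Subtracting the identity for `u` from the inequality for `w` with parameter `0` cancels the
  -- cost. The factor `θ ≥ lam * k₁` lets `lam` be divided out and leaves a strictly negative bound
  -- in the limit.
  have hle : ∫ q : Space n × Space n, lagrangianQuotient G q.1 q.2 0 * w q.1 ∂μ ≤ -(k₁ * η) := by
    refine le_of_tendsto hq ?_
    filter_upwards [hev] with j hj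
    have e1 := hθw (φ j) 0 w (hws.congr hGeq) hwl
    simp only [zero_mul] at e1
    rw [← hθu (φ j)] at e1
    have e2 : θ (φ j) * η ≤ θ (φ j) * (w z - u (lam (φ j + J)) z) := by
      have := (mul_pos (hlam (φ j + J)) hk₁).le.trans (hθ1 (φ j))
      gcongr
      linarith
    have e3 : lam (φ j + J) * k₁ * η ≤ θ (φ j) * η := by
      gcongr
      exact hθ1 (φ j)
    refine le_of_mul_le_mul_left ?_ (hlam (φ j + J))
    linarith
  have := mul_pos hk₁ hη0
  linarith

/-- Compactness of the maximal solutions as the parameter tends to zero. -/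
theorem exists_subseq_solution {H : Hamiltonian n} (h1 : AssumptionH1 H) (h2 : AssumptionH2 H)
    (h3 : AssumptionH3 H) {u : ℝ → Space n → ℝ}
    (hu : ∀ lam, 0 < lam → IsMaximalSolution H lam (u lam)) {lam : ℕ → ℝ}
    (hlam : ∀ j, lam j ∈ Ioc 0 1) (hlim : Tendsto lam atTop (𝓝 0)) :
    ∃ (U : Space n → ℝ) (φ : ℕ → ℕ), StrictMono φ ∧ IsSolution H (criticalValue H) 0 U ∧
      TendstoLocallyUniformly (fun j => u (lam (φ j))) U atTop := by
  obtain ⟨M, C, N, hM0, hC0, hfam⟩ := exists_family_bounds h1 h2 h3 hu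
  obtain ⟨U, φ, hφ, hconv, hUL⟩ := exists_subseq_tendstoLocallyUniformly
    (f := fun j => u (lam j)) (M := M) (δ := fun _ => 0)
    (fun x => ⟨C ‖x‖, fun j => (hfam _ (hlam j).1 (hlam j).2).2.2 _ x le_rfl⟩) tendsto_const_nhds
    (fun R j x y hx hy => by
      simpa using (hfam _ (hlam j).1 (hlam j).2).2.1 R y x hy hx)
  have hc : ∀ j, Continuous (u (lam (φ j))) := fun j => (hu _ (hlam (φ j)).1).1.1.1
  have hUc : Continuous U := hconv.continuous (Frequently.of_forall hc)
  refine ⟨U, φ, hφ, ⟨?_, ?_⟩, hconv⟩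
  · exact isSubsolution_of_tendstoLocallyUniformly h1.continuous hUc
      (hlim.comp hφ.tendsto_atTop) tendsto_const_nhds
      (Eventually.of_forall fun j => (hu _ (hlam (φ j)).1).1.1) hconv
  · exact isSupersolution_of_tendstoLocallyUniformly h1.continuous hUc
      (hlim.comp hφ.tendsto_atTop) tendsto_const_nhds
      (Eventually.of_forall fun j => (hu _ (hlam (φ j)).1).1.2) hconv

/-- Subsequential limits of the maximal solutions are greatest constrained subsolutions. -/
theorem exists_subseq_isGreatest {H G : Hamiltonian n} (h1 : AssumptionH1 H)
    (h2 : AssumptionH2 H) (h3 : AssumptionH3 H)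
    (hG : (G = H ∧ IsSuperlinear H) ∨ G = superlinearization H)
    (hL : ∀ x v : Space n, DifferentiableAt ℝ (lagrangian G x v) 0)
    {u : ℝ → Space n → ℝ} (hu : ∀ lam, 0 < lam → IsMaximalSolution H lam (u lam)) {lam : ℕ → ℝ}
    (hlam : ∀ j, lam j ∈ Ioc 0 1) (hlim : Tendsto lam atTop (𝓝 0)) :
    ∃ (U : Space n → ℝ) (φ : ℕ → ℕ), StrictMono φ ∧ IsSolution H (criticalValue H) 0 U ∧
      TendstoLocallyUniformly (fun j => u (lam (φ j))) U atTop ∧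
      IsGreatest (constrainedSubsolutions H (lagrangian G)
        (limitingMeasures (lagrangian G) (criticalValue H) u)) U := by
  obtain ⟨U, φ, hφ, hU, hconv⟩ := exists_subseq_solution h1 h2 h3 hu hlam hlim
  have hlim' := hlim.comp hφ.tendsto_atTop
  refine ⟨U, φ, hφ, hU, hconv, mem_constrainedSubsolutions_of_tendsto h1 h2 h3 hG hL hu
    (fun j => (hlam (φ j)).1) hlim' hU.1 hconv, fun w hw z => ?_⟩
  exact le_of_mem_constrainedSubsolutions h1 h2 h3 hG hL hu (fun j => (hlam (φ j)).1) hlim'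
    (hconv.tendstoLocallyUniformlyOn.tendsto_at (mem_univ z)) hw

end ContactHJ

/-! ### Convergence of the whole family -/

theorem theorem1p1 {n : ℕ} (H : ContactHJ.Hamiltonian n)
    (h1 : ContactHJ.AssumptionH1 H) (h2 : ContactHJ.AssumptionH2 H)
    (h3 : ContactHJ.AssumptionH3 H)
    (hP : ContactHJ.AssumptionP1 H ∨ ContactHJ.AssumptionP2 H ∨ ContactHJ.AssumptionP3 H)
    -- the superlinear Hamiltonian that defines the Lagrangian: `H` itself if `H` is superlinear,
    -- or its superlinear modification
    (G : ContactHJ.Hamiltonian n)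
    (hG : (G = H ∧ ContactHJ.IsSuperlinear H) ∨ G = ContactHJ.superlinearization H)
    -- the partial derivative of the Lagrangian that appears in the conclusion exists
    (hL : ∀ x v : ContactHJ.Space n, DifferentiableAt ℝ (ContactHJ.lagrangian G x v) 0) :
    (∀ lam : ℝ, 0 < lam → ∃ v : ContactHJ.Space n → ℝ, ContactHJ.IsMaximalSolution H lam v) ∧
    ∀ u : ℝ → ContactHJ.Space n → ℝ,
      (∀ lam : ℝ, 0 < lam → ContactHJ.IsMaximalSolution H lam (u lam)) →
      ∃ u₀ : ContactHJ.Space n → ℝ,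
        ContactHJ.IsSolution H (ContactHJ.criticalValue H) 0 u₀ ∧
        TendstoLocallyUniformly u u₀ (𝓝[>] (0 : ℝ)) ∧
        ∀ x : ContactHJ.Space n,
          IsLUB ((fun w : ContactHJ.Space n → ℝ => w x) ''
            ContactHJ.constrainedSubsolutions H (ContactHJ.lagrangian G)
              (ContactHJ.limitingMeasures (ContactHJ.lagrangian G)
                (ContactHJ.criticalValue H) u)) (u₀ x) := by
  refine ⟨fun lam hlam => ?_, fun u hu => ?_⟩
  · obtain ⟨U, hU, hmax⟩ := ContactHJ.exists_solution_ge_subsolutions h1 h2 h3 hlam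
    exact ⟨U, hU, fun v hv => hmax v hv.1⟩
  obtain ⟨u₀, φ₀, -, hsol, -, hgr⟩ := ContactHJ.exists_subseq_isGreatest h1 h2 h3 hG hL hu
    (lam := fun j : ℕ => 1 / ((j : ℝ) + 1))
    (fun j => ⟨by positivity, div_le_one_of_le₀ (by simp) (by positivity)⟩)
    tendsto_one_div_add_atTop_nhds_zero_nat
  refine ⟨u₀, hsol, ?_, fun x => ?_⟩
  · rw [tendstoLocallyUniformly_iff_forall_isCompact]
    intro K hK
    rw [Metric.tendstoUniformlyOn_iff]
    intro ε hε
    -- A failure of convergence gives parameters tending to zero that stay `ε`-far from `u₀` on `K`.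
    -- A further subsequence converges to a greatest element of the same set, which must be `u₀`.
    by_contra hcon
    have hpos : ∀ᶠ lam : ℝ in 𝓝[>] (0 : ℝ), lam ∈ Ioc (0 : ℝ) 1 := Ioc_mem_nhdsGT one_pos
    obtain ⟨lam, hlim, hlam⟩ := exists_seq_forall_of_frequently
      ((not_eventually.1 hcon).and_eventually hpos)
    obtain ⟨U, φ, -, -, hconv, hgr'⟩ := ContactHJ.exists_subseq_isGreatest h1 h2 h3 hG hL hu
      (fun j => (hlam j).2) (hlim.mono_right nhdsWithin_le_nhds)
    rw [hgr'.unique hgr] at hconv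
    obtain ⟨j, hj⟩ := (Metric.tendstoUniformlyOn_iff.1
      (tendstoLocallyUniformly_iff_forall_isCompact.1 hconv K hK) ε hε).exists
    exact (hlam (φ j)).1 hj
  · exact ⟨by rintro _ ⟨w, hw, rfl⟩; exact hgr.2 hw x, fun b hb => hb ⟨u₀, hgr.1, rfl⟩⟩
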